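/- For $n\ge 1$ let $X_0=0,X_1,\dots,X_n$ be the $n$-step equilateral isotropic random walk in $\mathbb R^2$: the steps $X_k-X_{k-1}$ are independent and uniformly distributed on the unit circle. The $n$-step two-dimensional equilateral isotropic random polygon is this walk conditioned on the event $X_n=X_0$; since this event has probability zero, its law is understood as the weak limit, as $\varepsilon\to 0^+$, of the conditional laws of the walk (as a random sequence of steps) given $|X_n-X_0|<\varepsilon$. Let $K'_n$ be the number of self-intersections of the polygon, that is, the number of pairs $1\le k<l\le n$ with $l-k\ge 2$ and $l-k\ne n-1$ such that the segments $[X_{k-1},X_k]$ and $[X_{l-1},X_l]$ meet at a point interior to both. Then for all sufficiently large $n$ the law of the random polygon exists (and is unique), and $$\operatorname{Var}[K'_n]=O(n^2\log n)\qquad (n\to\infty),$$ that is, there is a constant $C$ such that $\operatorname{Var}[K'_n]\le C\,n^2\log n$ for all sufficiently large $n$. -/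

import Mathlib

open Filter Topology MeasureTheory ProbabilityTheory

namespace RandomPolygon

/-- The law of one isotropic step of unit length in the plane `ℂ = ℝ²`: the point `exp (i θ)`
with `θ` uniformly distributed on `(-π, π]`. -/
noncomputable def stepLaw : Measure ℂ :=
  (ProbabilityTheory.cond volume (Set.Ioc (-Real.pi) Real.pi)).map
    (fun θ : ℝ => Complex.exp (θ * Complex.I))

/-- The joint law of the `n` independent steps of the equilateral isotropic random walk. -/
noncomputable def walkLaw (n : ℕ) : Measure (Fin n → ℂ) :=
  Measure.pi (fun _ => stepLaw)

/-- The `k`-th vertex `X_k` of the walk with steps `s`, which starts at `X_0 = 0`: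
the sum of the first `k` steps. -/
noncomputable def vertex {n : ℕ} (s : Fin n → ℂ) (k : ℕ) : ℂ :=
  ∑ i ∈ Finset.univ.filter (fun i : Fin n => i.val < k), s i

/-- `P` is the law of the steps of the `n`-step equilateral isotropic random polygon, that is, of
the random walk conditioned on the null event `X_n = X_0`: as `ε → 0`, the conditional laws of the
walk given `‖X_n - X_0‖ < ε` converge weakly to the probability measure `P`. -/
def IsPolygonLaw (n : ℕ) (P : Measure (Fin n → ℂ)) : Prop :=
  IsProbabilityMeasure P ∧
    ∀ g : BoundedContinuousFunction (Fin n → ℂ) ℝ,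
      Tendsto
        (fun ε : ℝ =>
          ∫ s, g s ∂(ProbabilityTheory.cond (walkLaw n) {s | ‖vertex s n - vertex s 0‖ < ε}))
        (𝓝[>] 0) (𝓝 (∫ s, g s ∂P))

/-- Edge number `i` (counted from `0`), from `X_i` to `X_{i+1}`, and edge number `j` meet at a
point that is interior to both. -/
def EdgesCross {n : ℕ} (s : Fin n → ℂ) (i j : ℕ) : Prop :=
  (openSegment ℝ (vertex s i) (vertex s (i + 1)) ∩
    openSegment ℝ (vertex s j) (vertex s (j + 1))).Nonempty

/-- The number of self-intersections of the closed polygon with steps `s`: the number of pairs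
`i < j` of edges that are not adjacent along the polygon (`j - i ≥ 2` and `j - i ≠ n - 1`) and
that meet at a point interior to both. -/
noncomputable def selfIntersections (n : ℕ) (s : Fin n → ℂ) : ℕ :=
  Set.ncard {p : Fin n × Fin n |
    (p.1 : ℕ) + 2 ≤ (p.2 : ℕ) ∧ (p.2 : ℕ) ≠ (p.1 : ℕ) + (n - 1) ∧ EdgesCross s p.1 p.2}

end RandomPolygon

/-!
Let `W` be the law of the walk and `P` that of the polygon. The variance is computed by expanding
`K = ∑ 1_p`, the sum of the indicators of the crossings of the pairs `p` of edges, and comparing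
`P(p)` and `P(p ∩ q)` with the corresponding probabilities of the walk; pairs of crossings that are
far apart then contribute nothing to leading order.

**Local limit bounds.** The characteristic function of a step is the Bessel function
`J₀ (2π ‖w‖)`, which is at most `(1 + ‖w‖²) ^ (-κ)` in absolute value for some `κ > 0`
(`exists_abs_besselZero_le`). Hence, once `d ≥ smoothRank`, the sum of `d` steps has a continuous
density `sumDensity d`, bounded by the `L¹` norm `densityBound d` of its characteristic function.
Instead of a local limit theorem it is enough to know how this density varies with `d`:
for `m = n - d + 2` the quotient of `densityBound d` and `sumDensity n 0` is at most `1 + O(m / d)`,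
and `sumDensity d y / sumDensity n 0 ≥ 1 - O(m / n)` for `‖y‖ ≤ 2` and `d ≥ n / 2`
(`exists_sumDensity_compare`).

**The polygon.** The conditional laws live on a compact set, and their characteristic functions
converge, so that they converge weakly to a measure `P` (`exists_isPolygonLaw`). Outside of a block
`D` of `d ≥ smoothRank` steps, `P` has the density `sumDensity d (-x) / sumDensity n 0` with
respect to the walk, `x` being the sum of the steps outside of `D` (`IsPolygonLaw.map_keep_eq`).
So an event that does not involve the steps in `D` has nearly the same probability under both laws
if `D` contains most of the steps, and under `P` it is never more than `O(n / d)` times as likely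
as under `W`.

**Crossings.** If the edges `i < j` cross, the steps between them add up to a vector of length at
most `2`, which has probability `O(1 / (j - i))`. Two crossings that are nested or interlaced force
two such bounds for sums that can be decoupled (`exists_measureReal_crossing_le`); two crossings at
disjoint places are independent under `W`. Carried over to `P`, this yields
`P(p) ≥ W(p) - O(1 / n)` and `P(p ∩ q) ≤ W(p) W(q) + O(pairError p q)`
(`exists_crossing_bounds`).

**Summation.** The total of `pairError` over all `p` and `q` is `O(n² log n)`
(`sum_pairError_le`), and `Q = ∑ W(p) = O(n log n)`. Therefore
`Var K ≤ Q² + O(n² log n) - (Q - O(n))² = O(n² log n)` (`exists_variance_le`).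
-/

namespace RandomPolygon

open scoped FourierTransform RealInnerProductSpace

/-! ### The radial profile of the characteristic function of a step -/

/-- The Bessel function `J₀`, in its integral form: the value at any `w` with `‖w‖ = R` of the
characteristic function of the uniform distribution on the unit circle. -/
noncomputable def besselZero (R : ℝ) : ℝ :=
  (2 * Real.pi)⁻¹ * ∫ θ in (-Real.pi)..Real.pi, Real.cos (R * Real.cos θ)

lemma continuous_besselZero : Continuous besselZero := by
  unfold besselZero
  refine continuous_const.mul ?_
  apply intervalIntegral.continuous_parametric_intervalIntegral_of_continuous'
  fun_prop

lemma abs_besselZero_le_one (R : ℝ) : |besselZero R| ≤ 1 := by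
  have h := intervalIntegral.norm_integral_le_of_norm_le_const (a := -Real.pi) (b := Real.pi)
    (f := fun θ => Real.cos (R * Real.cos θ)) (C := 1) (fun θ _ => by
      simpa using Real.abs_cos_le_one _)
  have hp := Real.pi_pos
  rw [Real.norm_eq_abs, show Real.pi - -Real.pi = 2 * Real.pi by ring, one_mul,
    abs_of_pos (by positivity : 0 < 2 * Real.pi)] at h
  unfold besselZero
  rw [abs_mul, abs_of_pos (by positivity : 0 < (2 * Real.pi)⁻¹), inv_mul_le_iff₀ (by positivity)]
  linarith

lemma besselZero_le_of_forall_cos_le {R b a : ℝ}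
    (h : ∀ θ, Real.cos (R * Real.cos θ) ≤ a + b * Real.cos θ ^ 2) :
    besselZero R ≤ a + b / 2 := by
  have hp := Real.pi_pos
  have h1 : ∫ θ in (-Real.pi)..Real.pi, Real.cos (R * Real.cos θ)
      ≤ ∫ θ in (-Real.pi)..Real.pi, (a + b * Real.cos θ ^ 2) := by
    apply intervalIntegral.integral_mono_on (by linarith)
    · apply Continuous.intervalIntegrable; fun_prop
    · apply Continuous.intervalIntegrable; fun_prop
    · intro θ _; exact h θ
  rw [intervalIntegral.integral_add (by simp) (by apply Continuous.intervalIntegrable; fun_prop),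
    intervalIntegral.integral_const_mul, integral_cos_sq] at h1
  simp at h1
  unfold besselZero
  rw [inv_mul_le_iff₀ (by positivity)]
  linarith

lemma le_besselZero_of_forall_le_cos {R b a : ℝ}
    (h : ∀ θ, a + b * Real.cos θ ^ 2 ≤ Real.cos (R * Real.cos θ)) :
    a + b / 2 ≤ besselZero R := by
  have hp := Real.pi_pos
  have h1 : ∫ θ in (-Real.pi)..Real.pi, (a + b * Real.cos θ ^ 2)
      ≤ ∫ θ in (-Real.pi)..Real.pi, Real.cos (R * Real.cos θ) := by
    apply intervalIntegral.integral_mono_on (by linarith)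
    · apply Continuous.intervalIntegrable; fun_prop
    · apply Continuous.intervalIntegrable; fun_prop
    · intro θ _; exact h θ
  rw [intervalIntegral.integral_add (by simp) (by apply Continuous.intervalIntegrable; fun_prop),
    intervalIntegral.integral_const_mul, integral_cos_sq] at h1
  simp at h1
  unfold besselZero
  rw [le_inv_mul_iff₀ (by positivity)]
  linarith

lemma one_sub_le_besselZero (R : ℝ) : 1 - R ^ 2 / 4 ≤ besselZero R := by
  have := le_besselZero_of_forall_le_cos (R := R) (a := 1) (b := -(R ^ 2 / 2)) (fun θ => by
    have := Real.one_sub_sq_div_two_le_cos (x := R * Real.cos θ)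
    nlinarith)
  linarith

lemma besselZero_le_one_sub {R : ℝ} (h0 : 0 ≤ R) (h1 : R ≤ 1) :
    besselZero R ≤ 1 - R ^ 2 / Real.pi ^ 2 := by
  have := besselZero_le_of_forall_cos_le (R := R) (a := 1) (b := -(2 / Real.pi ^ 2 * R ^ 2))
    (fun θ => by
      have := Real.cos_le_one_sub_mul_cos_sq (x := R * Real.cos θ) (by
        rw [abs_mul, abs_of_nonneg h0]
        have := Real.abs_cos_le_one θ
        have := Real.pi_gt_three
        nlinarith [abs_nonneg (Real.cos θ)])
      nlinarith)
  calc _ ≤ _ := this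
    _ = _ := by ring

/-- If `J₀ R = ±1`, then `cos (R cos θ) = ±1` for all `θ` by continuity, which for `R ≠ 0` fails
for a `θ` at which `R cos θ` is small and nonzero. -/
lemma abs_besselZero_lt_one {R : ℝ} (hR : 0 < R) : |besselZero R| < 1 := by
  have hp := Real.pi_pos
  have key : ∀ σ : ℝ, |σ| = 1 → 0 < ∫ θ in (-Real.pi)..Real.pi,
      (1 - σ * Real.cos (R * Real.cos θ)) := by
    intro σ hσ
    -- a point where `R cos θ` lies strictly between `0` and `π`
    obtain ⟨θ, hθ, hθ1, hθ2⟩ : ∃ θ ∈ Set.Icc (-Real.pi) Real.pi,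
        0 < R * Real.cos θ ∧ R * Real.cos θ < Real.pi := by
      refine ⟨Real.arccos (min 1 (1 / R)), ⟨?_, Real.arccos_le_pi _⟩, ?_⟩
      · linarith [Real.arccos_nonneg (min 1 (1 / R))]
      · have h1 : 0 < min 1 (1 / R) := by positivity
        rw [Real.cos_arccos (by linarith) (min_le_left _ _)]
        refine ⟨by positivity, ?_⟩
        have : R * min 1 (1 / R) ≤ R * (1 / R) := by gcongr; exact min_le_right _ _
        rw [mul_one_div_cancel hR.ne'] at this
        linarith [Real.pi_gt_three]
    have hcos : |Real.cos (R * Real.cos θ)| < 1 := by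
      rw [← sq_lt_one_iff_abs_lt_one]
      nlinarith [Real.sin_sq_add_cos_sq (R * Real.cos θ),
        pow_pos (Real.sin_pos_of_pos_of_lt_pi hθ1 hθ2) 2]
    apply intervalIntegral.integral_pos (by linarith)
    · fun_prop
    · intro x _
      have : |σ * Real.cos (R * Real.cos x)| ≤ 1 := by
        rw [abs_mul, hσ, one_mul]; exact Real.abs_cos_le_one _
      linarith [le_abs_self (σ * Real.cos (R * Real.cos x))]
    · refine ⟨θ, hθ, ?_⟩
      have : |σ * Real.cos (R * Real.cos θ)| < 1 := by rwa [abs_mul, hσ, one_mul]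
      linarith [le_abs_self (σ * Real.cos (R * Real.cos θ))]
  have key2 : ∀ σ : ℝ, |σ| = 1 → σ * besselZero R < 1 := by
    intro σ hσ
    have h := key σ hσ
    rw [intervalIntegral.integral_sub (by simp) (by apply Continuous.intervalIntegrable; fun_prop),
      intervalIntegral.integral_const_mul] at h
    simp at h
    unfold besselZero
    rw [mul_left_comm, inv_mul_lt_iff₀ (by positivity)]
    linarith
  rw [abs_lt]
  exact ⟨by linarith [key2 (-1) (by simp)], by linarith [key2 1 (by simp)]⟩

/-- The parameter `δ` cuts off the stationary points `0` and `π` of the phase `R cos θ`. -/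
lemma abs_integral_cos_mul_cos_le {R δ : ℝ} (hR : 0 < R) (hδ : 0 < δ) (hδ1 : δ ≤ 1) :
    |∫ θ in (0 : ℝ)..Real.pi, Real.cos (R * Real.cos θ)| ≤ 2 * δ + 13 / (R * δ ^ 2) := by
  have hp := Real.pi_gt_three
  have hp4 := Real.pi_lt_four
  have hI : ∀ a b : ℝ, IntervalIntegrable (fun θ => Real.cos (R * Real.cos θ)) volume a b :=
    fun a b => by apply Continuous.intervalIntegrable; fun_prop
  have hsplit : ∫ θ in (0 : ℝ)..Real.pi, Real.cos (R * Real.cos θ)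
      = (∫ θ in (0 : ℝ)..δ, Real.cos (R * Real.cos θ))
        + (∫ θ in δ..(Real.pi - δ), Real.cos (R * Real.cos θ))
        + ∫ θ in (Real.pi - δ)..Real.pi, Real.cos (R * Real.cos θ) := by
    rw [intervalIntegral.integral_add_adjacent_intervals (hI _ _) (hI _ _),
      intervalIntegral.integral_add_adjacent_intervals (hI _ _) (hI _ _)]
  have hend : ∀ a b : ℝ, |b - a| = δ →
      |∫ θ in a..b, Real.cos (R * Real.cos θ)| ≤ δ := by
    intro a b hab
    have := intervalIntegral.norm_integral_le_of_norm_le_const (a := a) (b := b)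
      (f := fun θ => Real.cos (R * Real.cos θ)) (C := 1) (fun θ _ => by
        simpa using Real.abs_cos_le_one _)
    rwa [hab, one_mul] at this
  have h1 := hend 0 δ (by simp [abs_of_pos hδ])
  have h3 := hend (Real.pi - δ) Real.pi (by simp [abs_of_pos hδ])
  -- on the middle interval `sin θ` is bounded below, and one can integrate by parts
  have hle : δ ≤ Real.pi - δ := by linarith
  have hsinlb : ∀ θ ∈ Set.Icc δ (Real.pi - δ), 2 / Real.pi * δ ≤ Real.sin θ := by
    intro θ hθ
    rcases le_total θ (Real.pi / 2) with h | h
    · refine le_trans ?_ (Real.mul_le_sin (by linarith [hθ.1]) h)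
      gcongr; exact hθ.1
    · rw [← Real.sin_pi_sub]
      refine le_trans ?_ (Real.mul_le_sin (by linarith [hθ.2]) (by linarith))
      gcongr; linarith [hθ.2]
  have hm : 0 < 2 / Real.pi * δ := by positivity
  have hsinpos : ∀ θ ∈ Set.Icc δ (Real.pi - δ), 0 < Real.sin θ := fun θ hθ =>
    hm.trans_le (hsinlb θ hθ)
  have hparts := intervalIntegral.integral_mul_deriv_eq_deriv_mul (a := δ) (b := Real.pi - δ)
    (u := fun θ => (Real.sin θ)⁻¹) (v := fun θ => Real.sin (R * Real.cos θ))
    (u' := fun θ => -Real.cos θ / Real.sin θ ^ 2)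
    (v' := fun θ => Real.cos (R * Real.cos θ) * (R * -Real.sin θ))
    (fun θ hθ => by
      rw [Set.uIcc_of_le hle] at hθ
      exact (Real.hasDerivAt_sin θ).inv (hsinpos θ hθ).ne')
    (fun θ hθ => ((Real.hasDerivAt_cos θ).const_mul R).sin)
    (by
      apply ContinuousOn.intervalIntegrable
      rw [Set.uIcc_of_le hle]
      apply ContinuousOn.div (by fun_prop) (by fun_prop)
      intro θ hθ
      exact pow_ne_zero 2 (hsinpos θ hθ).ne')
    (by apply Continuous.intervalIntegrable; fun_prop)
  have hlhs : ∫ θ in δ..(Real.pi - δ), (Real.sin θ)⁻¹ *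
      (Real.cos (R * Real.cos θ) * (R * -Real.sin θ))
      = -R * ∫ θ in δ..(Real.pi - δ), Real.cos (R * Real.cos θ) := by
    rw [← intervalIntegral.integral_const_mul]
    apply intervalIntegral.integral_congr
    intro θ hθ
    rw [Set.uIcc_of_le hle] at hθ
    have := (hsinpos θ hθ).ne'
    simp only
    field_simp
  rw [hlhs] at hparts
  have hinv : ∀ θ ∈ Set.Icc δ (Real.pi - δ), (Real.sin θ)⁻¹ ≤ 2 / δ := by
    intro θ hθ
    have h5 : (Real.sin θ)⁻¹ ≤ (2 / Real.pi * δ)⁻¹ := inv_anti₀ hm (hsinlb θ hθ)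
    refine h5.trans ?_
    rw [mul_inv, inv_div, ← div_eq_mul_inv]
    gcongr; linarith
  have hinv0 : ∀ θ ∈ Set.Icc δ (Real.pi - δ), 0 ≤ (Real.sin θ)⁻¹ := fun θ hθ =>
    inv_nonneg.2 (hsinpos θ hθ).le
  have hbd : ∀ θ ∈ Set.Icc δ (Real.pi - δ),
      |(Real.sin θ)⁻¹ * Real.sin (R * Real.cos θ)| ≤ 2 / δ := by
    intro θ hθ
    rw [abs_mul, abs_of_nonneg (hinv0 θ hθ)]
    calc _ ≤ (2 / δ) * 1 := by
          gcongr
          · exact hinv θ hθ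
          · exact Real.abs_sin_le_one _
      _ = _ := mul_one _
  have hb1 := hbd δ ⟨le_refl _, hle⟩
  have hb2 := hbd (Real.pi - δ) ⟨hle, le_refl _⟩
  have hsin_sq : ∀ θ ∈ Set.Icc δ (Real.pi - δ), ((Real.sin θ)⁻¹) ^ 2 ≤ Real.pi ^ 2 / 4 / δ ^ 2 := by
    intro θ hθ
    have h5 : (Real.sin θ)⁻¹ ≤ (2 / Real.pi * δ)⁻¹ := inv_anti₀ hm (hsinlb θ hθ)
    calc ((Real.sin θ)⁻¹) ^ 2 ≤ ((2 / Real.pi * δ)⁻¹) ^ 2 :=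
          pow_le_pow_left₀ (hinv0 θ hθ) h5 2
      _ = _ := by field_simp; norm_num
  have hpi2 : Real.pi ^ 2 / 4 * (Real.pi - 2 * δ) ≤ 9 := by
    have h314 := Real.pi_lt_d2
    have : Real.pi ^ 2 ≤ 3.15 ^ 2 := by gcongr
    have h0 : 0 ≤ Real.pi - 2 * δ := by linarith
    nlinarith
  have hint : |∫ θ in δ..(Real.pi - δ), -Real.cos θ / Real.sin θ ^ 2 * Real.sin (R * Real.cos θ)|
      ≤ 9 / δ ^ 2 := by
    have := intervalIntegral.norm_integral_le_of_norm_le_const (a := δ) (b := Real.pi - δ)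
      (f := fun θ => -Real.cos θ / Real.sin θ ^ 2 * Real.sin (R * Real.cos θ))
      (C := Real.pi ^ 2 / 4 / δ ^ 2) (fun θ hθ => by
        rw [Set.uIoc_of_le hle] at hθ
        have hθ' : θ ∈ Set.Icc δ (Real.pi - δ) := ⟨hθ.1.le, hθ.2⟩
        have h6 := hsin_sq θ hθ'
        rw [Real.norm_eq_abs, abs_mul, abs_div, abs_neg, abs_of_nonneg (sq_nonneg (Real.sin θ)),
          div_eq_mul_inv, ← inv_pow]
        calc |Real.cos θ| * ((Real.sin θ)⁻¹) ^ 2 * |Real.sin (R * Real.cos θ)|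
            ≤ 1 * ((Real.sin θ)⁻¹) ^ 2 * 1 := by
              gcongr
              · exact Real.abs_cos_le_one _
              · exact Real.abs_sin_le_one _
          _ ≤ _ := by linarith)
    rw [Real.norm_eq_abs, abs_of_nonneg (by linarith : 0 ≤ Real.pi - δ - δ)] at this
    refine this.trans ?_
    rw [div_mul_eq_mul_div]
    gcongr
    calc _ = Real.pi ^ 2 / 4 * (Real.pi - 2 * δ) := by ring
      _ ≤ 9 := hpi2
  have hmid : |∫ θ in δ..(Real.pi - δ), Real.cos (R * Real.cos θ)| ≤ 13 / (R * δ ^ 2) := by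
    have h7 : R * |∫ θ in δ..(Real.pi - δ), Real.cos (R * Real.cos θ)| ≤ 2 / δ + 2 / δ + 9 / δ ^ 2 := by
      calc _ = |-R * ∫ θ in δ..(Real.pi - δ), Real.cos (R * Real.cos θ)| := by
            rw [abs_mul, abs_neg, abs_of_pos hR]
        _ ≤ _ := by
            rw [hparts]
            refine (abs_sub _ _).trans ?_
            refine add_le_add ((abs_sub _ _).trans (add_le_add hb2 hb1)) hint
    have h8 : 2 / δ + 2 / δ + 9 / δ ^ 2 ≤ 13 / δ ^ 2 := by
      rw [← add_div, div_add_div _ _ hδ.ne' (by positivity), div_le_div_iff₀ (by positivity)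
        (by positivity)]
      have : 0 < δ ^ 4 := by positivity
      nlinarith [pow_pos hδ 2, pow_pos hδ 3, mul_le_mul_of_nonneg_left hδ1 (pow_pos hδ 3).le]
    rw [mul_comm R, ← div_div, le_div_iff₀ hR]
    linarith
  rw [hsplit]
  refine (abs_add_three _ _ _).trans ?_
  linarith

/-- Polynomial decay of `J₀`. The exponent is far from optimal, but any negative power will do. -/
lemma abs_besselZero_le_rpow {R : ℝ} (hR : 1 ≤ R) : |besselZero R| ≤ 5 * R ^ (-(1 / 3 : ℝ)) := by
  have hp := Real.pi_gt_three
  have hI : ∀ a b : ℝ, IntervalIntegrable (fun θ => Real.cos (R * Real.cos θ)) volume a b :=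
    fun a b => by apply Continuous.intervalIntegrable; fun_prop
  have hR0 : 0 < R := by linarith
  -- this cutoff makes both terms of the bound a multiple of `δ`
  set δ := R ^ (-(1 / 3 : ℝ)) with hδ
  have hδ0 : 0 < δ := Real.rpow_pos_of_pos hR0 _
  have hδ1 : δ ≤ 1 := Real.rpow_le_one_of_one_le_of_nonpos hR (by norm_num)
  have h := abs_integral_cos_mul_cos_le hR0 hδ0 hδ1
  have h3 : R * δ ^ 3 = 1 := by
    rw [hδ, ← Real.rpow_natCast, ← Real.rpow_mul hR0.le]
    norm_num
    rw [Real.rpow_neg_one, mul_inv_cancel₀ hR0.ne']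
  have h13 : 13 / (R * δ ^ 2) = 13 * δ := by
    field_simp; nlinarith
  rw [h13] at h
  have hsym : ∫ θ in (-Real.pi)..Real.pi, Real.cos (R * Real.cos θ)
      = 2 * ∫ θ in (0 : ℝ)..Real.pi, Real.cos (R * Real.cos θ) := by
    rw [← intervalIntegral.integral_add_adjacent_intervals (hI _ 0) (hI _ _)]
    have : ∫ θ in (-Real.pi)..0, Real.cos (R * Real.cos θ)
        = ∫ θ in (0 : ℝ)..Real.pi, Real.cos (R * Real.cos θ) := by
      have := intervalIntegral.integral_comp_neg (a := 0) (b := Real.pi)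
        (fun θ => Real.cos (R * Real.cos θ))
      simpa using this.symm
    rw [this]; ring
  unfold besselZero
  rw [hsym, abs_mul, abs_of_pos (by positivity : 0 < (2 * Real.pi)⁻¹),
    inv_mul_le_iff₀ (by positivity), abs_mul, abs_two]
  nlinarith

/-- A single bound that is quadratic near `0` and of power type at infinity: its powers have
explicit integrals over the plane. -/
lemma exists_abs_besselZero_le : ∃ κ : ℝ, 0 < κ ∧ ∀ R : ℝ, 0 ≤ R →
    |besselZero R| ≤ (1 + R ^ 2) ^ (-κ) := by
  -- at `R₁ = 5 ^ 6` the bound `5 * R ^ (-1 / 3)` has become `5 ^ (-1)`; compactness serves below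
  obtain ⟨R₁, hR₁⟩ : ∃ R₁ : ℝ, R₁ = 15625 := ⟨_, rfl⟩
  obtain ⟨x, hx, hmax⟩ := (isCompact_Icc (a := (1 : ℝ)) (b := R₁)).exists_isMaxOn
    ⟨1, by simp [hR₁]⟩ (continuous_besselZero.abs.continuousOn)
  have hρ : |besselZero x| < 1 := abs_besselZero_lt_one (by linarith [hx.1])
  have htend : Tendsto (fun κ : ℝ => (1 + R₁ ^ 2) ^ (-κ)) (𝓝[>] 0) (𝓝 1) := by
    have : Continuous (fun κ : ℝ => (1 + R₁ ^ 2) ^ (-κ)) := by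
      apply Continuous.rpow continuous_const continuous_neg
      intro κ; left; positivity
    have h := this.tendsto 0
    simp only [neg_zero, Real.rpow_zero] at h
    exact h.mono_left nhdsWithin_le_nhds
  have hev := (htend.eventually (eventually_gt_nhds hρ)).and
    (Ioo_mem_nhdsGT (show (0 : ℝ) < 1 / 24 by norm_num))
  obtain ⟨κ, hκ1, hκ0, hκ2⟩ := hev.exists
  refine ⟨κ, hκ0, fun R hR => ?_⟩
  have hpi := Real.pi_pos
  have hpi4 := Real.pi_lt_four
  rcases le_total R 1 with h1 | h1
  · have hnn : 0 ≤ besselZero R := by nlinarith [one_sub_le_besselZero R]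
    rw [abs_of_nonneg hnn]
    refine (besselZero_le_one_sub hR h1).trans ?_
    rw [Real.rpow_def_of_pos (by positivity)]
    have hlog : Real.log (1 + R ^ 2) ≤ R ^ 2 := by
      have := Real.log_le_sub_one_of_pos (show 0 < 1 + R ^ 2 by positivity)
      linarith
    have hlog0 : 0 ≤ Real.log (1 + R ^ 2) := Real.log_nonneg (by nlinarith)
    have hle : R ^ 2 / 24 ≤ R ^ 2 / Real.pi ^ 2 := by
      apply div_le_div_of_nonneg_left (sq_nonneg R) (by positivity)
      nlinarith [Real.pi_lt_d2]
    calc 1 - R ^ 2 / Real.pi ^ 2 ≤ Real.log (1 + R ^ 2) * -κ + 1 := by nlinarith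
      _ ≤ _ := Real.add_one_le_exp _
  · rcases le_total R R₁ with h2 | h2
    · have : |besselZero R| ≤ |besselZero x| := hmax (show R ∈ Set.Icc 1 R₁ from ⟨h1, h2⟩)
      refine this.trans (hκ1.le.trans ?_)
      apply Real.rpow_le_rpow_of_nonpos (by positivity) _ (by linarith)
      gcongr
    · have hR0 : 0 < R := by linarith
      refine (abs_besselZero_le_rpow h1).trans ?_
      have h5 : (5 : ℝ) ≤ R ^ (1 / 6 : ℝ) := by
        calc (5 : ℝ) = (R₁ : ℝ) ^ (1 / 6 : ℝ) := by
              rw [hR₁, show (15625 : ℝ) = 5 ^ (6 : ℝ) by norm_num, ← Real.rpow_mul (by norm_num)]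
              norm_num
          _ ≤ _ := Real.rpow_le_rpow (by rw [hR₁]; norm_num) h2 (by norm_num)
      calc 5 * R ^ (-(1 / 3 : ℝ)) ≤ R ^ (1 / 6 : ℝ) * R ^ (-(1 / 3 : ℝ)) := by gcongr
        _ = R ^ (-(1 / 6) : ℝ) := by rw [← Real.rpow_add hR0]; norm_num
        _ = (R ^ (4 : ℝ)) ^ (-(1 / 24) : ℝ) := by rw [← Real.rpow_mul hR0.le]; norm_num
        _ ≤ (1 + R ^ 2) ^ (-(1 / 24) : ℝ) := by
            apply Real.rpow_le_rpow_of_nonpos (by positivity) _ (by norm_num)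
            rw [show (4 : ℝ) = ((4 : ℕ) : ℝ) by norm_num, Real.rpow_natCast]
            nlinarith [sq_nonneg (R ^ 2 - 1), hR₁ ▸ h2]
        _ ≤ _ := by
            apply Real.rpow_le_rpow_of_exponent_le (by nlinarith) (by linarith)

/-! ### The law of a step and its characteristic function -/

instance : IsProbabilityMeasure (cond volume (Set.Ioc (-Real.pi) Real.pi)) :=
  cond_isProbabilityMeasure_of_finite (by simp [Real.pi_pos]) (by simp)

instance : IsProbabilityMeasure stepLaw :=
  Measure.isProbabilityMeasure_map (by fun_prop)

instance (n : ℕ) : IsProbabilityMeasure (walkLaw n) := by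
  unfold walkLaw; infer_instance

lemma integral_stepLaw {E : Type*} [NormedAddCommGroup E] [NormedSpace ℝ E] {f : ℂ → E}
    (hf : Continuous f) :
    ∫ s, f s ∂stepLaw
      = (2 * Real.pi)⁻¹ • ∫ θ in (-Real.pi)..Real.pi, f (Complex.exp (θ * Complex.I)) := by
  have hp := Real.pi_pos
  unfold stepLaw
  rw [integral_map (by fun_prop) hf.aestronglyMeasurable, ProbabilityTheory.cond,
    integral_smul_measure, intervalIntegral.integral_of_le (by linarith)]
  congr 1
  rw [Real.volume_Ioc, ENNReal.toReal_inv, ENNReal.toReal_ofReal (by linarith)]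
  ring

lemma ae_norm_stepLaw : ∀ᵐ s ∂stepLaw, ‖s‖ = 1 := by
  unfold stepLaw
  rw [ae_map_iff (by fun_prop) (by measurability)]
  simp [Complex.norm_exp_ofReal_mul_I]

/-- The characteristic function of a step, in the normalization of the Fourier transform. -/
noncomputable def stepChar (w : ℂ) : ℂ := ∫ s, (𝐞 ⟪s, w⟫ : ℂ) ∂stepLaw

lemma stepChar_eq (w : ℂ) : stepChar w = besselZero (2 * Real.pi * ‖w‖) := by
  have hp := Real.pi_pos
  set R := 2 * Real.pi * ‖w‖ with hR
  have hinner : ∀ θ : ℝ, 2 * Real.pi * ⟪Complex.exp (θ * Complex.I), w⟫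
      = R * Real.cos (θ - Complex.arg w) := by
    intro θ
    have hw : w = ‖w‖ * Complex.exp (Complex.arg w * Complex.I) :=
      (Complex.norm_mul_exp_arg_mul_I w).symm
    have : ⟪Complex.exp (θ * Complex.I), w⟫ = ‖w‖ * Real.cos (θ - Complex.arg w) := by
      rw [Complex.inner, Real.cos_sub]
      conv_lhs => rw [hw]
      simp only [Complex.mul_re, Complex.mul_im, Complex.conj_re, Complex.conj_im,
        Complex.exp_ofReal_mul_I_re, Complex.exp_ofReal_mul_I_im, Complex.ofReal_re,
        Complex.ofReal_im]
      ring
    rw [this, hR]; ring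
  have hg : ∀ θ : ℝ, (𝐞 ⟪Complex.exp (θ * Complex.I), w⟫ : ℂ)
      = (Real.cos (R * Real.cos (θ - Complex.arg w)) : ℂ)
        + (Real.sin (R * Real.cos (θ - Complex.arg w)) : ℂ) * Complex.I := by
    intro θ
    rw [Real.fourierChar_apply, hinner, Complex.exp_mul_I, Complex.ofReal_cos, Complex.ofReal_sin]
  have hper : ∀ f : ℝ → ℝ, (∀ x, f (x + 2 * Real.pi) = f x) →
      ∀ a : ℝ, ∫ θ in (-Real.pi)..Real.pi, f (θ + a) = ∫ θ in (-Real.pi)..Real.pi, f θ := by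
    intro f hf a
    rw [intervalIntegral.integral_comp_add_right]
    have := Function.Periodic.intervalIntegral_add_eq (f := f) (T := 2 * Real.pi) hf
      (-Real.pi + a) (-Real.pi)
    rw [show -Real.pi + a + 2 * Real.pi = Real.pi + a by ring,
      show -Real.pi + 2 * Real.pi = Real.pi by ring] at this
    exact this
  have hsin : ∫ θ in (-Real.pi)..Real.pi, Real.sin (R * Real.cos θ) = 0 := by
    have := hper (fun θ => Real.sin (R * Real.cos θ)) (by simp) Real.pi
    simp only [Real.cos_add_pi, mul_neg, Real.sin_neg, intervalIntegral.integral_neg] at this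
    linarith
  unfold stepChar
  rw [integral_stepLaw (by fun_prop), intervalIntegral.integral_congr (fun θ _ => hg θ),
    intervalIntegral.integral_add, intervalIntegral.integral_mul_const,
    intervalIntegral.integral_ofReal, intervalIntegral.integral_ofReal]
  · have h1 := hper (fun θ => Real.cos (R * Real.cos θ)) (by simp) (-Complex.arg w)
    have h2 := hper (fun θ => Real.sin (R * Real.cos θ)) (by simp) (-Complex.arg w)
    simp only [← sub_eq_add_neg] at h1 h2
    rw [h1, h2, hsin, besselZero]
    simp
  · apply Continuous.intervalIntegrable; fun_prop
  · apply Continuous.intervalIntegrable; fun_prop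

lemma continuous_stepChar : Continuous stepChar := by
  simp_rw [funext stepChar_eq]
  exact Complex.continuous_ofReal.comp (continuous_besselZero.comp (by fun_prop))

lemma exists_norm_stepChar_le : ∃ κ : ℝ, 0 < κ ∧ ∀ w : ℂ,
    ‖stepChar w‖ ≤ (1 + ‖w‖ ^ 2) ^ (-κ) := by
  obtain ⟨κ, hκ, h⟩ := exists_abs_besselZero_le
  refine ⟨κ, hκ, fun w => ?_⟩
  rw [stepChar_eq, Complex.norm_real]
  refine (h _ (by positivity)).trans ?_
  apply Real.rpow_le_rpow_of_nonpos (by positivity) _ (by linarith)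
  have : 1 ≤ 2 * Real.pi := by linarith [Real.pi_gt_three]
  gcongr
  nlinarith [norm_nonneg w]

/-! ### Two integrals over the plane -/

lemma integrable_one_add_norm_sq_rpow {a : ℝ} (ha : 1 < a) :
    Integrable (fun w : ℂ => (1 + ‖w‖ ^ 2) ^ (-a)) := by
  have := integrable_rpow_neg_one_add_norm_sq (E := ℂ) (μ := volume) (r := 2 * a)
    (by rw [Complex.finrank_real_complex]; push_cast; linarith)
  simpa [neg_div] using this

lemma integral_one_add_norm_sq_rpow {a : ℝ} (ha : 1 < a) :
    ∫ w : ℂ, (1 + ‖w‖ ^ 2) ^ (-a) = Real.pi / (a - 1) := by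
  have hint := integrable_one_add_norm_sq_rpow ha
  rw [integral_fun_norm_addHaar (μ := (volume : Measure ℂ)) (fun r : ℝ => (1 + r ^ 2) ^ (-a))]
  rw [integrable_fun_norm_addHaar (μ := (volume : Measure ℂ))
    (f := fun r : ℝ => (1 + r ^ 2) ^ (-a))] at hint
  simp only [Complex.finrank_real_complex, Nat.add_one_sub_one, pow_one, smul_eq_mul] at hint ⊢
  have hd : ∀ r : ℝ, HasDerivAt (fun r : ℝ => (1 + r ^ 2) ^ (1 - a) / (2 * (1 - a)))
      (r * (1 + r ^ 2) ^ (-a)) r := by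
    intro r
    have h1 : HasDerivAt (fun r : ℝ => 1 + r ^ 2) (2 * r) r := by
      simpa using (hasDerivAt_pow 2 r).const_add 1
    have h2 := (h1.rpow_const (p := 1 - a) (Or.inl (by positivity))).div_const (2 * (1 - a))
    refine h2.congr_deriv ?_
    rw [show 1 - a - 1 = -a by ring]
    have : 1 - a ≠ 0 := by linarith
    field_simp
  have htend : Tendsto (fun r : ℝ => (1 + r ^ 2) ^ (1 - a) / (2 * (1 - a))) atTop (𝓝 0) := by
    rw [show (0 : ℝ) = 0 / (2 * (1 - a)) by simp]
    apply Tendsto.div_const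
    have h3 : Tendsto (fun r : ℝ => 1 + r ^ 2) atTop atTop :=
      tendsto_atTop_add_const_left _ _ (tendsto_pow_atTop (by norm_num))
    have := (tendsto_rpow_neg_atTop (show 0 < a - 1 by linarith)).comp h3
    simpa [Function.comp_def, neg_sub] using this
  rw [integral_Ioi_of_hasDerivAt_of_tendsto (hd 0).continuousAt.continuousWithinAt
    (fun r _ => hd r) hint htend]
  have hvol : (volume : Measure ℂ).real (Metric.ball 0 1) = Real.pi := by
    simp [Measure.real]
  rw [hvol]
  have : 1 - a ≠ 0 := by linarith
  have : a - 1 ≠ 0 := by linarith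
  simp
  field_simp
  ring

lemma integral_norm_sq_mul_rpow {a : ℝ} (ha : 2 < a) :
    Integrable (fun w : ℂ => ‖w‖ ^ 2 * (1 + ‖w‖ ^ 2) ^ (-a)) ∧
    ∫ w : ℂ, ‖w‖ ^ 2 * (1 + ‖w‖ ^ 2) ^ (-a) = Real.pi / ((a - 1) * (a - 2)) := by
  have h : ∀ w : ℂ, ‖w‖ ^ 2 * (1 + ‖w‖ ^ 2) ^ (-a)
      = (1 + ‖w‖ ^ 2) ^ (-(a - 1)) - (1 + ‖w‖ ^ 2) ^ (-a) := by
    intro w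
    rw [show -(a - 1) = 1 + -a by ring, Real.rpow_add (by positivity), Real.rpow_one]
    ring
  have h1 := integrable_one_add_norm_sq_rpow (show 1 < a - 1 by linarith)
  have h2 := integrable_one_add_norm_sq_rpow (show 1 < a by linarith)
  simp_rw [h]
  refine ⟨h1.sub h2, ?_⟩
  rw [integral_sub h1 h2, integral_one_add_norm_sq_rpow (by linarith),
    integral_one_add_norm_sq_rpow (by linarith)]
  have : a - 1 ≠ 0 := by linarith
  have : a - 2 ≠ 0 := by linarith
  have : a - 1 - 1 ≠ 0 := by linarith
  field_simp
  ring

/-! ### Fourier inversion for weighted laws of planar random variables -/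

section Inversion

variable {Ω : Type*} [MeasurableSpace Ω] {μ : Measure Ω} [IsFiniteMeasure μ] {F X : Ω → ℂ}

lemma integral_mul_schwartz_eq (hF : Measurable F) (hFb : ∀ ω, ‖F ω‖ ≤ 1) (hX : Measurable X)
    (hint : Integrable (fun w : ℂ => ∫ ω, F ω * (𝐞 ⟪X ω, w⟫ : ℂ) ∂μ)) (ψ : SchwartzMap ℂ ℂ) :
    ∫ ω, F ω * ψ (X ω) ∂μ
      = ∫ y, ψ y * 𝓕 (fun w : ℂ => ∫ ω, F ω * (𝐞 ⟪X ω, w⟫ : ℂ) ∂μ) y := by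
  have hFψ : Integrable (𝓕 (ψ : ℂ → ℂ)) := by
    rw [← SchwartzMap.fourier_coe]; exact (𝓕 ψ).integrable
  have hinv : ∀ x, ψ x = ∫ w, (𝐞 ⟪w, x⟫ : ℂ) * 𝓕 (ψ : ℂ → ℂ) w := by
    intro x
    have := congrFun (ψ.continuous.fourierInv_fourier_eq ψ.integrable hFψ) x
    rw [Real.fourierInv_eq] at this
    rw [← this]; rfl
  calc ∫ ω, F ω * ψ (X ω) ∂μ
      = ∫ ω, (∫ w, F ω * (𝐞 ⟪X ω, w⟫ : ℂ) * 𝓕 (ψ : ℂ → ℂ) w) ∂μ := by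
        congr with ω
        rw [hinv, ← integral_const_mul]
        congr with w
        rw [real_inner_comm]; ring
    _ = ∫ w, (∫ ω, F ω * (𝐞 ⟪X ω, w⟫ : ℂ) * 𝓕 (ψ : ℂ → ℂ) w ∂μ) := by
        apply integral_integral_swap
        have h1 : Integrable (fun p : Ω × ℂ => 𝓕 (ψ : ℂ → ℂ) p.2) (μ.prod volume) :=
          hFψ.comp_snd μ
        have hm : Measurable (fun p : Ω × ℂ => F p.1 * (𝐞 ⟪X p.1, p.2⟫ : ℂ)) := by
          have : Measurable (fun p : Ω × ℂ => ⟪X p.1, p.2⟫) :=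
            (hX.comp measurable_fst).inner measurable_snd
          have hexp : Continuous (fun x : ℝ => (𝐞 x : ℂ)) := by fun_prop
          exact (hF.comp measurable_fst).mul (hexp.measurable.comp this)
        refine h1.mono (hm.aestronglyMeasurable.mul h1.aestronglyMeasurable) ?_
        filter_upwards with p
        simp only [Function.uncurry, norm_mul, Circle.norm_coe, mul_one]
        exact mul_le_of_le_one_left (norm_nonneg _) (hFb _)
    _ = ∫ w, 𝓕 (ψ : ℂ → ℂ) w • ∫ ω, F ω * (𝐞 ⟪X ω, w⟫ : ℂ) ∂μ := by
        congr with w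
        rw [integral_mul_const, smul_eq_mul, mul_comm]
    _ = ∫ y, ψ y • 𝓕 (fun w : ℂ => ∫ ω, F ω * (𝐞 ⟪X ω, w⟫ : ℂ) ∂μ) y := by
        have := VectorFourier.integral_fourierIntegral_smul_eq_flip (L := innerₗ ℂ)
          (e := 𝐞) (μ := volume) (ν := volume) Real.continuous_fourierChar continuous_inner
          ψ.integrable hint
        simpa [flip_innerₗ] using! this
    _ = _ := by simp [smul_eq_mul]

/-- If the weighted characteristic function `w ↦ E[F · 𝐞⟪X, w⟫]` is integrable, its Fourier
transform is the density of `X` under the (complex) weight `F`. Testing on balls suffices here. -/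
theorem setIntegral_preimage_ball_eq (hF : Measurable F) (hFb : ∀ ω, ‖F ω‖ ≤ 1)
    (hX : Measurable X)
    (hint : Integrable (fun w : ℂ => ∫ ω, F ω * (𝐞 ⟪X ω, w⟫ : ℂ) ∂μ)) (c : ℂ) {r : ℝ}
    (hr : 0 < r) :
    ∫ ω in X ⁻¹' Metric.ball c r, F ω ∂μ
      = ∫ y in Metric.ball c r, 𝓕 (fun w : ℂ => ∫ ω, F ω * (𝐞 ⟪X ω, w⟫ : ℂ) ∂μ) y := by
  set h := 𝓕 (fun w : ℂ => ∫ ω, F ω * (𝐞 ⟪X ω, w⟫ : ℂ) ∂μ) with hh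
  have hcont : Continuous h := VectorFourier.fourierIntegral_continuous Real.continuous_fourierChar
    (by exact continuous_inner) hint
  -- smooth bumps increasing to the indicator of the ball
  let b : ℕ → ContDiffBump c := fun k =>
    ⟨r * (1 - 1 / ((k : ℝ) + 2)), r, by
      have : 1 / ((k : ℝ) + 2) < 1 := by rw [div_lt_one (by positivity)]; linarith
      exact mul_pos hr (by linarith), by
      have : 0 < 1 / ((k : ℝ) + 2) := by positivity
      nlinarith⟩
  have hψ : ∀ k, ∃ ψ : SchwartzMap ℂ ℂ, ∀ x, ψ x = (b k x : ℂ) := by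
    intro k
    have hc : HasCompactSupport (fun x => (b k x : ℂ)) :=
      (b k).hasCompactSupport.comp_left (g := fun x : ℝ => (x : ℂ)) rfl
    have hs : ContDiff ℝ (⊤ : ℕ∞) (fun x => (b k x : ℂ)) :=
      Complex.ofRealCLM.contDiff.comp (b k).contDiff
    exact ⟨hc.toSchwartzMap hs, fun x => rfl⟩
  choose ψ hψ using hψ
  have hlim : ∀ x : ℂ, Tendsto (fun k => ψ k x) atTop
      (𝓝 ((Metric.ball c r).indicator (fun _ => (1 : ℂ)) x)) := by
    intro x
    by_cases hx : x ∈ Metric.ball c r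
    · rw [Set.indicator_of_mem hx]
      have hx' : dist x c < r := hx
      have ht : Tendsto (fun k : ℕ => r * (1 - 1 / ((k : ℝ) + 2))) atTop (𝓝 (r * (1 - 0))) := by
        refine Tendsto.const_mul _ (tendsto_const_nhds.sub ?_)
        have := (tendsto_one_div_add_atTop_nhds_zero_nat (𝕜 := ℝ)).comp (tendsto_add_atTop_nat 1)
        refine this.congr (fun k => ?_)
        simp only [Function.comp]; push_cast; ring
      rw [sub_zero, mul_one] at ht
      refine tendsto_const_nhds.congr' ?_
      filter_upwards [ht.eventually (eventually_gt_nhds hx')] with k hk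
      rw [hψ, (b k).one_of_mem_closedBall (Metric.mem_closedBall.2 hk.le)]
      simp
    · rw [Set.indicator_of_notMem hx]
      refine tendsto_const_nhds.congr (fun k => ?_)
      rw [hψ, (b k).zero_of_le_dist (by simpa [Metric.mem_ball] using hx)]
      simp
  have hψ1 : ∀ k x, ‖ψ k x‖ ≤ 1 := by
    intro k x
    rw [hψ, Complex.norm_real, Real.norm_of_nonneg (b k).nonneg]
    exact (b k).le_one
  have hψ0 : ∀ k x, x ∉ Metric.ball c r → ψ k x = 0 := by
    intro k x hx
    rw [hψ, (b k).zero_of_le_dist (by simpa [Metric.mem_ball] using hx)]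
    simp
  have hL : Tendsto (fun k => ∫ ω, F ω * ψ k (X ω) ∂μ) atTop
      (𝓝 (∫ ω, F ω * (Metric.ball c r).indicator (fun _ => (1 : ℂ)) (X ω) ∂μ)) := by
    refine tendsto_integral_of_dominated_convergence (fun _ => 1) ?_ (integrable_const 1) ?_ ?_
    · intro k
      exact (hF.mul ((ψ k).continuous.measurable.comp hX)).aestronglyMeasurable
    · intro k
      filter_upwards with ω
      rw [norm_mul]
      exact mul_le_one₀ (hFb ω) (norm_nonneg _) (hψ1 _ _)
    · filter_upwards with ω
      exact (hlim (X ω)).const_mul _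
  have hR : Tendsto (fun k => ∫ y, ψ k y * h y) atTop
      (𝓝 (∫ y, (Metric.ball c r).indicator (fun _ => (1 : ℂ)) y * h y)) := by
    refine tendsto_integral_of_dominated_convergence
      ((Metric.ball c r).indicator (fun y => ‖h y‖)) ?_ ?_ ?_ ?_
    · intro k
      exact ((ψ k).continuous.mul hcont).aestronglyMeasurable
    · rw [integrable_indicator_iff Metric.isOpen_ball.measurableSet]
      exact (hcont.norm.continuousOn.integrableOn_compact (isCompact_closedBall c r)).mono_set
        Metric.ball_subset_closedBall
    · intro k
      filter_upwards with y
      by_cases hy : y ∈ Metric.ball c r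
      · rw [Set.indicator_of_mem hy, norm_mul]
        exact mul_le_of_le_one_left (norm_nonneg _) (hψ1 _ _)
      · rw [Set.indicator_of_notMem hy, hψ0 k y hy]; simp
    · filter_upwards with y
      exact (hlim y).mul_const _
  have heq := tendsto_nhds_unique hL (hR.congr (fun k =>
    (integral_mul_schwartz_eq hF hFb hX hint (ψ k)).symm))
  have e1 : ∀ ω, F ω * (Metric.ball c r).indicator (fun _ => (1 : ℂ)) (X ω)
      = (X ⁻¹' Metric.ball c r).indicator F ω := by
    intro ω
    by_cases hω : X ω ∈ Metric.ball c r
    · rw [Set.indicator_of_mem hω, Set.indicator_of_mem (by exact hω), mul_one]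
    · rw [Set.indicator_of_notMem hω, Set.indicator_of_notMem (by exact hω), mul_zero]
  have e2 : ∀ y, (Metric.ball c r).indicator (fun _ => (1 : ℂ)) y * h y
      = (Metric.ball c r).indicator h y := by
    intro y
    by_cases hy : y ∈ Metric.ball c r
    · rw [Set.indicator_of_mem hy, Set.indicator_of_mem hy, one_mul]
    · rw [Set.indicator_of_notMem hy, Set.indicator_of_notMem hy, zero_mul]
  simp_rw [e1, e2] at heq
  rwa [integral_indicator (hX Metric.isOpen_ball.measurableSet),
    integral_indicator Metric.isOpen_ball.measurableSet] at heq

end Inversion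

/-! ### The density of a sum of steps near the origin -/

/-- An exponent `κ` with `‖stepChar w‖ ≤ (1 + ‖w‖ ^ 2) ^ (-κ)`. -/
noncomputable def decayExp : ℝ := exists_norm_stepChar_le.choose

lemma decayExp_pos : 0 < decayExp := exists_norm_stepChar_le.choose_spec.1

lemma norm_stepChar_le (w : ℂ) : ‖stepChar w‖ ≤ (1 + ‖w‖ ^ 2) ^ (-decayExp) :=
  exists_norm_stepChar_le.choose_spec.2 w

/-- A number of steps from which on the characteristic function of their sum decays like
`‖w‖ ^ (-8)`, so that the sum has a bounded continuous density. -/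
noncomputable def smoothRank : ℕ := ⌈4 / decayExp⌉₊ + 1

lemma four_le_decayExp_mul {m : ℕ} (hm : smoothRank ≤ m) : 4 ≤ decayExp * m := by
  have h1 : 4 / decayExp ≤ (m : ℝ) := by
    refine (Nat.le_ceil _).trans ?_
    exact_mod_cast (Nat.le_succ _).trans hm
  rw [div_le_iff₀ decayExp_pos] at h1
  linarith

lemma one_le_smoothRank : 1 ≤ smoothRank := Nat.le_add_left _ _

lemma norm_stepChar_pow_le (m : ℕ) (w : ℂ) :
    ‖stepChar w‖ ^ m ≤ (1 + ‖w‖ ^ 2) ^ (-(decayExp * m)) := by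
  calc ‖stepChar w‖ ^ m ≤ ((1 + ‖w‖ ^ 2) ^ (-decayExp)) ^ m :=
        pow_le_pow_left₀ (norm_nonneg _) (norm_stepChar_le w) m
    _ = _ := by rw [← Real.rpow_natCast, ← Real.rpow_mul (by positivity), neg_mul]

lemma integrable_norm_stepChar_pow {m : ℕ} (hm : smoothRank ≤ m) :
    Integrable (fun w => ‖stepChar w‖ ^ m) := by
  refine (integrable_one_add_norm_sq_rpow (a := decayExp * m)
    (by linarith [four_le_decayExp_mul hm])).mono'
    (continuous_stepChar.norm.pow m).aestronglyMeasurable ?_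
  filter_upwards with w
  rw [Real.norm_of_nonneg (by positivity)]
  exact norm_stepChar_pow_le m w

lemma integrable_norm_sq_mul_stepChar_pow {m : ℕ} (hm : smoothRank ≤ m) :
    Integrable (fun w => ‖w‖ ^ 2 * ‖stepChar w‖ ^ m) := by
  refine (integral_norm_sq_mul_rpow (a := decayExp * m)
    (by linarith [four_le_decayExp_mul hm])).1.mono'
    ((continuous_norm.pow 2).mul (continuous_stepChar.norm.pow m)).aestronglyMeasurable ?_
  filter_upwards with w
  rw [Real.norm_of_nonneg (by positivity)]
  gcongr
  exact norm_stepChar_pow_le m w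

/-- A uniform bound for the density of the sum of `m` steps. -/
noncomputable def densityBound (m : ℕ) : ℝ := ∫ w, ‖stepChar w‖ ^ m

lemma densityBound_nonneg (m : ℕ) : 0 ≤ densityBound m :=
  integral_nonneg fun _ => by positivity

lemma exists_densityBound_le :
    ∃ C : ℝ, 0 < C ∧ ∀ m : ℕ, smoothRank ≤ m → densityBound m ≤ C / m := by
  have hκ := decayExp_pos
  have hp := Real.pi_pos
  refine ⟨2 * Real.pi / decayExp, by positivity, fun m hm => ?_⟩
  have h4 := four_le_decayExp_mul hm
  have hm0 : 0 < (m : ℝ) := by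
    have : 0 < m := lt_of_lt_of_le one_le_smoothRank hm
    exact_mod_cast this
  calc densityBound m ≤ ∫ w : ℂ, (1 + ‖w‖ ^ 2) ^ (-(decayExp * m)) :=
        integral_mono (integrable_norm_stepChar_pow hm)
          (integrable_one_add_norm_sq_rpow (by linarith)) (norm_stepChar_pow_le m)
    _ = Real.pi / (decayExp * m - 1) := integral_one_add_norm_sq_rpow (by linarith)
    _ ≤ Real.pi / (decayExp * m / 2) := by
        apply div_le_div_of_nonneg_left hp.le (by positivity); linarith
    _ = _ := by field_simp

lemma exists_integral_norm_sq_mul_stepChar_pow_le :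
    ∃ C : ℝ, 0 < C ∧ ∀ m : ℕ, smoothRank ≤ m →
      ∫ w, ‖w‖ ^ 2 * ‖stepChar w‖ ^ m ≤ C / (m : ℝ) ^ 2 := by
  have hκ := decayExp_pos
  have hp := Real.pi_pos
  refine ⟨4 * Real.pi / decayExp ^ 2, by positivity, fun m hm => ?_⟩
  have h4 := four_le_decayExp_mul hm
  have hm0 : 0 < (m : ℝ) := by
    have : 0 < m := lt_of_lt_of_le one_le_smoothRank hm
    exact_mod_cast this
  calc ∫ w, ‖w‖ ^ 2 * ‖stepChar w‖ ^ m
        ≤ ∫ w : ℂ, ‖w‖ ^ 2 * (1 + ‖w‖ ^ 2) ^ (-(decayExp * m)) :=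
        integral_mono (integrable_norm_sq_mul_stepChar_pow hm)
          (integral_norm_sq_mul_rpow (by linarith)).1
          (fun w => mul_le_mul_of_nonneg_left (norm_stepChar_pow_le m w) (by positivity))
    _ = Real.pi / ((decayExp * m - 1) * (decayExp * m - 2)) :=
        (integral_norm_sq_mul_rpow (by linarith)).2
    _ ≤ Real.pi / ((decayExp * m / 2) * (decayExp * m / 2)) := by
        apply div_le_div_of_nonneg_left hp.le (by positivity)
        apply mul_le_mul <;> nlinarith
    _ = _ := by field_simp; norm_num

/-- The density at `y` of the sum of `m` steps, given by Fourier inversion. -/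
noncomputable def sumDensity (m : ℕ) (y : ℂ) : ℝ := (𝓕 (fun w => stepChar w ^ m) y).re

lemma integrable_stepChar_pow {m : ℕ} (hm : smoothRank ≤ m) :
    Integrable (fun w => stepChar w ^ m) :=
  (integrable_norm_stepChar_pow hm).mono' (continuous_stepChar.pow m).aestronglyMeasurable
    (by filter_upwards with w; rw [norm_pow])

lemma continuous_sumDensity {m : ℕ} (hm : smoothRank ≤ m) : Continuous (sumDensity m) :=
  Complex.continuous_re.comp (VectorFourier.fourierIntegral_continuous
    Real.continuous_fourierChar (by exact continuous_inner) (integrable_stepChar_pow hm))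

lemma abs_sumDensity_le (m : ℕ) (y : ℂ) : |sumDensity m y| ≤ densityBound m := by
  refine (Complex.abs_re_le_norm _).trans ?_
  rw [Real.fourier_eq]
  refine (norm_integral_le_integral_norm _).trans (le_of_eq ?_)
  simp [densityBound]

lemma sumDensity_eq {m : ℕ} (hm : smoothRank ≤ m) (y : ℂ) :
    sumDensity m y
      = ∫ w, Real.cos (2 * Real.pi * ⟪w, y⟫) * besselZero (2 * Real.pi * ‖w‖) ^ m := by
  have hint := (integrable_stepChar_pow hm)
  have hint2 : Integrable (fun w : ℂ => 𝐞 (-⟪w, y⟫) • stepChar w ^ m) :=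
    (Real.fourierIntegral_convergent_iff y).2 hint
  unfold sumDensity
  rw [Real.fourier_eq]
  have := integral_re hint2
  simp only [RCLike.re_eq_complex_re] at this
  rw [← this]
  congr with w
  rw [stepChar_eq, Circle.smul_def, Real.fourierChar_apply, smul_eq_mul, ← Complex.ofReal_pow,
    Complex.re_mul_ofReal, Complex.exp_ofReal_mul_I_re]
  rw [mul_neg, Real.cos_neg]

lemma integrable_cos_mul_besselZero_pow {m : ℕ} (hm : smoothRank ≤ m) (y : ℂ) :
    Integrable (fun w : ℂ =>
      Real.cos (2 * Real.pi * ⟪w, y⟫) * besselZero (2 * Real.pi * ‖w‖) ^ m) := by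
  refine (integrable_norm_stepChar_pow hm).mono' ?_ ?_
  · have := continuous_besselZero
    apply Continuous.aestronglyMeasurable
    fun_prop
  · filter_upwards with w
    rw [stepChar_eq, Complex.norm_real, norm_mul, norm_pow]
    exact mul_le_of_le_one_left (by positivity) (Real.abs_cos_le_one _)

/-- The pointwise estimate behind the comparison of densities: replacing `d` steps by `n ≥ d`
steps, an absolute value by the value, or the origin by a point near it changes the integrand of
the inversion formula by at most `O((n - d + 1) ‖w‖ ^ 2)` in relative size. -/
lemma abs_pow_sub_cos_mul_pow_le {R x : ℝ} {d n : ℕ} (hdn : d ≤ n) (hx : |x| ≤ 2 * R) :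
    |Real.cos x * besselZero R ^ d - besselZero R ^ n|
      ≤ (n - d + 2) * R ^ 2 * |besselZero R| ^ d ∧
    |(|besselZero R| ^ d - besselZero R ^ n)|
      ≤ (n - d + 2) * R ^ 2 * |besselZero R| ^ d := by
  set b := besselZero R with hb
  have hb1 : |b| ≤ 1 := abs_besselZero_le_one R
  have hble : b ≤ 1 := (le_abs_self b).trans hb1
  have hbR : 1 - b ≤ R ^ 2 / 4 := by linarith [one_sub_le_besselZero R]
  have hpow : ∀ k : ℕ, |1 - b ^ k| ≤ k * (R ^ 2 / 4) := by
    intro k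
    induction k with
    | zero => simp
    | succ k ih =>
      have : 1 - b ^ (k + 1) = (1 - b) + b * (1 - b ^ k) := by ring
      rw [this]
      refine (abs_add_le _ _).trans ?_
      rw [abs_mul, abs_of_nonneg (by linarith : 0 ≤ 1 - b)]
      push_cast
      have := mul_le_of_le_one_left (abs_nonneg (1 - b ^ k)) hb1
      linarith
  obtain ⟨k, rfl⟩ := Nat.exists_eq_add_of_le hdn
  have hk := hpow k
  have hbd : 0 ≤ |b| ^ d := by positivity
  have hR2 : 0 ≤ R ^ 2 := sq_nonneg R
  have hk0 : (0 : ℝ) ≤ k := Nat.cast_nonneg k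
  have hmain : ∀ c : ℝ, |1 - c| ≤ 2 * R ^ 2 → |c - b ^ k| ≤ (k + 2) * R ^ 2 := by
    intro c hc
    have : c - b ^ k = -(1 - c) + (1 - b ^ k) := by ring
    rw [this]
    refine (abs_add_le _ _).trans ?_
    rw [abs_neg]
    nlinarith
  have hcast : ((d + k : ℕ) : ℝ) - d + 2 = k + 2 := by push_cast; ring
  rw [hcast]
  constructor
  · have hc : |1 - Real.cos x| ≤ 2 * R ^ 2 := by
      rw [abs_of_nonneg (by linarith [Real.cos_le_one x])]
      have := Real.one_sub_sq_div_two_le_cos (x := x)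
      have : x ^ 2 ≤ (2 * R) ^ 2 := by
        rw [← sq_abs x]; exact pow_le_pow_left₀ (abs_nonneg _) hx 2
      linarith
    rw [pow_add, show Real.cos x * b ^ d - b ^ d * b ^ k = b ^ d * (Real.cos x - b ^ k) by ring,
      abs_mul, abs_pow, mul_comm]
    gcongr
    exact hmain _ hc
  · -- if `|b| ^ d ≠ b ^ d` then `b < 0`, which forces `R ^ 2 ≥ 4`
    have hsign : ∃ c : ℝ, |b| ^ d = b ^ d * c ∧ |1 - c| ≤ 2 * R ^ 2 := by
      rcases le_or_gt 0 b with h0 | h0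
      · exact ⟨1, by rw [abs_of_nonneg h0, mul_one], by simpa using hR2⟩
      · refine ⟨(-1) ^ d, by rw [abs_of_neg h0, neg_pow, mul_comm], ?_⟩
        rcases neg_one_pow_eq_or ℝ d with h | h <;> rw [h]
        · simpa using hR2
        · rw [show |1 - (-1 : ℝ)| = 2 by norm_num]
          linarith
    obtain ⟨c, hc, hc2⟩ := hsign
    have h3 : |b| ^ d - b ^ (d + k) = b ^ d * (c - b ^ k) := by rw [hc, pow_add]; ring
    rw [h3, abs_mul, abs_pow, mul_comm]
    gcongr
    exact hmain _ hc2

/-- Comparison of the densities of `d ≤ n` steps near the origin. -/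
lemma exists_abs_density_sub_le :
    ∃ C : ℝ, 0 < C ∧ ∀ d n : ℕ, smoothRank ≤ d → d ≤ n →
      (∀ y : ℂ, ‖y‖ ≤ 2 → |sumDensity d y - sumDensity n 0| ≤ C * (n - d + 2) / (d : ℝ) ^ 2) ∧
      |densityBound d - sumDensity n 0| ≤ C * (n - d + 2) / (d : ℝ) ^ 2 := by
  obtain ⟨C, hC, hCm⟩ := exists_integral_norm_sq_mul_stepChar_pow_le
  have hp := Real.pi_pos
  refine ⟨(2 * Real.pi) ^ 2 * C, by positivity, fun d n hd hdn => ?_⟩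
  have hn := hd.trans hdn
  have hnd : (0 : ℝ) ≤ n - d + 2 := by
    have : (d : ℝ) ≤ n := by exact_mod_cast hdn
    linarith
  have hbound : ∫ w : ℂ, (n - d + 2) * (2 * Real.pi * ‖w‖) ^ 2 * ‖stepChar w‖ ^ d
      ≤ (2 * Real.pi) ^ 2 * C * (n - d + 2) / (d : ℝ) ^ 2 := by
    have : ∀ w : ℂ, (n - d + 2) * (2 * Real.pi * ‖w‖) ^ 2 * ‖stepChar w‖ ^ d
        = ((n - d + 2) * (2 * Real.pi) ^ 2) * (‖w‖ ^ 2 * ‖stepChar w‖ ^ d) := fun w => by ring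
    simp_rw [this]
    rw [integral_const_mul]
    calc _ ≤ ((n - d + 2) * (2 * Real.pi) ^ 2) * (C / (d : ℝ) ^ 2) := by
          gcongr; exact hCm d hd
      _ = _ := by ring
  have hgi : Integrable (fun w : ℂ => (n - d + 2) * (2 * Real.pi * ‖w‖) ^ 2 * ‖stepChar w‖ ^ d) := by
    have := (integrable_norm_sq_mul_stepChar_pow hd).const_mul ((n - d + 2) * (2 * Real.pi) ^ 2)
    refine this.congr ?_
    filter_upwards with w
    ring
  have hn0 : sumDensity n 0 = ∫ w : ℂ, besselZero (2 * Real.pi * ‖w‖) ^ n := by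
    rw [sumDensity_eq hn]; simp
  have hn0i : Integrable (fun w : ℂ => besselZero (2 * Real.pi * ‖w‖) ^ n) := by
    simpa using integrable_cos_mul_besselZero_pow hn 0
  constructor
  · intro y hy
    rw [sumDensity_eq hd, hn0, ← integral_sub (integrable_cos_mul_besselZero_pow hd y) hn0i]
    refine le_trans ?_ hbound
    rw [← Real.norm_eq_abs]
    refine norm_integral_le_of_norm_le hgi ?_
    filter_upwards with w
    rw [stepChar_eq, Complex.norm_real, Real.norm_eq_abs]
    refine (abs_pow_sub_cos_mul_pow_le hdn ?_).1
    rw [abs_mul, abs_of_pos (by positivity)]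
    have := abs_real_inner_le_norm w y
    have : ‖w‖ * ‖y‖ ≤ ‖w‖ * 2 := by gcongr
    nlinarith
  · have : densityBound d = ∫ w : ℂ, |besselZero (2 * Real.pi * ‖w‖)| ^ d := by
      unfold densityBound
      congr with w
      rw [stepChar_eq, Complex.norm_real, Real.norm_eq_abs]
    have hi : Integrable (fun w : ℂ => |besselZero (2 * Real.pi * ‖w‖)| ^ d) := by
      refine (integrable_norm_stepChar_pow hd).congr ?_
      filter_upwards with w
      rw [stepChar_eq, Complex.norm_real, Real.norm_eq_abs]
    rw [this, hn0, ← integral_sub hi hn0i]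
    refine le_trans ?_ hbound
    rw [← Real.norm_eq_abs]
    refine norm_integral_le_of_norm_le hgi ?_
    filter_upwards with w
    rw [stepChar_eq, Complex.norm_real, Real.norm_eq_abs]
    exact (abs_pow_sub_cos_mul_pow_le (x := 0) hdn
      (by rw [abs_zero]; positivity)).2

lemma exists_le_densityBound :
    ∃ c : ℝ, 0 < c ∧ ∀ m : ℕ, smoothRank ≤ m → c / m ≤ densityBound m := by
  have hp := Real.pi_pos
  refine ⟨1 / (8 * Real.pi), by positivity, fun m hm => ?_⟩
  have hm1 : 1 ≤ m := one_le_smoothRank.trans hm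
  have hm0 : 0 < (m : ℝ) := by exact_mod_cast hm1
  -- on this disc `stepChar w ^ m ≥ (1 - 1 / (4 m)) ^ m ≥ 1 / 2`
  set ρ : ℝ := 1 / (2 * Real.pi * Real.sqrt m) with hρ
  have hρ0 : 0 < ρ := by positivity
  have hlow : ∀ w ∈ Metric.ball (0 : ℂ) ρ, (1 / 2 : ℝ) ≤ ‖stepChar w‖ ^ m := by
    intro w hw
    have hw' : ‖w‖ < ρ := by simpa using hw
    have h1 : (2 * Real.pi * ‖w‖) ^ 2 ≤ 1 / m := by
      have : 2 * Real.pi * ‖w‖ ≤ 2 * Real.pi * ρ := by gcongr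
      calc (2 * Real.pi * ‖w‖) ^ 2 ≤ (2 * Real.pi * ρ) ^ 2 := by gcongr
        _ = (1 / Real.sqrt m) ^ 2 := by rw [hρ]; field_simp
        _ = 1 / (m : ℝ) := by rw [div_pow, Real.sq_sqrt hm0.le, one_pow]
    have h2 := one_sub_le_besselZero (2 * Real.pi * ‖w‖)
    have h3 : 1 - 1 / (4 * m) ≤ ‖stepChar w‖ := by
      rw [stepChar_eq, Complex.norm_real, Real.norm_eq_abs]
      refine le_trans ?_ (le_abs_self _)
      have : (1 : ℝ) / (4 * m) = 1 / m / 4 := by ring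
      linarith
    have h4 : (1 : ℝ) / (4 * m) ≤ 1 / 4 := by
      apply one_div_le_one_div_of_le (by norm_num)
      have : (1 : ℝ) ≤ m := by exact_mod_cast hm1
      linarith
    have h5 := one_add_mul_le_pow (a := -(1 / (4 * (m : ℝ)))) (by linarith) m
    calc (1 / 2 : ℝ) ≤ 1 + m * -(1 / (4 * (m : ℝ))) := by
          field_simp; norm_num
      _ ≤ (1 + -(1 / (4 * (m : ℝ)))) ^ m := h5
      _ ≤ _ := by
        apply pow_le_pow_left₀ (by linarith)
        linarith
  have hvol : (volume : Measure ℂ).real (Metric.ball 0 ρ) = Real.pi * ρ ^ 2 := by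
    simp only [Measure.real, Complex.volume_ball, ENNReal.toReal_mul, ENNReal.toReal_pow,
      ENNReal.toReal_ofReal hρ0.le, ENNReal.coe_toReal, NNReal.coe_real_pi]
    ring
  calc (1 / (8 * Real.pi)) / (m : ℝ) = ∫ _w in Metric.ball (0 : ℂ) ρ, (1 / 2 : ℝ) := by
        rw [setIntegral_const, hvol, hρ, smul_eq_mul]
        rw [div_pow, mul_pow, mul_pow, Real.sq_sqrt hm0.le]
        field_simp; norm_num
    _ ≤ ∫ w in Metric.ball (0 : ℂ) ρ, ‖stepChar w‖ ^ m := by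
        apply setIntegral_mono_on
        · exact integrableOn_const measure_ball_lt_top.ne (by simp)
        · exact (integrable_norm_stepChar_pow hm).integrableOn
        · exact measurableSet_ball
        · exact hlow
    _ ≤ densityBound m := setIntegral_le_integral (integrable_norm_stepChar_pow hm)
        (by filter_upwards with w; positivity)

/-- The density of return to the origin is of order at least `1 / n`, and it controls the densities
of fewer steps near the origin up to a small relative error. -/
lemma exists_sumDensity_compare :
    ∃ C : ℝ, 1 ≤ C ∧ ∃ N : ℕ, smoothRank ≤ N ∧ ∀ n : ℕ, N ≤ n →
      0 < sumDensity n 0 ∧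
      (∀ d : ℕ, smoothRank ≤ d → d ≤ n →
        densityBound d ≤ sumDensity n 0 * (1 + C * (n - d + 2) / d)) ∧
      (∀ d : ℕ, smoothRank ≤ d → d ≤ n → n ≤ 2 * d → ∀ y : ℂ, ‖y‖ ≤ 2 →
        sumDensity n 0 * (1 - C * (n - d + 2) / n) ≤ sumDensity d y) := by
  obtain ⟨C₁, hC₁, h1⟩ := exists_densityBound_le
  obtain ⟨C₂, hC₂, h2⟩ := exists_abs_density_sub_le
  obtain ⟨c, hc, h3⟩ := exists_le_densityBound
  obtain ⟨N₀, hN₀⟩ := exists_nat_gt (4 * C₂ / c)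
  set q := c / 2 with hq
  have hq0 : 0 < q := by positivity
  refine ⟨max 1 (4 * C₂ / q + 4 * C₁ / q), le_max_left _ _, max N₀ smoothRank, le_max_right _ _,
    fun n hn => ?_⟩
  set C := max 1 (4 * C₂ / q + 4 * C₁ / q) with hCdef
  have hC : 4 * C₂ / q + 4 * C₁ / q ≤ C := le_max_right _ _
  have hCC : 4 * C₂ + 4 * C₁ ≤ C * q := by
    rw [← add_div, div_le_iff₀ hq0] at hC; exact hC
  have hC0 : 0 < C := lt_of_lt_of_le one_pos (le_max_left _ _)
  have hns : smoothRank ≤ n := (le_max_right _ _).trans hn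
  have hn0 : 0 < (n : ℝ) := by exact_mod_cast lt_of_lt_of_le one_le_smoothRank hns
  have hnN : 4 * C₂ / c < n := hN₀.trans_le (by exact_mod_cast (le_max_left _ _).trans hn)
  have hpn : q / n ≤ sumDensity n 0 := by
    have ha := (abs_le.1 (h2 n n hns le_rfl).2).2
    have hb := h3 n hns
    have hcc : C₂ * (n - n + 2) / (n : ℝ) ^ 2 ≤ c / 2 / n := by
      rw [div_lt_iff₀ hc] at hnN
      rw [div_le_div_iff₀ (by positivity) hn0, pow_two, ← mul_assoc]
      apply mul_le_mul_of_nonneg_right _ hn0.le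
      linarith
    have : c / n = c / 2 / n + c / 2 / n := by ring
    linarith
  have hp0 : 0 < sumDensity n 0 := lt_of_lt_of_le (by positivity) hpn
  refine ⟨hp0, fun d hd hdn => ?_, fun d hd hdn hnd y hy => ?_⟩
  · have hd0 : 0 < (d : ℝ) := by exact_mod_cast lt_of_lt_of_le one_le_smoothRank hd
    have hdn' : (d : ℝ) ≤ n := by exact_mod_cast hdn
    have hk0 : (0 : ℝ) < n - d + 2 := by linarith
    have hgoal : ∀ x : ℝ, x ≤ q / n * (C * (n - d + 2) / d) →
        x ≤ sumDensity n 0 * (C * (n - d + 2) / d) := fun x hx => hx.trans (by gcongr)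
    rcases le_total n (2 * d) with hnd | hnd
    · have hnd' : (n : ℝ) ≤ 2 * d := by exact_mod_cast hnd
      have ha := (abs_le.1 (h2 d n hd hdn).2).2
      have : C₂ * (n - d + 2) / (d : ℝ) ^ 2 ≤ q / n * (C * (n - d + 2) / d) := by
        rw [div_mul_div_comm, div_le_div_iff₀ (by positivity) (by positivity)]
        have e1 : C₂ * (n * d) ≤ q * C * (d : ℝ) ^ 2 := by
          have : C₂ * (n * d) ≤ C₂ * (2 * d * d) := by gcongr
          have : (4 * C₂ + 4 * C₁) * (d : ℝ) ^ 2 ≤ C * q * (d : ℝ) ^ 2 := by gcongr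
          nlinarith [mul_pos hC₂ (pow_pos hd0 2), mul_pos hC₁ (pow_pos hd0 2)]
        nlinarith
      have := hgoal _ this
      linarith
    · have hnd' : 2 * (d : ℝ) ≤ n := by exact_mod_cast hnd
      have ha := h1 d hd
      have : C₁ / d ≤ q / n * (C * (n - d + 2) / d) := by
        rw [div_mul_div_comm, div_le_div_iff₀ hd0 (by positivity)]
        have : C₁ * n ≤ q * (C * (n - d + 2)) := by
          have : (4 * C₂ + 4 * C₁) * (n - d + 2) ≤ C * q * (n - d + 2) := by gcongr
          nlinarith
        nlinarith
      have := hgoal _ this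
      linarith
  · have hd0 : 0 < (d : ℝ) := by exact_mod_cast lt_of_lt_of_le one_le_smoothRank hd
    have hdn' : (d : ℝ) ≤ n := by exact_mod_cast hdn
    have hnd' : (n : ℝ) ≤ 2 * d := by exact_mod_cast hnd
    have hk0 : (0 : ℝ) < n - d + 2 := by linarith
    have ha := (abs_le.1 ((h2 d n hd hdn).1 y hy)).1
    have h5 : C₂ * (n - d + 2) / (d : ℝ) ^ 2 ≤ q / n * (C * (n - d + 2) / n) := by
      rw [div_mul_div_comm, div_le_div_iff₀ (by positivity) (by positivity)]
      have e1 : C₂ * (n * n) ≤ q * C * (d : ℝ) ^ 2 := by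
        have : (n : ℝ) * n ≤ (2 * d) * (2 * d) := by gcongr
        have : (4 * C₂ + 4 * C₁) * (d : ℝ) ^ 2 ≤ C * q * (d : ℝ) ^ 2 := by gcongr
        nlinarith [mul_pos hC₁ (pow_pos hd0 2)]
      nlinarith
    have : q / n * (C * (n - d + 2) / n) ≤ sumDensity n 0 * (C * (n - d + 2) / n) := by gcongr
    linarith

/-! ### Block sums of the walk -/

variable {n : ℕ}

/-- The sum of the steps whose indices lie in the block `S`. -/
noncomputable def blockSum (S : Finset (Fin n)) (s : Fin n → ℂ) : ℂ := ∑ i ∈ S, s i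

/-- The steps with indices in `S`, all other steps being replaced by `0`. Functions of the steps
in `S` are encoded as functions `f` with `f s = f (keep S s)`. -/
noncomputable def keep (S : Finset (Fin n)) (s : Fin n → ℂ) : Fin n → ℂ :=
  fun i => if i ∈ S then s i else 0

lemma continuous_blockSum (S : Finset (Fin n)) : Continuous (blockSum S) := by
  unfold blockSum; fun_prop

lemma continuous_keep (S : Finset (Fin n)) : Continuous (keep S) := by
  unfold keep
  refine continuous_pi fun i => ?_
  split_ifs <;> fun_prop

lemma measurable_blockSum (S : Finset (Fin n)) : Measurable (blockSum S) :=
  (continuous_blockSum S).measurable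

lemma measurable_keep (S : Finset (Fin n)) : Measurable (keep S) :=
  (continuous_keep S).measurable

lemma keep_of_mem {S : Finset (Fin n)} {i : Fin n} (h : i ∈ S) (s : Fin n → ℂ) :
    keep S s i = s i := if_pos h

lemma blockSum_keep_of_subset {S T : Finset (Fin n)} (h : S ⊆ T) (s : Fin n → ℂ) :
    blockSum S (keep T s) = blockSum S s :=
  Finset.sum_congr rfl fun _ hi => keep_of_mem (h hi) s

lemma blockSum_univ_keep (S : Finset (Fin n)) (s : Fin n → ℂ) :
    blockSum Finset.univ (keep S s) = blockSum S s := by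
  simp [blockSum, keep]

lemma vertex_self (s : Fin n → ℂ) : vertex s n = blockSum Finset.univ s := by
  unfold vertex blockSum
  congr 1
  ext i; simp

lemma vertex_zero (s : Fin n → ℂ) : vertex s 0 = 0 := by simp [vertex]

lemma ae_norm_walkLaw : ∀ᵐ s ∂walkLaw n, ∀ i, ‖s i‖ = 1 := by
  rw [ae_all_iff]
  intro i
  have h : Measure.QuasiMeasurePreserving (fun s : Fin n → ℂ => s i) (walkLaw n) stepLaw :=
    Measure.quasiMeasurePreserving_eval (μ := fun _ : Fin n => stepLaw) i
  exact h.ae ae_norm_stepLaw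

lemma indepFun_keep {S T : Finset (Fin n)} (h : Disjoint S T) :
    IndepFun (keep S) (keep T) (walkLaw n) := by
  have h1 : iIndepFun (fun (i : Fin n) (s : Fin n → ℂ) => s i) (walkLaw n) :=
    iIndepFun_pi (μ := fun _ : Fin n => stepLaw) (X := fun _ z => z) (fun _ => aemeasurable_id)
  have h2 := h1.indepFun_finset S T h (fun i => measurable_pi_apply i)
  have hφ : ∀ S : Finset (Fin n), Measurable
      (fun (x : S → ℂ) (i : Fin n) => if hi : i ∈ S then x ⟨i, hi⟩ else 0) := by
    intro S
    refine measurable_pi_lambda _ fun i => ?_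
    split_ifs
    · exact measurable_pi_apply _
    · exact measurable_const
  have h3 := h2.comp (hφ S) (hφ T)
  exact h3

lemma indepFun_keep_blockSum {S T : Finset (Fin n)} (h : Disjoint S T) :
    IndepFun (keep S) (blockSum T) (walkLaw n) := by
  have := (indepFun_keep h).comp measurable_id (measurable_blockSum T)
  refine this.congr (ae_of_all _ fun s => rfl) (ae_of_all _ fun s => ?_)
  exact blockSum_keep_of_subset subset_rfl s

lemma coe_fourierChar_sum {ι : Type*} (S : Finset ι) (f : ι → ℝ) :
    (𝐞 (∑ i ∈ S, f i) : ℂ) = ∏ i ∈ S, (𝐞 (f i) : ℂ) := by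
  classical
  induction S using Finset.induction_on with
  | empty => simp
  | insert a S ha ih =>
    rw [Finset.sum_insert ha, Finset.prod_insert ha, AddChar.map_add_eq_mul, Circle.coe_mul, ih]

/-- Joint characteristic function of the steps and of a block sum. -/
lemma integral_prod_fourierChar_walkLaw (a : Fin n → ℂ) (S : Finset (Fin n)) (w : ℂ) :
    ∫ s, (∏ i, (𝐞 ⟪s i, a i⟫ : ℂ)) * (𝐞 ⟪blockSum S s, w⟫ : ℂ) ∂walkLaw n
      = ∏ i, stepChar (a i + if i ∈ S then w else 0) := by
  have h : ∀ s : Fin n → ℂ, (∏ i, (𝐞 ⟪s i, a i⟫ : ℂ)) * (𝐞 ⟪blockSum S s, w⟫ : ℂ)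
      = ∏ i, (𝐞 ⟪s i, a i + if i ∈ S then w else 0⟫ : ℂ) := by
    intro s
    have h1 : (𝐞 ⟪blockSum S s, w⟫ : ℂ) = ∏ i, (𝐞 ⟪s i, if i ∈ S then w else 0⟫ : ℂ) := by
      unfold blockSum
      rw [sum_inner]
      have : ∑ i ∈ S, ⟪s i, w⟫ = ∑ i, ⟪s i, if i ∈ S then w else 0⟫ := by
        simp [apply_ite, Finset.sum_ite_mem]
      rw [this, coe_fourierChar_sum]
    rw [h1, ← Finset.prod_mul_distrib]
    refine Finset.prod_congr rfl fun i _ => ?_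
    rw [inner_add_right, AddChar.map_add_eq_mul]
    simp
  simp_rw [h]
  unfold walkLaw
  rw [integral_fintype_prod_eq_prod (fun i (z : ℂ) => (𝐞 ⟪z, a i + if i ∈ S then w else 0⟫ : ℂ))]
  rfl

lemma stepChar_zero : stepChar 0 = 1 := by simp [stepChar]

lemma integral_fourierChar_blockSum (S : Finset (Fin n)) (w : ℂ) :
    ∫ s, (𝐞 ⟪blockSum S s, w⟫ : ℂ) ∂walkLaw n = stepChar w ^ S.card := by
  have := integral_prod_fourierChar_walkLaw (0 : Fin n → ℂ) S w
  simp only [Pi.zero_apply, inner_zero_right, AddChar.map_zero_eq_one, Circle.coe_one,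
    Finset.prod_const_one, one_mul, zero_add] at this
  rw [this]
  simp [apply_ite, stepChar_zero, Finset.prod_ite_mem]

/-- For a block of at least `smoothRank` steps, `sumDensity` is the density of the block sum. -/
lemma measureReal_blockSum_mem_ball {S : Finset (Fin n)} (hS : smoothRank ≤ S.card) (c : ℂ)
    {r : ℝ} (hr : 0 < r) :
    (walkLaw n).real (blockSum S ⁻¹' Metric.ball c r)
      = ∫ y in Metric.ball c r, sumDensity S.card y := by
  have hchar : (fun w : ℂ => ∫ s, (1 : ℂ) * (𝐞 ⟪blockSum S s, w⟫ : ℂ) ∂walkLaw n)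
      = fun w => stepChar w ^ S.card := by
    funext w
    simp_rw [one_mul]
    exact integral_fourierChar_blockSum S w
  have h := setIntegral_preimage_ball_eq (μ := walkLaw n) (F := fun _ => (1 : ℂ))
    measurable_const (fun _ => by simp) (measurable_blockSum S)
    (by rw [hchar]; exact integrable_stepChar_pow hS) c hr
  rw [hchar, setIntegral_const, Complex.real_smul, mul_one] at h
  have hi : IntegrableOn (𝓕 (fun w => stepChar w ^ S.card)) (Metric.ball c r) := by
    refine ((Continuous.continuousOn ?_).integrableOn_compact (isCompact_closedBall c r)).mono_set
      Metric.ball_subset_closedBall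
    exact VectorFourier.fourierIntegral_continuous Real.continuous_fourierChar
      (by exact continuous_inner) (integrable_stepChar_pow hS)
  have h2 := congrArg Complex.re h
  rw [Complex.ofReal_re] at h2
  rw [h2]
  exact (integral_re hi).symm

lemma volume_real_ball (c : ℂ) {r : ℝ} (hr : 0 ≤ r) :
    (volume : Measure ℂ).real (Metric.ball c r) = Real.pi * r ^ 2 := by
  simp only [Measure.real, Complex.volume_ball, ENNReal.toReal_mul, ENNReal.toReal_pow,
    ENNReal.toReal_ofReal hr, ENNReal.coe_toReal, NNReal.coe_real_pi]
  ring

lemma measureReal_blockSum_mem_ball_le {S : Finset (Fin n)} (hS : smoothRank ≤ S.card) (c : ℂ)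
    {r : ℝ} (hr : 0 < r) :
    (walkLaw n).real (blockSum S ⁻¹' Metric.ball c r)
      ≤ densityBound S.card * (Real.pi * r ^ 2) := by
  rw [measureReal_blockSum_mem_ball hS c hr]
  have h := norm_setIntegral_le_of_norm_le_const (μ := volume) (s := Metric.ball c r)
    (f := sumDensity S.card) (C := densityBound S.card) measure_ball_lt_top
    (fun y _ => abs_sumDensity_le _ y)
  rw [volume_real_ball c hr.le] at h
  exact (le_abs_self _).trans h

/-- Anticoncentration: a sum of `k` steps is within distance `6` of a given point with probability
`O(1 / (k + 1))`. -/
lemma exists_measureReal_blockSum_le :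
    ∃ C : ℝ, 1 ≤ C ∧ ∀ (n : ℕ) (S : Finset (Fin n)) (c : ℂ),
      (walkLaw n).real {s | ‖blockSum S s + c‖ ≤ 6} ≤ C / (S.card + 1) := by
  obtain ⟨C, hC, h⟩ := exists_densityBound_le
  have hp := Real.pi_pos
  refine ⟨2 * C * (Real.pi * 7 ^ 2) + (smoothRank + 1), ?_, fun n S c => ?_⟩
  · have : (0 : ℝ) ≤ smoothRank := Nat.cast_nonneg _
    have : 0 ≤ 2 * C * (Real.pi * 7 ^ 2) := by positivity
    linarith
  rw [le_div_iff₀ (by positivity)]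
  rcases le_or_gt smoothRank S.card with hS | hS
  · have hS0 : (1 : ℝ) ≤ S.card := by exact_mod_cast one_le_smoothRank.trans hS
    have h1 : (walkLaw n).real {s | ‖blockSum S s + c‖ ≤ 6}
        ≤ (walkLaw n).real (blockSum S ⁻¹' Metric.ball (-c) 7) := by
      refine measureReal_mono (fun s hs => ?_) (measure_ne_top _ _)
      have : ‖blockSum S s + c‖ ≤ 6 := hs
      simp only [Set.mem_preimage, Metric.mem_ball, dist_eq_norm, sub_neg_eq_add]
      linarith
    have h2 := measureReal_blockSum_mem_ball_le hS (-c) (r := 7) (by norm_num)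
    have h3 := h _ hS
    have h4 : densityBound S.card * (Real.pi * 7 ^ 2) ≤ C / S.card * (Real.pi * 7 ^ 2) := by
      gcongr
    have h5 : (walkLaw n).real {s | ‖blockSum S s + c‖ ≤ 6} * (S.card + 1)
        ≤ C / S.card * (Real.pi * 7 ^ 2) * (2 * S.card) := by
      apply mul_le_mul (by linarith) (by linarith) (by positivity) (by positivity)
    have h6 : C / S.card * (Real.pi * 7 ^ 2) * (2 * S.card) = 2 * C * (Real.pi * 7 ^ 2) := by
      field_simp
    have : (0 : ℝ) ≤ smoothRank := Nat.cast_nonneg _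
    linarith
  · have h1 : (walkLaw n).real {s | ‖blockSum S s + c‖ ≤ 6} ≤ 1 := measureReal_le_one
    have h2 : (S.card : ℝ) + 1 ≤ smoothRank + 1 := by
      have : (S.card : ℝ) ≤ smoothRank := by exact_mod_cast hS.le
      linarith
    have : 0 ≤ 2 * C * (Real.pi * 7 ^ 2) := by positivity
    have h3 : (walkLaw n).real {s | ‖blockSum S s + c‖ ≤ 6} * (S.card + 1) ≤ 1 * (smoothRank + 1) :=
      mul_le_mul h1 h2 (by positivity) zero_le_one
    linarith

/-- Two closeness conditions on block sums cost the product of the two probabilities, even if the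
second block is shifted by a function of the steps outside of it. -/
lemma exists_measureReal_two_blockSum_le :
    ∃ C : ℝ, 1 ≤ C ∧ ∀ (n : ℕ) (S T U : Finset (Fin n)), Disjoint S T → Disjoint U T →
      (walkLaw n).real {s | ‖blockSum S s‖ ≤ 6 ∧ ‖blockSum T s + blockSum U s‖ ≤ 6}
        ≤ C / ((S.card + 1) * (T.card + 1)) := by
  obtain ⟨C, hC, h⟩ := exists_measureReal_blockSum_le
  refine ⟨C ^ 2, by nlinarith, fun n S T U hST hUT => ?_⟩
  have hdisj : Disjoint Tᶜ T := disjoint_compl_left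
  have hind := indepFun_keep_blockSum hdisj
  rw [indepFun_iff_map_prod_eq_prod_map_map (measurable_keep _).aemeasurable
    (measurable_blockSum _).aemeasurable] at hind
  set A : Set ((Fin n → ℂ) × ℂ) := {p | ‖blockSum S p.1‖ ≤ 6 ∧ ‖p.2 + blockSum U p.1‖ ≤ 6} with hA
  have hAm : MeasurableSet A := by
    have := measurable_blockSum (n := n)
    apply MeasurableSet.inter
    · exact measurableSet_le ((this S).comp measurable_fst).norm measurable_const
    · exact measurableSet_le (measurable_snd.add ((this U).comp measurable_fst)).norm
        measurable_const
  have hSsub : S ⊆ Tᶜ := by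
    intro i hi; simp only [Finset.mem_compl]; exact Finset.disjoint_left.1 hST hi
  have hUsub : U ⊆ Tᶜ := by
    intro i hi; simp only [Finset.mem_compl]; exact Finset.disjoint_left.1 hUT hi
  have e1 : {s | ‖blockSum S s‖ ≤ 6 ∧ ‖blockSum T s + blockSum U s‖ ≤ 6}
      = (fun s => (keep Tᶜ s, blockSum T s)) ⁻¹' A := by
    ext s
    simp only [hA, Set.mem_preimage, Set.mem_ofPred_eq, blockSum_keep_of_subset hSsub,
      blockSum_keep_of_subset hUsub]
  have hB : MeasurableSet {x : Fin n → ℂ | ‖blockSum S x‖ ≤ 6} :=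
    measurableSet_le (measurable_blockSum S).norm measurable_const
  have key : (walkLaw n) ((fun s => (keep Tᶜ s, blockSum T s)) ⁻¹' A)
      ≤ ENNReal.ofReal (C / (T.card + 1)) * (walkLaw n) {s | ‖blockSum S s‖ ≤ 6} := by
    rw [← Measure.map_apply ((measurable_keep _).prodMk (measurable_blockSum _)) hAm, hind,
      Measure.prod_apply hAm]
    calc _ ≤ ∫⁻ x, ({x : Fin n → ℂ | ‖blockSum S x‖ ≤ 6}).indicator
            (fun _ => ENNReal.ofReal (C / (T.card + 1))) x ∂((walkLaw n).map (keep Tᶜ)) := by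
          apply lintegral_mono
          intro x
          by_cases hx : ‖blockSum S x‖ ≤ 6
          · rw [Set.indicator_of_mem (by exact hx)]
            beta_reduce
            rw [Measure.map_apply (measurable_blockSum T) (measurable_prodMk_left hAm)]
            have := h n T (blockSum U x)
            rw [measureReal_def] at this
            refine le_trans (measure_mono ?_)
              ((ENNReal.le_ofReal_iff_toReal_le (measure_ne_top _ _) (by positivity)).2 this)
            intro s hs
            exact hs.2
          · have : Prod.mk x ⁻¹' A = ∅ := by
              ext y; simp [hA, hx]
            simp [this]
      _ = _ := by
          rw [lintegral_indicator_const hB, Measure.map_apply (measurable_keep _) hB]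
          congr 2
          ext s
          simp only [Set.mem_preimage, Set.mem_ofPred_eq, blockSum_keep_of_subset hSsub]
  have h2 := h n S 0
  simp only [add_zero] at h2
  rw [e1, measureReal_def]
  have h3 := ENNReal.toReal_mono (by finiteness) key
  rw [ENNReal.toReal_mul, ENNReal.toReal_ofReal (by positivity)] at h3
  refine h3.trans ?_
  rw [← measureReal_def]
  calc _ ≤ C / (T.card + 1) * (C / (S.card + 1)) := by gcongr
    _ = _ := by field_simp

/-! ### The conditional laws and their limit -/

lemma tendsto_average_ball {E : Type*} [NormedAddCommGroup E] [NormedSpace ℝ E] [CompleteSpace E]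
    {h : ℂ → E} (hc : Continuous h) (c : ℂ) :
    Tendsto (fun ε : ℝ => (Real.pi * ε ^ 2)⁻¹ • ∫ y in Metric.ball c ε, h y) (𝓝[>] 0)
      (𝓝 (h c)) := by
  rw [Metric.tendsto_nhdsWithin_nhds]
  intro δ hδ
  obtain ⟨η, hη, hclose⟩ := Metric.continuous_iff.1 hc c (δ / 2) (by linarith)
  refine ⟨η, hη, fun ε hε hεη => ?_⟩
  have hε0 : 0 < ε := hε
  rw [Real.dist_eq, sub_zero, abs_of_pos hε0] at hεη
  have hv := volume_real_ball c hε0.le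
  have hv0 : 0 < Real.pi * ε ^ 2 := by have := Real.pi_pos; positivity
  have hi : IntegrableOn h (Metric.ball c ε) :=
    (hc.continuousOn.integrableOn_compact (isCompact_closedBall c ε)).mono_set
      Metric.ball_subset_closedBall
  have h1 : (Real.pi * ε ^ 2)⁻¹ • ∫ y in Metric.ball c ε, h y
      = h c + (Real.pi * ε ^ 2)⁻¹ • ∫ y in Metric.ball c ε, (h y - h c) := by
    rw [integral_sub hi (integrableOn_const measure_ball_lt_top.ne (by simp)), setIntegral_const,
      hv, smul_sub, smul_smul, inv_mul_cancel₀ hv0.ne', one_smul]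
    abel
  have h2 : ‖∫ y in Metric.ball c ε, (h y - h c)‖ ≤ δ / 2 * (Real.pi * ε ^ 2) := by
    rw [← hv]
    apply norm_setIntegral_le_of_norm_le_const measure_ball_lt_top
    intro y hy
    rw [← dist_eq_norm]
    exact (hclose y ((Metric.mem_ball.1 hy).trans hεη)).le
  rw [h1, dist_eq_norm, add_sub_cancel_left, norm_smul, norm_inv, Real.norm_of_nonneg hv0.le]
  calc _ ≤ (Real.pi * ε ^ 2)⁻¹ * (δ / 2 * (Real.pi * ε ^ 2)) := by gcongr
    _ = δ / 2 := by field_simp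
    _ < δ := by linarith

lemma sumDensity_nonneg {S : Finset (Fin n)} (hS : smoothRank ≤ S.card) (y : ℂ) :
    0 ≤ sumDensity S.card y := by
  refine ge_of_tendsto (tendsto_average_ball (continuous_sumDensity hS) y) ?_
  filter_upwards [self_mem_nhdsWithin] with ε hε
  rw [← measureReal_blockSum_mem_ball hS y hε, smul_eq_mul]
  have := Real.pi_pos
  positivity

/-- The event that the walk returns to within distance `ε` of its starting point. -/
def nearReturn (n : ℕ) (ε : ℝ) : Set (Fin n → ℂ) := blockSum Finset.univ ⁻¹' Metric.ball 0 ε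

lemma nearReturn_eq (ε : ℝ) : {s : Fin n → ℂ | ‖vertex s n - vertex s 0‖ < ε} = nearReturn n ε := by
  ext s
  simp [nearReturn, vertex_self, vertex_zero]

lemma measurableSet_nearReturn (ε : ℝ) : MeasurableSet (nearReturn n ε) :=
  measurable_blockSum _ Metric.isOpen_ball.measurableSet

lemma integral_cond_walkLaw {E : Type*} [NormedAddCommGroup E] [NormedSpace ℝ E]
    (B : Set (Fin n → ℂ)) (f : (Fin n → ℂ) → E) :
    ∫ s, f s ∂(cond (walkLaw n) B) = ((walkLaw n).real B)⁻¹ • ∫ s in B, f s ∂walkLaw n := by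
  rw [ProbabilityTheory.cond, integral_smul_measure, ENNReal.toReal_inv]
  rfl

lemma tendsto_measureReal_nearReturn (hn : smoothRank ≤ n) :
    Tendsto (fun ε : ℝ => (Real.pi * ε ^ 2)⁻¹ * (walkLaw n).real (nearReturn n ε)) (𝓝[>] 0)
      (𝓝 (sumDensity n 0)) := by
  have hc : (Finset.univ : Finset (Fin n)).card = n := Finset.card_fin n
  refine (tendsto_average_ball (continuous_sumDensity hn) 0).congr' ?_
  filter_upwards [self_mem_nhdsWithin] with ε hε
  rw [nearReturn, measureReal_blockSum_mem_ball (by rw [hc]; exact hn) 0 hε, hc, smul_eq_mul]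

lemma eventually_measureReal_nearReturn_pos (hn : smoothRank ≤ n) (hp : 0 < sumDensity n 0) :
    ∀ᶠ ε : ℝ in 𝓝[>] 0, 0 < (walkLaw n).real (nearReturn n ε) := by
  filter_upwards [(tendsto_measureReal_nearReturn hn).eventually (eventually_gt_nhds hp),
    self_mem_nhdsWithin] with ε h1 h2
  have h0 : 0 < (Real.pi * ε ^ 2)⁻¹ := by
    have := Real.pi_pos
    have : 0 < ε := h2
    positivity
  exact (pos_iff_pos_of_mul_pos h1).1 h0

/-- Limits of conditional expectations, computed from normalized integrals. -/
lemma tendsto_integral_cond_of_tendsto {E : Type*} [NormedAddCommGroup E] [NormedSpace ℝ E]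
    (hn : smoothRank ≤ n) (hp : 0 < sumDensity n 0) {f : (Fin n → ℂ) → E} {z : E}
    (h : Tendsto (fun ε : ℝ => (Real.pi * ε ^ 2)⁻¹ • ∫ s in nearReturn n ε, f s ∂walkLaw n)
      (𝓝[>] 0) (𝓝 z)) :
    Tendsto (fun ε : ℝ => ∫ s, f s ∂(cond (walkLaw n) (nearReturn n ε))) (𝓝[>] 0)
      (𝓝 ((sumDensity n 0)⁻¹ • z)) := by
  refine (((tendsto_measureReal_nearReturn hn).inv₀ hp.ne').smul h).congr' ?_
  filter_upwards [self_mem_nhdsWithin] with ε hε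
  have : Real.pi * ε ^ 2 ≠ 0 := by
    have := Real.pi_pos
    have : 0 < ε := hε
    positivity
  rw [integral_cond_walkLaw, smul_smul, mul_inv, inv_inv, mul_right_comm, mul_inv_cancel₀ this,
    one_mul]

lemma integrable_prod_stepChar (hn : smoothRank ≤ n) (a : Fin n → ℂ) :
    Integrable (fun w : ℂ => ∏ i, stepChar (a i + w)) := by
  have hκ := decayExp_pos
  have hshift : ∀ (b w : ℂ), ‖stepChar (b + w)‖
      ≤ (2 * (1 + ‖b‖ ^ 2)) ^ decayExp * (1 + ‖w‖ ^ 2) ^ (-decayExp) := by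
    intro b w
    refine (norm_stepChar_le _).trans ?_
    have h1 : 1 + ‖w‖ ^ 2 ≤ 2 * (1 + ‖b‖ ^ 2) * (1 + ‖b + w‖ ^ 2) := by
      have h2 : ‖w‖ ≤ ‖b + w‖ + ‖b‖ := by
        calc ‖w‖ = ‖(b + w) - b‖ := by congr 1; ring
          _ ≤ _ := norm_sub_le _ _
      have h3 : ‖w‖ ^ 2 ≤ (‖b + w‖ + ‖b‖) ^ 2 := by gcongr
      nlinarith [sq_nonneg (‖b + w‖ - ‖b‖), mul_nonneg (sq_nonneg ‖b‖) (sq_nonneg ‖b + w‖)]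
    have h4 : (1 + ‖w‖ ^ 2) ^ decayExp
        ≤ (2 * (1 + ‖b‖ ^ 2)) ^ decayExp * (1 + ‖b + w‖ ^ 2) ^ decayExp := by
      rw [← Real.mul_rpow (by positivity) (by positivity)]
      exact Real.rpow_le_rpow (by positivity) h1 hκ.le
    rw [Real.rpow_neg (by positivity), Real.rpow_neg (by positivity), ← div_eq_mul_inv,
      le_div_iff₀ (by positivity), inv_mul_le_iff₀ (by positivity), mul_comm]
    exact h4
  have hint := (integrable_one_add_norm_sq_rpow (a := decayExp * n)
    (by linarith [four_le_decayExp_mul hn])).const_mul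
    (∏ i, (2 * (1 + ‖a i‖ ^ 2)) ^ decayExp)
  refine hint.mono' ?_ ?_
  · have := continuous_stepChar
    apply Continuous.aestronglyMeasurable
    fun_prop
  · filter_upwards with w
    rw [norm_prod]
    calc ∏ i, ‖stepChar (a i + w)‖
        ≤ ∏ i, ((2 * (1 + ‖a i‖ ^ 2)) ^ decayExp * (1 + ‖w‖ ^ 2) ^ (-decayExp)) :=
          Finset.prod_le_prod (fun _ _ => norm_nonneg _) (fun i _ => hshift _ _)
      _ = _ := by
          rw [Finset.prod_mul_distrib, Finset.prod_const, Finset.card_fin, ← Real.rpow_natCast,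
            ← Real.rpow_mul (by positivity), neg_mul]

/-- The characteristic functions of the conditional laws converge. -/
lemma exists_tendsto_integral_cond_char (hn : smoothRank ≤ n) (hp : 0 < sumDensity n 0)
    (a : Fin n → ℂ) : ∃ z : ℂ,
    Tendsto (fun ε : ℝ => ∫ s, (𝐞 (∑ i, ⟪s i, a i⟫) : ℂ) ∂(cond (walkLaw n) (nearReturn n ε)))
      (𝓝[>] 0) (𝓝 z) := by
  have hchar : (fun w : ℂ => ∫ s, (𝐞 (∑ i, ⟪s i, a i⟫) : ℂ)
      * (𝐞 ⟪blockSum Finset.univ s, w⟫ : ℂ) ∂walkLaw n) = fun w => ∏ i, stepChar (a i + w) := by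
    funext w
    have := integral_prod_fourierChar_walkLaw a Finset.univ w
    simp only [Finset.mem_univ, if_true] at this
    rw [← this]
    congr with s
    rw [coe_fourierChar_sum]
  have hint := integrable_prod_stepChar hn a
  have hcont : Continuous (𝓕 (fun w : ℂ => ∏ i, stepChar (a i + w))) :=
    VectorFourier.fourierIntegral_continuous Real.continuous_fourierChar
      (by exact continuous_inner) hint
  refine ⟨_, tendsto_integral_cond_of_tendsto hn hp
    ((tendsto_average_ball hcont 0).congr' ?_)⟩
  filter_upwards [self_mem_nhdsWithin] with ε hε
  have h := setIntegral_preimage_ball_eq (μ := walkLaw n)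
    (F := fun s => (𝐞 (∑ i, ⟪s i, a i⟫) : ℂ)) (X := blockSum Finset.univ)
    (by apply Continuous.measurable; fun_prop) (fun s => (Circle.norm_coe _).le) (measurable_blockSum _)
    (by rw [hchar]; exact hint) 0 hε
  rw [hchar] at h
  rw [← h]
  rfl

/-- The Euclidean inner product of step sequences, which supplies the characters of `Fin n → ℂ`. -/
noncomputable def stepPairing (n : ℕ) : (Fin n → ℂ) →ₗ[ℝ] (Fin n → ℂ) →ₗ[ℝ] ℝ :=
  LinearMap.mk₂ ℝ (fun s a => ∑ i, ⟪s i, a i⟫)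
    (fun s t a => by simp [inner_add_left, Finset.sum_add_distrib])
    (fun c s a => by simp only [Pi.smul_apply, real_inner_smul_left, smul_eq_mul, Finset.mul_sum])
    (fun s a b => by simp [inner_add_right, Finset.sum_add_distrib])
    (fun c s a => by simp only [Pi.smul_apply, real_inner_smul_right, smul_eq_mul, Finset.mul_sum])

/-- Existence of the polygon law: the conditional laws are supported by a common compact set, and
any cluster point of them is their limit because their characteristic functions converge. -/
lemma exists_isPolygonLaw (hn : smoothRank ≤ n) (hp : 0 < sumDensity n 0) :
    ∃ P : Measure (Fin n → ℂ), IsPolygonLaw n P := by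
  classical
  -- the conditional laws; for `ε` with a null event, the law of the walk serves as a filler
  let μ : ℝ → ProbabilityMeasure (Fin n → ℂ) := fun ε =>
    if h : walkLaw n (nearReturn n ε) ≠ 0 then
      ⟨cond (walkLaw n) (nearReturn n ε), cond_isProbabilityMeasure h⟩
    else ⟨walkLaw n, inferInstance⟩
  have hμ1 : ∀ ε, ∀ h : walkLaw n (nearReturn n ε) ≠ 0,
      μ ε = ⟨cond (walkLaw n) (nearReturn n ε), cond_isProbabilityMeasure h⟩ :=
    fun ε h => dif_pos h
  have hμ : ∀ᶠ ε in 𝓝[>] (0 : ℝ),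
      (μ ε : Measure (Fin n → ℂ)) = cond (walkLaw n) (nearReturn n ε) := by
    filter_upwards [eventually_measureReal_nearReturn_pos hn hp] with ε hε
    have h : walkLaw n (nearReturn n ε) ≠ 0 := by
      intro h0
      simp [measureReal_def, h0] at hε
    exact congrArg _ (hμ1 ε h)
  have hac : ∀ ε, (μ ε : Measure (Fin n → ℂ)) ≪ walkLaw n := by
    intro ε
    by_cases h : walkLaw n (nearReturn n ε) ≠ 0
    · rw [hμ1 ε h]
      exact cond_absolutelyContinuous
    · rw [show μ ε = ⟨walkLaw n, inferInstance⟩ from dif_neg h]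
      exact Measure.AbsolutelyContinuous.refl _
  have htight : IsTightMeasureSet {(μ ε : Measure (Fin n → ℂ)) | ε} := by
    rw [isTightMeasureSet_iff_exists_isCompact_measure_compl_le]
    intro δ _
    refine ⟨Metric.closedBall 0 1, isCompact_closedBall _ _, ?_⟩
    rintro _ ⟨ε, rfl⟩
    have : walkLaw n (Metric.closedBall (0 : Fin n → ℂ) 1)ᶜ = 0 := by
      rw [← mem_ae_iff]
      filter_upwards [ae_norm_walkLaw] with s hs
      rw [mem_closedBall_zero_iff, pi_norm_le_iff_of_nonneg zero_le_one]
      exact fun i => (hs i).le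
    rw [hac ε this]
    exact zero_le
  have hcompact : IsCompact (closure {x | ∃ ε, μ ε = x}) := by
    apply isCompact_closure_of_isTightMeasureSet
    convert htight using 1
    ext x; simp
  let U : Ultrafilter ℝ := Ultrafilter.of (𝓝[>] 0)
  have hU : (U : Filter ℝ) ≤ 𝓝[>] 0 := Ultrafilter.of_le _
  obtain ⟨μ₀, -, hμ₀⟩ := hcompact.ultrafilter_le_nhds (U.map μ)
    (.trans (by simp) (Filter.monotone_principal subset_closure))
  have hμ₀ : Tendsto μ U (𝓝 μ₀) := hμ₀
  have hcontL : Continuous fun p : (Fin n → ℂ) × (Fin n → ℂ) => stepPairing n p.1 p.2 := by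
    simp only [stepPairing, LinearMap.mk₂_apply]
    fun_prop
  have hchar : ∀ a : Fin n → ℂ, Tendsto
      (fun ε => ∫ s, (Real.fourierChar (stepPairing n s a) : ℂ) ∂(μ ε : Measure (Fin n → ℂ)))
      (𝓝[>] 0)
      (𝓝 (∫ s, (Real.fourierChar (stepPairing n s a) : ℂ) ∂(μ₀ : Measure (Fin n → ℂ)))) := by
    intro a
    obtain ⟨z, hz⟩ := exists_tendsto_integral_cond_char hn hp a
    have hz' : Tendsto
        (fun ε => ∫ s, (Real.fourierChar (stepPairing n s a) : ℂ) ∂(μ ε : Measure (Fin n → ℂ)))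
        (𝓝[>] 0) (𝓝 z) := by
      refine hz.congr' ?_
      filter_upwards [hμ] with ε hε
      rw [hε]
      rfl
    rw [ProbabilityMeasure.tendsto_iff_forall_integral_rclike_tendsto ℂ] at hμ₀
    have h1 := hμ₀ (BoundedContinuousFunction.char Real.continuous_fourierChar hcontL a)
    have h2 := tendsto_nhds_unique h1 (hz'.mono_left hU)
    simp only [BoundedContinuousFunction.char_apply] at h2
    rw [h2]
    exact hz'
  have hne1 : Real.fourierChar ≠ 1 := by
    intro h
    have := DFunLike.congr_fun h (1 / 2 : ℝ)
    have h2 := congrArg (fun z : Circle => (z : ℂ)) this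
    simp only [Real.fourierChar_apply, AddChar.one_apply, Circle.coe_one] at h2
    rw [show ((2 * Real.pi * (1 / 2) : ℝ) : ℂ) * Complex.I = Real.pi * Complex.I by
      push_cast; ring, Complex.exp_pi_mul_I] at h2
    norm_num at h2
  have hL0 : ∀ v : Fin n → ℂ, v ≠ 0 → stepPairing n v ≠ 0 := by
    intro v hv h
    have h1 : stepPairing n v v = 0 := by rw [h]; rfl
    simp only [stepPairing, LinearMap.mk₂_apply] at h1
    rw [Finset.sum_eq_zero_iff_of_nonneg (fun i _ => real_inner_self_nonneg)] at h1
    exact hv (funext fun i => inner_self_eq_zero.1 (h1 i (Finset.mem_univ i)))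
  have hlim : Tendsto μ (𝓝[>] 0) (𝓝 μ₀) := by
    refine ProbabilityMeasure.tendsto_of_tight_of_separatesPoints ℂ htight
      (A := BoundedContinuousFunction.charPoly Real.continuous_fourierChar hcontL)
      (BoundedContinuousFunction.separatesPoints_charPoly Real.continuous_fourierChar hne1
        hcontL hL0) ?_
    intro g hg
    rw [BoundedContinuousFunction.mem_charPoly] at hg
    obtain ⟨w, hw⟩ := hg
    have h_eq (μ : Measure (Fin n → ℂ)) (hμ : IsProbabilityMeasure μ) :
        ∫ x, g x ∂μ
          = w.coeff.sum (fun a z => z * ∫ x, (Real.fourierChar (stepPairing n x a) : ℂ) ∂μ) := by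
      simp_rw [hw, Finsupp.sum]
      rw [integral_finsetSum]
      · congr with y
        rw [integral_const_mul]
      · refine fun i hi => Integrable.const_mul ?_ _
        exact BoundedContinuousFunction.integrable μ
          (BoundedContinuousFunction.char Real.continuous_fourierChar hcontL i)
    simp_rw [h_eq (μ _) inferInstance, h_eq μ₀ inferInstance]
    exact tendsto_finsetSum _ fun y _ => (hchar y).const_mul _
  refine ⟨μ₀, inferInstance, fun g => ?_⟩
  have h1 := (ProbabilityMeasure.tendsto_iff_forall_integral_tendsto.1 hlim) g
  refine h1.congr' ?_
  filter_upwards [hμ] with ε hε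
  rw [hε, nearReturn_eq]

lemma IsPolygonLaw.unique {P P' : Measure (Fin n → ℂ)} (h : IsPolygonLaw n P)
    (h' : IsPolygonLaw n P') : P = P' := by
  have := h.1
  have := h'.1
  exact ext_of_forall_integral_eq_of_IsFiniteMeasure fun g => tendsto_nhds_unique (h.2 g) (h'.2 g)

/-! ### Comparison of the polygon with the walk -/

lemma blockSum_univ_eq_add (D : Finset (Fin n)) (s : Fin n → ℂ) :
    blockSum Finset.univ s = blockSum Finset.univ (keep Dᶜ s) + blockSum D s := by
  rw [blockSum_univ_keep]
  exact (Finset.sum_compl_add_sum D s).symm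

lemma setIntegral_nearReturn_eq (D : Finset (Fin n)) (ε : ℝ)
    (g : BoundedContinuousFunction (Fin n → ℂ) ℝ) :
    ∫ s in nearReturn n ε, g (keep Dᶜ s) ∂walkLaw n
      = ∫ x, g x * (walkLaw n).real (blockSum D ⁻¹' Metric.ball (-(blockSum Finset.univ x)) ε)
          ∂((walkLaw n).map (keep Dᶜ)) := by
  have hind := indepFun_keep_blockSum (n := n) (S := Dᶜ) (T := D) disjoint_compl_left
  rw [indepFun_iff_map_prod_eq_prod_map_map (measurable_keep _).aemeasurable
    (measurable_blockSum _).aemeasurable] at hind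
  have := Measure.isProbabilityMeasure_map (μ := walkLaw n) (measurable_keep Dᶜ).aemeasurable
  have := Measure.isProbabilityMeasure_map (μ := walkLaw n) (measurable_blockSum D).aemeasurable
  set A : Set ((Fin n → ℂ) × ℂ) := {p | ‖blockSum Finset.univ p.1 + p.2‖ < ε} with hA
  have hAm : MeasurableSet A :=
    measurableSet_lt (((measurable_blockSum _).comp measurable_fst).add measurable_snd).norm
      measurable_const
  have hF : Measurable (A.indicator (fun p : (Fin n → ℂ) × ℂ => g p.1)) :=
    (g.continuous.measurable.comp measurable_fst).indicator hAm
  have hFi : Integrable (A.indicator (fun p : (Fin n → ℂ) × ℂ => g p.1))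
      (((walkLaw n).map (keep Dᶜ)).prod ((walkLaw n).map (blockSum D))) := by
    refine (integrable_const ‖g‖).mono' hF.aestronglyMeasurable (ae_of_all _ fun p => ?_)
    exact (norm_indicator_le_norm_self _ _).trans (g.norm_coe_le_norm _)
  calc ∫ s in nearReturn n ε, g (keep Dᶜ s) ∂walkLaw n
      = ∫ s, A.indicator (fun p : (Fin n → ℂ) × ℂ => g p.1) (keep Dᶜ s, blockSum D s)
          ∂walkLaw n := by
        rw [← integral_indicator (measurableSet_nearReturn ε)]
        congr with s
        have hiff : s ∈ nearReturn n ε ↔ (keep Dᶜ s, blockSum D s) ∈ A := by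
          simp only [nearReturn, Set.mem_preimage, mem_ball_zero_iff, hA, Set.mem_ofPred_eq]
          rw [blockSum_univ_eq_add D s]
        by_cases hs : s ∈ nearReturn n ε
        · rw [Set.indicator_of_mem hs, Set.indicator_of_mem (hiff.1 hs)]
        · rw [Set.indicator_of_notMem hs, Set.indicator_of_notMem (fun h => hs (hiff.2 h))]
    _ = ∫ p, A.indicator (fun p : (Fin n → ℂ) × ℂ => g p.1) p
          ∂(((walkLaw n).map (keep Dᶜ)).prod ((walkLaw n).map (blockSum D))) := by
        rw [← hind, integral_map ((measurable_keep _).prodMk (measurable_blockSum _)).aemeasurable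
          hF.aestronglyMeasurable]
    _ = _ := by
        rw [integral_prod _ hFi]
        congr with x
        have hAx : MeasurableSet (Metric.ball (-(blockSum Finset.univ x)) ε) := measurableSet_ball
        have : ∀ y, A.indicator (fun p : (Fin n → ℂ) × ℂ => g p.1) (x, y)
            = (Metric.ball (-(blockSum Finset.univ x)) ε).indicator (fun _ => g x) y := by
          intro y
          have hiff : y ∈ Metric.ball (-(blockSum Finset.univ x)) ε ↔ (x, y) ∈ A := by
            simp only [Metric.mem_ball, dist_eq_norm, sub_neg_eq_add, hA, Set.mem_ofPred_eq,
              add_comm]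
          by_cases hy : y ∈ Metric.ball (-(blockSum Finset.univ x)) ε
          · rw [Set.indicator_of_mem hy, Set.indicator_of_mem (hiff.1 hy)]
          · rw [Set.indicator_of_notMem hy, Set.indicator_of_notMem (fun h => hy (hiff.2 h))]
        simp_rw [this]
        rw [integral_indicator_const _ hAx, smul_eq_mul, mul_comm,
          map_measureReal_apply (measurable_blockSum D) hAx]

/-- Outside a long block `D`, the polygon law has a density with respect to the walk: the density
at which the steps in `D` close the path. -/
theorem IsPolygonLaw.map_keep_eq {P : Measure (Fin n → ℂ)} (h : IsPolygonLaw n P)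
    (hp : 0 < sumDensity n 0) {D : Finset (Fin n)} (hD : smoothRank ≤ D.card) :
    P.map (keep Dᶜ) = ((walkLaw n).map (keep Dᶜ)).withDensity (fun x =>
      ENNReal.ofReal (sumDensity D.card (-(blockSum Finset.univ x)) / sumDensity n 0)) := by
  have hn : smoothRank ≤ n := hD.trans (by simpa using Finset.card_le_univ D)
  have := h.1
  have hR := Measure.isProbabilityMeasure_map (μ := walkLaw n) (measurable_keep Dᶜ).aemeasurable
  have hρc : Continuous (fun x : Fin n → ℂ =>
      sumDensity D.card (-(blockSum Finset.univ x)) / sumDensity n 0) := by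
    have h1 := continuous_sumDensity hD
    have h2 := continuous_blockSum (Finset.univ : Finset (Fin n))
    exact (h1.comp h2.neg).div_const _
  have hρ0 : ∀ x : Fin n → ℂ,
      0 ≤ sumDensity D.card (-(blockSum Finset.univ x)) / sumDensity n 0 :=
    fun x => div_nonneg (sumDensity_nonneg hD _) hp.le
  have hfin : IsFiniteMeasure (((walkLaw n).map (keep Dᶜ)).withDensity (fun x =>
      ENNReal.ofReal (sumDensity D.card (-(blockSum Finset.univ x)) / sumDensity n 0))) := by
    apply isFiniteMeasure_withDensity_ofReal
    refine Integrable.hasFiniteIntegral ?_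
    refine (integrable_const (densityBound D.card / sumDensity n 0)).mono'
      hρc.aestronglyMeasurable (ae_of_all _ fun x => ?_)
    rw [norm_div, Real.norm_of_nonneg hp.le]
    gcongr
    exact abs_sumDensity_le _ _
  refine ext_of_forall_integral_eq_of_IsFiniteMeasure fun g => ?_
  rw [integral_map (measurable_keep _).aemeasurable g.continuous.aestronglyMeasurable]
  have h1 := h.2 (g.compContinuous ⟨keep Dᶜ, continuous_keep _⟩)
  simp only [nearReturn_eq] at h1
  have h2 : Tendsto (fun ε : ℝ => (Real.pi * ε ^ 2)⁻¹ •
      ∫ s in nearReturn n ε, g.compContinuous ⟨keep Dᶜ, continuous_keep _⟩ s ∂walkLaw n) (𝓝[>] 0)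
      (𝓝 (∫ x, g x * sumDensity D.card (-(blockSum Finset.univ x))
        ∂((walkLaw n).map (keep Dᶜ)))) := by
    have hdom : Tendsto (fun ε : ℝ => ∫ x, g x * ((Real.pi * ε ^ 2)⁻¹ •
          ∫ y in Metric.ball (-(blockSum Finset.univ x)) ε, sumDensity D.card y)
        ∂((walkLaw n).map (keep Dᶜ))) (𝓝[>] 0)
        (𝓝 (∫ x, g x * sumDensity D.card (-(blockSum Finset.univ x))
          ∂((walkLaw n).map (keep Dᶜ)))) := by
      have hbound : ∀ ε : ℝ, 0 < ε → ∀ c : ℂ,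
          |(Real.pi * ε ^ 2)⁻¹ • ∫ y in Metric.ball c ε, sumDensity D.card y|
            ≤ densityBound D.card := by
        intro ε hε c
        have hv : 0 < Real.pi * ε ^ 2 := by have := Real.pi_pos; positivity
        rw [← measureReal_blockSum_mem_ball hD c hε, smul_eq_mul, abs_of_nonneg (by positivity),
          inv_mul_le_iff₀ hv, mul_comm]
        exact measureReal_blockSum_mem_ball_le hD c hε
      refine tendsto_integral_filter_of_dominated_convergence
        (fun _ => ‖g‖ * densityBound D.card) ?_ ?_ (integrable_const _) ?_
      · filter_upwards [self_mem_nhdsWithin] with ε hε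
        simp only [smul_eq_mul]
        refine (g.continuous.measurable.mul (Measurable.const_mul ?_ _)).aestronglyMeasurable
        have : ∀ x : Fin n → ℂ, (∫ y in Metric.ball (-(blockSum Finset.univ x)) ε,
            sumDensity D.card y) = (walkLaw n).real (Prod.mk x ⁻¹'
              {p : (Fin n → ℂ) × (Fin n → ℂ) |
                ‖blockSum Finset.univ p.1 + blockSum D p.2‖ < ε}) := by
          intro x
          rw [← measureReal_blockSum_mem_ball hD _ hε]
          congr 1
          ext s
          simp [dist_eq_norm, add_comm]
        simp_rw [this]
        refine (measurable_measure_prodMk_left ?_).ennreal_toReal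
        exact measurableSet_lt (((measurable_blockSum _).comp measurable_fst).add
          ((measurable_blockSum _).comp measurable_snd)).norm measurable_const
      · filter_upwards [self_mem_nhdsWithin] with ε hε
        refine ae_of_all _ fun x => ?_
        rw [norm_mul]
        exact mul_le_mul (g.norm_coe_le_norm _) (hbound ε hε _) (norm_nonneg _) (norm_nonneg _)
      · exact ae_of_all _ fun x =>
          (tendsto_average_ball (continuous_sumDensity hD) _).const_mul _
    refine hdom.congr' ?_
    filter_upwards [self_mem_nhdsWithin] with ε hε
    have := setIntegral_nearReturn_eq D ε g
    simp only [BoundedContinuousFunction.compContinuous_apply, ContinuousMap.coe_mk]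
    rw [this, smul_eq_mul, ← integral_const_mul]
    congr with x
    rw [measureReal_blockSum_mem_ball hD _ hε, smul_eq_mul]
    ring
  have h3 := tendsto_nhds_unique h1 (tendsto_integral_cond_of_tendsto hn hp h2)
  simp only [BoundedContinuousFunction.compContinuous_apply, ContinuousMap.coe_mk] at h3
  rw [h3, integral_withDensity_eq_integral_toReal_smul hρc.measurable.ennreal_ofReal
    (ae_of_all _ fun x => ENNReal.ofReal_lt_top), smul_eq_mul, ← integral_const_mul]
  congr with x
  rw [ENNReal.toReal_ofReal (hρ0 x), smul_eq_mul]
  ring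

/-- `E` is an event about the steps with indices in `S`. -/
def DeterminedBy (S : Finset (Fin n)) (E : Set (Fin n → ℂ)) : Prop :=
  ∀ s, keep S s ∈ E ↔ s ∈ E

lemma DeterminedBy.mono {S T : Finset (Fin n)} {E : Set (Fin n → ℂ)} (h : DeterminedBy S E)
    (hST : S ⊆ T) : DeterminedBy T E := by
  intro s
  have : keep S (keep T s) = keep S s := by
    funext i
    by_cases hi : i ∈ S
    · rw [keep_of_mem hi, keep_of_mem hi, keep_of_mem (hST hi)]
    · simp [keep, hi]
  rw [← h (keep T s), this, h s]

lemma DeterminedBy.inter {S T : Finset (Fin n)} {E F : Set (Fin n → ℂ)} (hE : DeterminedBy S E)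
    (hF : DeterminedBy T F) : DeterminedBy (S ∪ T) (E ∩ F) := by
  intro s
  exact and_congr (hE.mono Finset.subset_union_left s) (hF.mono Finset.subset_union_right s)

lemma measureReal_inter_of_determinedBy {S T : Finset (Fin n)} {E F : Set (Fin n → ℂ)}
    (hE : DeterminedBy S E) (hF : DeterminedBy T F) (hEm : MeasurableSet E)
    (hFm : MeasurableSet F) (hST : Disjoint S T) :
    (walkLaw n).real (E ∩ F) = (walkLaw n).real E * (walkLaw n).real F := by
  have h := (indepFun_keep hST).measure_inter_preimage_eq_mul E F hEm hFm
  have e1 : keep S ⁻¹' E = E := Set.ext hE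
  have e2 : keep T ⁻¹' F = F := Set.ext hF
  rw [e1, e2] at h
  simp only [measureReal_def, h, ENNReal.toReal_mul]

section Compare

variable {P : Measure (Fin n → ℂ)} {D : Finset (Fin n)} {E : Set (Fin n → ℂ)}

lemma IsPolygonLaw.measure_eq_lintegral (h : IsPolygonLaw n P) (hp : 0 < sumDensity n 0)
    (hD : smoothRank ≤ D.card) (hE : DeterminedBy Dᶜ E) (hEm : MeasurableSet E) :
    P E = ∫⁻ s in E, ENNReal.ofReal (sumDensity D.card (-(blockSum Dᶜ s)) / sumDensity n 0)
      ∂walkLaw n := by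
  have e1 : keep Dᶜ ⁻¹' E = E := Set.ext hE
  have hm : Measurable (fun x : Fin n → ℂ =>
      ENNReal.ofReal (sumDensity D.card (-(blockSum Finset.univ x)) / sumDensity n 0)) := by
    have h1 := (continuous_sumDensity hD).measurable
    have h2 := measurable_blockSum (Finset.univ : Finset (Fin n))
    exact ((h1.comp h2.neg).div_const _).ennreal_ofReal
  have h1 := congrArg (fun μ : Measure (Fin n → ℂ) => μ E) (h.map_keep_eq hp hD)
  beta_reduce at h1
  rw [Measure.map_apply (measurable_keep _) hEm, e1, withDensity_apply _ hEm,
    setLIntegral_map hEm hm (measurable_keep _), e1] at h1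
  rw [h1]
  simp only [blockSum_univ_keep]

/-- An event that does not involve a block of `d` steps is at most
`densityBound d / sumDensity n 0` times as likely for the polygon as for the walk. -/
lemma IsPolygonLaw.measureReal_le (h : IsPolygonLaw n P) (hp : 0 < sumDensity n 0)
    (hD : smoothRank ≤ D.card) (hE : DeterminedBy Dᶜ E) (hEm : MeasurableSet E) :
    P.real E ≤ densityBound D.card / sumDensity n 0 * (walkLaw n).real E := by
  have hle : P E ≤ ENNReal.ofReal (densityBound D.card / sumDensity n 0) * walkLaw n E := by
    rw [h.measure_eq_lintegral hp hD hE hEm, ← setLIntegral_const]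
    refine lintegral_mono fun s => ENNReal.ofReal_le_ofReal ?_
    gcongr
    exact (le_abs_self _).trans (abs_sumDensity_le _ _)
  have h3 := ENNReal.toReal_mono (by finiteness) hle
  rwa [ENNReal.toReal_mul, ENNReal.toReal_ofReal
    (div_nonneg (densityBound_nonneg _) hp.le)] at h3

lemma IsPolygonLaw.le_measureReal (h : IsPolygonLaw n P) (hp : 0 < sumDensity n 0)
    (hD : smoothRank ≤ D.card) (hE : DeterminedBy Dᶜ E) (hEm : MeasurableSet E) {a : ℝ}
    (ha : ∀ᵐ s ∂walkLaw n, s ∈ E →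
      sumDensity n 0 * a ≤ sumDensity D.card (-(blockSum Dᶜ s))) :
    a * (walkLaw n).real E ≤ P.real E := by
  have := h.1
  rcases le_or_gt a 0 with ha0 | ha0
  · exact (mul_nonpos_of_nonpos_of_nonneg ha0 measureReal_nonneg).trans measureReal_nonneg
  have hle : ENNReal.ofReal a * walkLaw n E ≤ P E := by
    rw [h.measure_eq_lintegral hp hD hE hEm, ← setLIntegral_const]
    refine setLIntegral_mono_ae' hEm ?_
    filter_upwards [ha] with s hs hsE
    apply ENNReal.ofReal_le_ofReal
    rw [le_div_iff₀ hp, mul_comm]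
    exact hs hsE
  have h3 := ENNReal.toReal_mono (measure_ne_top _ _) hle
  rwa [ENNReal.toReal_mul, ENNReal.toReal_ofReal ha0.le] at h3

end Compare

/-! ### Crossing edges -/

/-- The event that the edges `i` and `j` cross. -/
def crossing (i j : Fin n) : Set (Fin n → ℂ) := {s | EdgesCross s i j}

lemma vertex_eq_add_blockSum {i j : Fin n} (hij : i ≤ j) (s : Fin n → ℂ) :
    vertex s j = vertex s i + blockSum (Finset.Ico i j) s := by
  unfold vertex blockSum
  rw [← Finset.sum_union]
  · congr 1
    ext k
    simp only [Finset.mem_filter, Finset.mem_univ, true_and, Finset.mem_union, Finset.mem_Ico]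
    omega
  · rw [Finset.disjoint_left]
    intro k hk hk'
    simp only [Finset.mem_filter, Finset.mem_univ, true_and, Finset.mem_Ico] at hk hk'
    omega

lemma vertex_succ (i : Fin n) (s : Fin n → ℂ) : vertex s (i + 1) = vertex s i + s i := by
  unfold vertex
  have : (Finset.univ.filter (fun k : Fin n => k.val < i + 1))
      = insert i (Finset.univ.filter (fun k : Fin n => k.val < i)) := by
    ext k
    simp only [Finset.mem_filter, Finset.mem_univ, true_and, Finset.mem_insert]
    omega
  rw [this, Finset.sum_insert (by simp), add_comm]

lemma mem_crossing_iff {i j : Fin n} (hij : i ≤ j) (s : Fin n → ℂ) :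
    s ∈ crossing i j ↔ ∃ q ∈ Set.Ioo (0 : ℝ) 1 ×ˢ Set.Ioo (0 : ℝ) 1,
      q.1 • s i = blockSum (Finset.Ico i j) s + q.2 • s j := by
  simp only [crossing, Set.mem_ofPred_eq, EdgesCross, openSegment_eq_image', vertex_succ,
    add_sub_cancel_left, vertex_eq_add_blockSum hij]
  constructor
  · rintro ⟨z, ⟨θ, hθ, rfl⟩, τ, hτ, h⟩
    refine ⟨(θ, τ), ⟨hθ, hτ⟩, ?_⟩
    simp only at h ⊢
    rw [add_assoc] at h
    exact (add_left_cancel h).symm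
  · rintro ⟨⟨θ, τ⟩, ⟨hθ, hτ⟩, h⟩
    refine ⟨vertex s i + θ • s i, ⟨θ, hθ, rfl⟩, τ, hτ, ?_⟩
    simp only at h ⊢
    rw [h, add_assoc]

lemma determinedBy_crossing {i j : Fin n} (hij : i ≤ j) :
    DeterminedBy (Finset.Icc i j) (crossing i j) := by
  intro s
  rw [mem_crossing_iff hij, mem_crossing_iff hij,
    blockSum_keep_of_subset Finset.Ico_subset_Icc_self, keep_of_mem (Finset.left_mem_Icc.2 hij),
    keep_of_mem (Finset.right_mem_Icc.2 hij)]

/-- The crossing event is a countable union of closed sets: the parameters of the crossing point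
may be confined to one of countably many compact squares exhausting the open unit square. -/
lemma measurableSet_crossing {i j : Fin n} (hij : i ≤ j) : MeasurableSet (crossing i j) := by
  let K : ℕ → Set (ℝ × ℝ) := fun m =>
    Set.Icc (1 / ((m : ℝ) + 1)) (1 - 1 / ((m : ℝ) + 1)) ×ˢ
      Set.Icc (1 / ((m : ℝ) + 1)) (1 - 1 / ((m : ℝ) + 1))
  have hK : ∀ m, IsCompact (K m) := fun m => isCompact_Icc.prod isCompact_Icc
  have hex : ∀ x ∈ Set.Ioo (0 : ℝ) 1, ∃ M : ℕ, ∀ m ≥ M,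
      x ∈ Set.Icc (1 / ((m : ℝ) + 1)) (1 - 1 / ((m : ℝ) + 1)) := by
    intro x hx
    have ht := tendsto_one_div_add_atTop_nhds_zero_nat (𝕜 := ℝ)
    have h1 := ht.eventually (eventually_lt_nhds (show 0 < min x (1 - x) from
      lt_min hx.1 (by linarith [hx.2])))
    obtain ⟨M, hM⟩ := eventually_atTop.1 h1
    refine ⟨M, fun m hm => ?_⟩
    have := hM m hm
    exact ⟨(this.trans_le (min_le_left _ _)).le, by
      linarith [this.trans_le (min_le_right x (1 - x))]⟩
  have heq : crossing i j = ⋃ m : ℕ, {s | ∃ q ∈ K m,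
      q.1 • s i = blockSum (Finset.Ico i j) s + q.2 • s j} := by
    ext s
    rw [mem_crossing_iff hij, Set.mem_iUnion]
    constructor
    · rintro ⟨q, ⟨h1, h2⟩, h⟩
      obtain ⟨M₁, hM₁⟩ := hex _ h1
      obtain ⟨M₂, hM₂⟩ := hex _ h2
      exact ⟨max M₁ M₂, q, ⟨hM₁ _ (le_max_left _ _), hM₂ _ (le_max_right _ _)⟩, h⟩
    · rintro ⟨m, q, ⟨h1, h2⟩, h⟩
      have hm : 0 < 1 / ((m : ℝ) + 1) := by positivity
      exact ⟨q, ⟨⟨by linarith [h1.1], by linarith [h1.2]⟩,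
        ⟨by linarith [h2.1], by linarith [h2.2]⟩⟩, h⟩
  rw [heq]
  refine MeasurableSet.iUnion fun m => IsClosed.measurableSet ?_
  have : CompactSpace (K m) := isCompact_iff_compactSpace.1 (hK m)
  have hcl : IsClosed {x : K m × (Fin n → ℂ) |
      x.1.1.1 • x.2 i = blockSum (Finset.Ico i j) x.2 + x.1.1.2 • x.2 j} := by
    have := continuous_blockSum (Finset.Ico i j)
    apply isClosed_eq <;> fun_prop
  have himg := isClosedMap_snd_of_compactSpace _ hcl
  convert himg using 1
  ext s
  constructor
  · rintro ⟨q, hq, h⟩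
    exact ⟨(⟨q, hq⟩, s), h, rfl⟩
  · rintro ⟨⟨⟨q, hq⟩, s'⟩, h, rfl⟩
    exact ⟨q, hq, h⟩

lemma norm_blockSum_sub_le {S T : Finset (Fin n)} (hST : S ⊆ T) {s : Fin n → ℂ}
    (hs : ∀ i, ‖s i‖ = 1) : ‖blockSum T s - blockSum S s‖ ≤ ((T \ S).card : ℝ) := by
  unfold blockSum
  rw [← Finset.sum_sdiff hST, add_sub_cancel_right]
  refine (norm_sum_le _ _).trans ?_
  simp [hs]

/-- If two edges of unit length cross, then both the steps strictly between them and the steps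
from the first to the second one add up to a vector of length at most `2`. -/
lemma norm_blockSum_le_of_mem_crossing {i j : Fin n} (hij : i < j) {s : Fin n → ℂ}
    (hs : ∀ i, ‖s i‖ = 1) (h : s ∈ crossing i j) :
    ‖blockSum (Finset.Ioo i j) s‖ ≤ 2 ∧ ‖blockSum (Finset.Icc i j) s‖ ≤ 2 := by
  obtain ⟨⟨θ, τ⟩, ⟨hθ, hτ⟩, h⟩ := (mem_crossing_iff hij.le s).1 h
  simp only at hθ hτ h
  have h1 : blockSum (Finset.Ico i j) s = s i + blockSum (Finset.Ioo i j) s := by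
    unfold blockSum
    rw [← Finset.Ioo_insert_left hij, Finset.sum_insert (by simp)]
  have h2 : blockSum (Finset.Icc i j) s = s j + blockSum (Finset.Ico i j) s := by
    unfold blockSum
    rw [← Finset.Ico_insert_right hij.le, Finset.sum_insert (by simp)]
  have hsm : ∀ (a b : ℝ), |a| ≤ 1 → |b| ≤ 1 → ‖a • s i + b • s j‖ ≤ 2 := by
    intro a b ha hb
    refine (norm_add_le _ _).trans ?_
    rw [norm_smul, norm_smul, hs, hs, mul_one, mul_one, Real.norm_eq_abs, Real.norm_eq_abs]
    linarith
  have h3 : blockSum (Finset.Ioo i j) s = (θ - 1) • s i + (-τ) • s j := by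
    rw [sub_smul, h, h1, one_smul, neg_smul]; abel
  have h4 : blockSum (Finset.Icc i j) s = θ • s i + (1 - τ) • s j := by
    rw [h2, sub_smul, h, one_smul]; abel
  rw [h3, h4]
  constructor <;> apply hsm <;> rw [abs_le] <;> constructor <;> linarith [hθ.1, hθ.2, hτ.1, hτ.2]

/-! ### Crossing probabilities of the walk -/

/-- Bounds for the probability that the walk has one or two prescribed crossings, for two pairs of
edges which are nested or interlaced. -/
lemma exists_measureReal_crossing_le :
    ∃ C : ℝ, 1 ≤ C ∧ ∀ n : ℕ,
      (∀ i j : Fin n, i < j → (walkLaw n).real (crossing i j) ≤ C / ((j : ℝ) - i)) ∧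
      (∀ i j k l : Fin n, i ≤ k → k < l → l ≤ j →
        (walkLaw n).real (crossing i j ∩ crossing k l)
          ≤ C / (((l : ℝ) - k) * ((j : ℝ) - i - (l - k) + 1))) ∧
      (∀ i j k l : Fin n, i ≤ k → k ≤ j → j < l → (i : ℕ) + 2 ≤ j →
        (walkLaw n).real (crossing i j ∩ crossing k l)
          ≤ C / (((j : ℝ) - i) * ((l : ℝ) - j))) := by
  obtain ⟨C₁, hC₁, h1⟩ := exists_measureReal_blockSum_le
  obtain ⟨C₂, hC₂, h2⟩ := exists_measureReal_two_blockSum_le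
  refine ⟨C₁ + 3 * C₂, by linarith, fun n => ⟨?_, ?_, ?_⟩⟩
  · intro i j hij
    have hle : (walkLaw n).real (crossing i j)
        ≤ (walkLaw n).real {s | ‖blockSum (Finset.Ioo i j) s + 0‖ ≤ 6} := by
      refine ENNReal.toReal_mono (measure_ne_top _ _) (measure_mono_ae ?_)
      filter_upwards [ae_norm_walkLaw] with s hs h
      have := (norm_blockSum_le_of_mem_crossing hij hs h).1
      change ‖blockSum (Finset.Ioo i j) s + 0‖ ≤ 6
      rw [add_zero]; linarith
    refine hle.trans ((h1 n _ 0).trans ?_)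
    have hij' : (i : ℕ) < j := hij
    have hpos : (0 : ℝ) < (j : ℝ) - i := by
      have : ((i : ℕ) : ℝ) < (j : ℕ) := by exact_mod_cast hij'
      linarith
    have hc : ((Finset.Ioo i j).card : ℝ) + 1 = (j : ℝ) - i := by
      rw [Fin.card_Ioo, ← Nat.cast_sub hij'.le]
      have : (j : ℕ) - i - 1 + 1 = j - i := by omega
      exact_mod_cast this
    rw [hc]
    gcongr
    linarith
  · intro i j k l hik hkl hlj
    have hik' : (i : ℕ) ≤ k := hik
    have hkl' : (k : ℕ) < l := hkl
    have hlj' : (l : ℕ) ≤ j := hlj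
    have hij : i < j := lt_of_le_of_lt hik (lt_of_lt_of_le hkl hlj)
    -- the inner loop, and the outer loop without the inner one, involve disjoint blocks
    set S := Finset.Ioo k l with hS
    set T := Finset.Ioo i k ∪ Finset.Ioo l j with hT
    have hST : Disjoint S T := by
      rw [Finset.disjoint_left]
      intro x hx hx'
      simp only [hS, hT, Finset.mem_union, Finset.mem_Ioo] at hx hx'
      omega
    have hsub : S ∪ T ⊆ Finset.Ioo i j := by
      intro x hx
      simp only [hS, hT, Finset.mem_union, Finset.mem_Ioo] at hx ⊢
      omega
    have hdiff : (Finset.Ioo i j \ (S ∪ T)).card ≤ 2 := by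
      refine (Finset.card_le_card (t := {k, l}) ?_).trans Finset.card_le_two
      intro x hx
      simp only [hS, hT, Finset.mem_sdiff, Finset.mem_union, Finset.mem_Ioo, Finset.mem_insert,
        Finset.mem_singleton] at hx ⊢
      omega
    have hle : (walkLaw n).real (crossing i j ∩ crossing k l)
        ≤ (walkLaw n).real {s | ‖blockSum S s‖ ≤ 6 ∧ ‖blockSum T s + blockSum ∅ s‖ ≤ 6} := by
      refine ENNReal.toReal_mono (measure_ne_top _ _) (measure_mono_ae ?_)
      filter_upwards [ae_norm_walkLaw] with s hs h
      have ha := (norm_blockSum_le_of_mem_crossing hij hs h.1).1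
      have hb := (norm_blockSum_le_of_mem_crossing hkl hs h.2).1
      have hc := norm_blockSum_sub_le hsub hs
      have hd : ((Finset.Ioo i j \ (S ∪ T)).card : ℝ) ≤ 2 := by exact_mod_cast hdiff
      have he : blockSum (S ∪ T) s = blockSum S s + blockSum T s := Finset.sum_union hST
      change ‖blockSum S s‖ ≤ 6 ∧ ‖blockSum T s + blockSum ∅ s‖ ≤ 6
      refine ⟨by linarith, ?_⟩
      have hf : blockSum T s + blockSum ∅ s = blockSum (Finset.Ioo i j) s - blockSum S s
          - (blockSum (Finset.Ioo i j) s - blockSum (S ∪ T) s) := by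
        rw [he]; simp [blockSum]
      rw [hf]
      refine (norm_sub_le _ _).trans ?_
      have := norm_sub_le (blockSum (Finset.Ioo i j) s) (blockSum S s)
      linarith
    refine hle.trans ((h2 n S T ∅ hST (Finset.disjoint_empty_left _)).trans ?_)
    have hβ : ((S.card : ℕ) : ℝ) + 1 = (l : ℝ) - k := by
      rw [hS, Fin.card_Ioo, ← Nat.cast_sub hkl'.le]
      have : (l : ℕ) - k - 1 + 1 = l - k := by omega
      exact_mod_cast this
    have hTc : (j : ℕ) - i + 1 ≤ 3 * (T.card + 1) + (l - k) := by
      have e1 := Finset.card_sdiff_add_card_eq_card hsub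
      have e2 : S.card = l - k - 1 := Fin.card_Ioo k l
      have e3 : (Finset.Ioo i j).card = j - i - 1 := Fin.card_Ioo i j
      rw [Finset.card_union_of_disjoint hST] at e1
      omega
    have hTc' : (j : ℝ) - i - (l - k) + 1 ≤ 3 * ((T.card : ℝ) + 1) := by
      have h5 : ((j : ℕ) : ℝ) - (i : ℕ) + 1 ≤ 3 * ((T.card : ℝ) + 1) + ((l : ℕ) - (k : ℕ)) := by
        rw [← Nat.cast_sub (show (i : ℕ) ≤ j by omega), ← Nat.cast_sub hkl'.le]
        exact_mod_cast hTc
      linarith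
    have hβ0 : (0 : ℝ) < (l : ℝ) - k := by rw [← hβ]; positivity
    have hγ0 : (0 : ℝ) < (j : ℝ) - i - (l - k) + 1 := by
      have a1 : ((i : ℕ) : ℝ) ≤ (k : ℕ) := by exact_mod_cast hik'
      have a2 : ((l : ℕ) : ℝ) ≤ (j : ℕ) := by exact_mod_cast hlj'
      linarith
    rw [hβ, div_le_div_iff₀ (by positivity) (by positivity)]
    have : C₂ * (((l : ℝ) - k) * ((j : ℝ) - i - (l - k) + 1))
        ≤ C₂ * (((l : ℝ) - k) * (3 * ((T.card : ℝ) + 1))) := by gcongr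
    have h6 : 0 ≤ C₁ * (((l : ℝ) - k) * ((T.card : ℝ) + 1)) := by positivity
    nlinarith
  · intro i j k l hik hkj hjl hij2
    have hik' : (i : ℕ) ≤ k := hik
    have hkj' : (k : ℕ) ≤ j := hkj
    have hjl' : (j : ℕ) < l := hjl
    have hij : i < j := by change (i : ℕ) < j; omega
    have hkl : k < l := lt_of_le_of_lt hkj hjl
    -- the second loop is the block `T` after the first loop, shifted by the common part `U`
    set S := Finset.Ioo i k ∪ Finset.Ioo k j with hS
    set T := Finset.Ioo j l with hT
    set U := Finset.Ioo k j with hU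
    have hST : Disjoint S T := by
      rw [Finset.disjoint_left]
      intro x hx hx'
      simp only [hS, hU, hT, Finset.mem_union, Finset.mem_Ioo] at hx hx'
      omega
    have hUT : Disjoint U T := by
      rw [Finset.disjoint_left]
      intro x hx hx'
      simp only [hU, hT, Finset.mem_Ioo] at hx hx'
      omega
    have hsub : S ⊆ Finset.Ioo i j := by
      intro x hx
      simp only [hS, hU, Finset.mem_union, Finset.mem_Ioo] at hx ⊢
      omega
    have hsub2 : U ∪ T ⊆ Finset.Ioo k l := by
      intro x hx
      simp only [hU, hT, Finset.mem_union, Finset.mem_Ioo] at hx ⊢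
      omega
    have hdiff : (Finset.Ioo i j \ S).card ≤ 1 := by
      refine (Finset.card_le_card (t := {k}) ?_).trans (Finset.card_singleton k).le
      intro x hx
      simp only [hS, hU, Finset.mem_sdiff, Finset.mem_union, Finset.mem_Ioo,
        Finset.mem_singleton] at hx ⊢
      omega
    have hdiff2 : (Finset.Ioo k l \ (U ∪ T)).card ≤ 1 := by
      refine (Finset.card_le_card (t := {j}) ?_).trans (Finset.card_singleton j).le
      intro x hx
      simp only [hU, hT, Finset.mem_sdiff, Finset.mem_union, Finset.mem_Ioo,
        Finset.mem_singleton] at hx ⊢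
      omega
    have hle : (walkLaw n).real (crossing i j ∩ crossing k l)
        ≤ (walkLaw n).real {s | ‖blockSum S s‖ ≤ 6 ∧ ‖blockSum T s + blockSum U s‖ ≤ 6} := by
      refine ENNReal.toReal_mono (measure_ne_top _ _) (measure_mono_ae ?_)
      filter_upwards [ae_norm_walkLaw] with s hs h
      have ha := (norm_blockSum_le_of_mem_crossing hij hs h.1).1
      have hb := (norm_blockSum_le_of_mem_crossing hkl hs h.2).1
      have hc := norm_blockSum_sub_le hsub hs
      have hc2 := norm_blockSum_sub_le hsub2 hs
      have hd : ((Finset.Ioo i j \ S).card : ℝ) ≤ 1 := by exact_mod_cast hdiff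
      have hd2 : ((Finset.Ioo k l \ (U ∪ T)).card : ℝ) ≤ 1 := by exact_mod_cast hdiff2
      have he : blockSum (U ∪ T) s = blockSum U s + blockSum T s := Finset.sum_union hUT
      change ‖blockSum S s‖ ≤ 6 ∧ ‖blockSum T s + blockSum U s‖ ≤ 6
      constructor
      · have hf : blockSum S s = blockSum (Finset.Ioo i j) s
            - (blockSum (Finset.Ioo i j) s - blockSum S s) := by ring
        rw [hf]
        refine (norm_sub_le _ _).trans ?_
        linarith
      · have hf : blockSum T s + blockSum U s = blockSum (Finset.Ioo k l) s
            - (blockSum (Finset.Ioo k l) s - blockSum (U ∪ T) s) := by rw [he]; ring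
        rw [hf]
        refine (norm_sub_le _ _).trans ?_
        linarith
    refine hle.trans ((h2 n S T U hST hUT).trans ?_)
    have hc : ((T.card : ℕ) : ℝ) + 1 = (l : ℝ) - j := by
      rw [hT, Fin.card_Ioo, ← Nat.cast_sub hjl'.le]
      have : (l : ℕ) - j - 1 + 1 = l - j := by omega
      exact_mod_cast this
    have hSc : (j : ℕ) - i ≤ 2 * (S.card + 1) := by
      have e1 := Finset.card_sdiff_add_card_eq_card hsub
      rw [Fin.card_Ioo] at e1
      omega
    have hSc' : (j : ℝ) - i ≤ 2 * ((S.card : ℝ) + 1) := by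
      rw [← Nat.cast_sub (show (i : ℕ) ≤ j by omega)]
      exact_mod_cast hSc
    have hc0 : (0 : ℝ) < (l : ℝ) - j := by rw [← hc]; positivity
    have ha0 : (0 : ℝ) < (j : ℝ) - i := by
      have : ((i : ℕ) : ℝ) < (j : ℕ) := by exact_mod_cast hij
      linarith
    rw [hc, div_le_div_iff₀ (by positivity) (by positivity)]
    have : C₂ * (((j : ℝ) - i) * ((l : ℝ) - j))
        ≤ C₂ * ((2 * ((S.card : ℝ) + 1)) * ((l : ℝ) - j)) := by gcongr
    have h6 : 0 ≤ C₁ * (((S.card : ℝ) + 1) * ((l : ℝ) - j)) := by positivity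
    have h7 : 0 ≤ C₂ * (((S.card : ℝ) + 1) * ((l : ℝ) - j)) := by positivity
    nlinarith

/-! ### Crossing probabilities of the polygon -/

/-- An upper bound, up to a constant factor, for the excess of the probability that the edges
`i < j` and `k < l` of the polygon both cross, where `i ≤ k`, over the product of the two crossing
probabilities of the walk. The first two terms account for the case that fewer than `m` steps lie
outside of the range of the four edges; the others for disjoint, nested and interlaced pairs. -/
noncomputable def pairError (n m i j k l : ℕ) : ℝ :=
  (if i < m ∧ n ≤ j + m then 1 else 0) + (if i < m ∧ n ≤ l + m then 1 else 0)
  + (if i < j ∧ j < k ∧ k < l then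
      1 / ((i : ℝ) + n - l) * (1 / ((j : ℝ) - i) + 1 / ((l : ℝ) - k)) else 0)
  + (if i ≤ k ∧ k < l ∧ l ≤ j then
      n / ((i : ℝ) + n - j) * (1 / (((l : ℝ) - k) * ((j : ℝ) - i - (l - k) + 1))) else 0)
  + (if i ≤ k ∧ k ≤ j ∧ j < l ∧ i < j then
      n / ((i : ℝ) + n - l) * (1 / (((j : ℝ) - i) * ((l : ℝ) - j))) else 0)

lemma pairError_summands_nonneg {m i j k l : ℕ} (hj : j < n) (hl : l < n) :
    ((0 : ℝ) ≤ if i < m ∧ n ≤ j + m then 1 else 0) ∧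
    ((0 : ℝ) ≤ if i < m ∧ n ≤ l + m then 1 else 0) ∧
    ((0 : ℝ) ≤ if i < j ∧ j < k ∧ k < l then
      1 / ((i : ℝ) + n - l) * (1 / ((j : ℝ) - i) + 1 / ((l : ℝ) - k)) else 0) ∧
    ((0 : ℝ) ≤ if i ≤ k ∧ k < l ∧ l ≤ j then
      n / ((i : ℝ) + n - j) * (1 / (((l : ℝ) - k) * ((j : ℝ) - i - (l - k) + 1))) else 0) ∧
    ((0 : ℝ) ≤ if i ≤ k ∧ k ≤ j ∧ j < l ∧ i < j then
      n / ((i : ℝ) + n - l) * (1 / (((j : ℝ) - i) * ((l : ℝ) - j))) else 0) := by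
  have hjn : (j : ℝ) + 1 ≤ n := by exact_mod_cast hj
  have hln : (l : ℝ) + 1 ≤ n := by exact_mod_cast hl
  have hi0 : (0 : ℝ) ≤ i := Nat.cast_nonneg _
  have o1 : (0 : ℝ) < (i : ℝ) + n - l := by linarith
  have o2 : (0 : ℝ) < (i : ℝ) + n - j := by linarith
  refine ⟨?_, ?_, ?_, ?_, ?_⟩
  · split_ifs <;> norm_num
  · split_ifs <;> norm_num
  · split_ifs with h
    · have h1 : (i : ℝ) < j := by exact_mod_cast h.1
      have h2 : (k : ℝ) < l := by exact_mod_cast h.2.2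
      have h3 : (0 : ℝ) < (j : ℝ) - i := by linarith
      have h4 : (0 : ℝ) < (l : ℝ) - k := by linarith
      positivity
    · rfl
  · split_ifs with h
    · have h0 : (i : ℝ) ≤ k := by exact_mod_cast h.1
      have h1 : (k : ℝ) < l := by exact_mod_cast h.2.1
      have h2 : (l : ℝ) ≤ j := by exact_mod_cast h.2.2
      have h3 : (0 : ℝ) < (j : ℝ) - i - (l - k) + 1 := by linarith
      have h4 : (0 : ℝ) < (l : ℝ) - k := by linarith
      positivity
    · rfl
  · split_ifs with h
    · have h1 : (i : ℝ) < j := by exact_mod_cast h.2.2.2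
      have h2 : (j : ℝ) < l := by exact_mod_cast h.2.2.1
      have h3 : (0 : ℝ) < (l : ℝ) - j := by linarith
      have h4 : (0 : ℝ) < (j : ℝ) - i := by linarith
      positivity
    · rfl

lemma card_compl_Icc {i j : Fin n} (hij : i ≤ j) :
    (((Finset.Icc i j)ᶜ).card : ℝ) = (i : ℝ) + n - j - 1 := by
  have h1 : (Finset.Icc i j).card = j + 1 - i := Fin.card_Icc i j
  have h2 := Finset.card_compl_add_card (Finset.Icc i j)
  rw [Fintype.card_fin, h1] at h2
  have hij' : (i : ℕ) ≤ j := hij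
  have h3 : ((Finset.Icc i j)ᶜ).card + (j + 1) = n + i := by omega
  have h4 : (((Finset.Icc i j)ᶜ).card : ℝ) + ((j : ℕ) + 1) = n + (i : ℕ) := by exact_mod_cast h3
  linarith

lemma lt_and_le_of_card_compl_Icc_lt {i j : Fin n} (hij : i ≤ j) {m : ℕ}
    (h : ((Finset.Icc i j)ᶜ).card < m) : (i : ℕ) < m ∧ n ≤ (j : ℕ) + m := by
  have h1 : (Finset.Icc i j).card = j + 1 - i := Fin.card_Icc i j
  have h2 := Finset.card_compl_add_card (Finset.Icc i j)
  rw [Fintype.card_fin, h1] at h2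
  have hij' : (i : ℕ) ≤ j := hij
  have := j.2
  omega

/-- An event that only involves the steps between `i` and `j` becomes more likely by conditioning
on closure by at most a factor of the order of `n` over the number of the other steps. -/
lemma IsPolygonLaw.measureReal_le_of_determinedBy_Icc {P : Measure (Fin n → ℂ)}
    (hP : IsPolygonLaw n P) (hp : 0 < sumDensity n 0) {B : ℝ} (hB : 1 ≤ B)
    (hup : ∀ d, smoothRank ≤ d → d ≤ n →
      densityBound d ≤ sumDensity n 0 * (1 + B * (n - d + 2) / d))
    (hn2 : 2 ≤ n) {i j : Fin n} {E : Set (Fin n → ℂ)} (hij : i ≤ j)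
    (hD : smoothRank ≤ ((Finset.Icc i j)ᶜ).card) (hE : DeterminedBy (Finset.Icc i j) E)
    (hEm : MeasurableSet E) :
    P.real E ≤ 8 * B * (n / ((i : ℝ) + n - j)) * (walkLaw n).real E := by
  have hB0 : 0 < B := by linarith
  set d := ((Finset.Icc i j)ᶜ).card with hd
  have hd1 : (1 : ℝ) ≤ d := by exact_mod_cast one_le_smoothRank.trans hD
  have hdn : d ≤ n := by simpa using Finset.card_le_univ (Finset.Icc i j)ᶜ
  have hdn' : (d : ℝ) ≤ n := by exact_mod_cast hdn
  have h1 := hP.measureReal_le hp hD (by rwa [compl_compl]) hEm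
  refine h1.trans ?_
  gcongr
  rw [div_le_iff₀ hp, mul_comm]
  refine (hup d hD hdn).trans ?_
  gcongr
  have hc := card_compl_Icc hij
  rw [← hd] at hc
  rw [show (i : ℝ) + n - j = d + 1 by linarith, mul_div_assoc', ← sub_nonneg]
  have : 8 * B * n / (d + 1) - (1 + B * (n - d + 2) / d)
      = (8 * B * n * d - (d + B * (n - d + 2)) * (d + 1)) / (d * (d + 1)) := by field_simp
  rw [this]
  apply div_nonneg _ (by positivity)
  have hn3 : (2 : ℝ) ≤ n := by
    exact_mod_cast hn2
  have e1 : (d + B * (n - d + 2)) * (d + 1) ≤ (d + B * (n - d + 2)) * (2 * d) := by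
    apply mul_le_mul_of_nonneg_left (by linarith)
    have : 0 ≤ B * (n - d + 2) := mul_nonneg hB0.le (by linarith)
    linarith
  have e2 : d + B * (n - d + 2) ≤ B * (4 * n) := by nlinarith
  nlinarith

/-- A crossing of two edges of the polygon is at most by a term of order `1 / n` less likely than
for the walk. -/
lemma IsPolygonLaw.sub_le_measureReal_crossing {P : Measure (Fin n → ℂ)}
    (hP : IsPolygonLaw n P) (hp : 0 < sumDensity n 0) {A B : ℝ} (hB : 1 ≤ B)
    (hlow : ∀ d, smoothRank ≤ d → d ≤ n → n ≤ 2 * d → ∀ y : ℂ, ‖y‖ ≤ 2 →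
      sumDensity n 0 * (1 - B * (n - d + 2) / n) ≤ sumDensity d y)
    (hW1 : ∀ i j : Fin n, i < j → (walkLaw n).real (crossing i j) ≤ A / ((j : ℝ) - i))
    (hn2 : 2 * smoothRank + 3 ≤ n) {i j : Fin n} (hij2 : (i : ℕ) + 2 ≤ j) :
    (walkLaw n).real (crossing i j) - 3 * A * B / n ≤ P.real (crossing i j) := by
  have := hP.1
  have hB0 : 0 < B := by linarith
  have hn0 : (0 : ℝ) < n := by
    have : 0 < n := by omega
    exact_mod_cast this
  have hij : i < j := by change (i : ℕ) < j; omega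
  have hα : (2 : ℝ) ≤ (j : ℝ) - i := by
    have : ((i : ℕ) : ℝ) + 2 ≤ (j : ℕ) := by exact_mod_cast hij2
    linarith
  have hWij := hW1 i j hij
  rw [le_div_iff₀ (by linarith)] at hWij
  set w := (walkLaw n).real (crossing i j) with hw
  have hw0 : 0 ≤ w := measureReal_nonneg
  set d := ((Finset.Icc i j)ᶜ).card with hd
  have hc := card_compl_Icc hij.le
  rw [← hd] at hc
  have hdn : d ≤ n := by simpa using Finset.card_le_univ (Finset.Icc i j)ᶜ
  -- the relative error is at most a multiple of `(j - i) / n`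
  have hsuff : (1 - 3 * B * ((j : ℝ) - i) / n) * w ≤ P.real (crossing i j) := by
    -- if fewer than `n / 2` steps are outside of `[i, j]`, the left hand side is not positive
    rcases le_or_gt n (2 * d) with h2d | h2d
    · have hD : smoothRank ≤ d := by omega
      have hkey := hP.le_measureReal (E := crossing i j) (D := (Finset.Icc i j)ᶜ) hp hD
        (by rw [compl_compl]; exact determinedBy_crossing hij.le)
        (measurableSet_crossing hij.le) (a := 1 - B * (n - d + 2) / n) (by
          filter_upwards [ae_norm_walkLaw] with s hs hsE
          apply hlow d hD hdn h2d
          rw [norm_neg, compl_compl]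
          exact (norm_blockSum_le_of_mem_crossing hij hs hsE).2)
      refine le_trans ?_ hkey
      apply mul_le_mul_of_nonneg_right _ hw0
      apply sub_le_sub_left
      apply div_le_div_of_nonneg_right _ hn0.le
      rw [show (n : ℝ) - d + 2 = (j : ℝ) - i + 3 by linarith]
      nlinarith
    · refine le_trans ?_ (measureReal_nonneg (μ := P))
      apply mul_nonpos_of_nonpos_of_nonneg _ hw0
      have h2d' : 2 * (d : ℝ) < n := by exact_mod_cast h2d
      rw [sub_nonpos, le_div_iff₀ hn0]
      nlinarith
  have h3 : (1 - 3 * B * ((j : ℝ) - i) / n) * w = w - 3 * B * (w * ((j : ℝ) - i)) / n := by ring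
  rw [h3] at hsuff
  have h4 : 3 * B * (w * ((j : ℝ) - i)) / n ≤ 3 * A * B / n := by
    apply div_le_div_of_nonneg_right _ hn0.le
    calc 3 * B * (w * ((j : ℝ) - i)) ≤ 3 * B * A := by gcongr
      _ = 3 * A * B := by ring
  linarith

/-- Two crossings at disjoint places are nearly independent. -/
lemma IsPolygonLaw.measureReal_inter_crossing_le_of_disjoint {P : Measure (Fin n → ℂ)}
    (hP : IsPolygonLaw n P) (hp : 0 < sumDensity n 0) {A B : ℝ} (hA : 0 < A) (hB : 1 ≤ B)
    (hup : ∀ d, smoothRank ≤ d → d ≤ n →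
      densityBound d ≤ sumDensity n 0 * (1 + B * (n - d + 2) / d))
    (hW1 : ∀ i j : Fin n, i < j → (walkLaw n).real (crossing i j) ≤ A / ((j : ℝ) - i))
    {i j k l : Fin n} (hij2 : (i : ℕ) + 2 ≤ j) (hjk : j < k) (hkl2 : (k : ℕ) + 2 ≤ l)
    (hD : smoothRank ≤ ((Finset.Icc i l)ᶜ).card) :
    P.real (crossing i j ∩ crossing k l)
      ≤ (walkLaw n).real (crossing i j) * (walkLaw n).real (crossing k l)
        + 4 * A ^ 2 * B * (1 / ((i : ℝ) + n - l) * (1 / ((j : ℝ) - i) + 1 / ((l : ℝ) - k))) := by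
  have hB0 : 0 < B := by linarith
  have hij : i < j := by change (i : ℕ) < j; omega
  have hkl : k < l := by change (k : ℕ) < l; omega
  have hik : i ≤ k := (hij.trans hjk).le
  have hil : i ≤ l := hik.trans hkl.le
  have hjl' : j < l := hjk.trans hkl
  have hα : (2 : ℝ) ≤ (j : ℝ) - i := by
    have : ((i : ℕ) : ℝ) + 2 ≤ (j : ℕ) := by exact_mod_cast hij2
    linarith
  have hβ : (2 : ℝ) ≤ (l : ℝ) - k := by
    have : ((k : ℕ) : ℝ) + 2 ≤ (l : ℕ) := by exact_mod_cast hkl2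
    linarith
  have hmE : MeasurableSet (crossing i j ∩ crossing k l) :=
    (measurableSet_crossing hij.le).inter (measurableSet_crossing hkl.le)
  have hdet := (determinedBy_crossing hij.le).inter (determinedBy_crossing hkl.le)
  have hdisj : Disjoint (Finset.Icc i j) (Finset.Icc k l) := by
    rw [Finset.disjoint_left]
    intro x hx hx'
    simp only [Finset.mem_Icc] at hx hx'
    omega
  have hind := measureReal_inter_of_determinedBy (determinedBy_crossing hij.le)
    (determinedBy_crossing hkl.le) (measurableSet_crossing hij.le)
    (measurableSet_crossing hkl.le) hdisj
  set D := (Finset.Icc i j ∪ Finset.Icc k l)ᶜ with hDdef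
  have hsub : (Finset.Icc i l)ᶜ ⊆ D := by
    rw [hDdef, Finset.compl_subset_compl]
    exact Finset.union_subset (Finset.Icc_subset_Icc le_rfl hjl'.le)
      (Finset.Icc_subset_Icc hik le_rfl)
  have hle := Finset.card_le_card hsub
  have hDs : smoothRank ≤ D.card := hD.trans hle
  have hDn : D.card ≤ n := by simpa using Finset.card_le_univ D
  have h1 := hP.measureReal_le hp hDs (by rw [hDdef, compl_compl]; exact hdet) hmE
  rw [hind] at h1
  have hcard : (D.card : ℝ) = n - (((j : ℝ) - i + 1) + ((l : ℝ) - k + 1)) := by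
    have e1 := Finset.card_compl_add_card (Finset.Icc i j ∪ Finset.Icc k l)
    have e2 : (Finset.Icc i j).card = j + 1 - i := Fin.card_Icc i j
    have e3 : (Finset.Icc k l).card = l + 1 - k := Fin.card_Icc k l
    rw [Finset.card_union_of_disjoint hdisj, Fintype.card_fin, e2, e3, ← hDdef] at e1
    have e4 : D.card + (j + 1) + (l + 1) = n + i + k := by omega
    have e5 : (D.card : ℝ) + ((j : ℕ) + 1) + ((l : ℕ) + 1) = n + (i : ℕ) + (k : ℕ) := by
      exact_mod_cast e4
    linarith
  have hodd : (i : ℝ) + n - l - 1 ≤ D.card := by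
    rw [← card_compl_Icc hil]; exact_mod_cast hle
  have ho1 : (1 : ℝ) ≤ (i : ℝ) + n - l - 1 := by
    rw [← card_compl_Icc hil]; exact_mod_cast one_le_smoothRank.trans hD
  set α := (j : ℝ) - i with hαd
  set β := (l : ℝ) - k with hβd
  set o := (i : ℝ) + n - l with hod
  have ho0 : 0 < o := by linarith
  set wp := (walkLaw n).real (crossing i j) with hwpd
  set wq := (walkLaw n).real (crossing k l) with hwqd
  have hwp0 : 0 ≤ wp := measureReal_nonneg
  have hwq0 : 0 ≤ wq := measureReal_nonneg
  have h2 : densityBound D.card / sumDensity n 0 ≤ 1 + 4 * B * (α + β) / o := by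
    rw [div_le_iff₀ hp, mul_comm]
    refine (hup _ hDs hDn).trans ?_
    refine mul_le_mul_of_nonneg_left (add_le_add le_rfl ?_) hp.le
    rw [hcard, div_le_div_iff₀ (by linarith) (by linarith)]
    have e1 : B * (n - (n - (α + 1 + (β + 1))) + 2) ≤ B * (2 * (α + β)) := by
      gcongr; linarith
    have e2 : o ≤ 2 * D.card := by linarith
    have e3 : B * (n - (n - (α + 1 + (β + 1))) + 2) * o
        ≤ B * (2 * (α + β)) * (2 * D.card) := by
      apply mul_le_mul e1 e2 (by linarith) (by positivity)
    rw [hcard] at e3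
    linarith
  have h3 := hW1 i j hij
  have h4 := hW1 k l hkl
  have h5 : wp * wq ≤ A / α * (A / β) := by gcongr
  have h6 : P.real (crossing i j ∩ crossing k l)
      ≤ wp * wq + 4 * B * (α + β) / o * (A / α * (A / β)) := by
    have e1 : densityBound D.card / sumDensity n 0 * (wp * wq)
        ≤ (1 + 4 * B * (α + β) / o) * (wp * wq) := by gcongr
    have e2 : 4 * B * (α + β) / o * (wp * wq) ≤ 4 * B * (α + β) / o * (A / α * (A / β)) := by
      gcongr
    linarith
  have h7 : 4 * B * (α + β) / o * (A / α * (A / β))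
      = 4 * A ^ 2 * B * (1 / o * (1 / α + 1 / β)) := by
    field_simp; ring
  rw [h7] at h6
  exact h6

/-- The comparison of the crossings of the polygon with those of the walk. For two pairs of edges,
the steps left out of consideration are those outside of the range of all four edges if the pairs
are nested or interlaced, and those outside of the two ranges `[i, j]`, `[k, l]` if these are
disjoint. -/
lemma exists_crossing_bounds :
    ∃ C : ℝ, 1 ≤ C ∧ ∃ N : ℕ, ∀ n : ℕ, N ≤ n → smoothRank ≤ n ∧ 0 < sumDensity n 0 ∧
      ∀ P : Measure (Fin n → ℂ), IsPolygonLaw n P →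
        (∀ i j : Fin n, i < j → (walkLaw n).real (crossing i j) ≤ C / ((j : ℝ) - i)) ∧
        (∀ i j : Fin n, (i : ℕ) + 2 ≤ j →
          (walkLaw n).real (crossing i j) - C / n ≤ P.real (crossing i j)) ∧
        (∀ i j k l : Fin n, (i : ℕ) + 2 ≤ j → (k : ℕ) + 2 ≤ l → i ≤ k →
          P.real (crossing i j ∩ crossing k l)
            ≤ (walkLaw n).real (crossing i j) * (walkLaw n).real (crossing k l)
              + C * pairError n smoothRank i j k l) := by
  obtain ⟨A, hA, hW⟩ := exists_measureReal_crossing_le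
  obtain ⟨B, hB, N, hN, hcmp⟩ := exists_sumDensity_compare
  refine ⟨16 * A ^ 2 * B, by nlinarith [mul_le_mul hA hA zero_le_one (by linarith)],
    max N (2 * smoothRank + 3), fun n hn => ?_⟩
  have hNn : N ≤ n := (le_max_left _ _).trans hn
  have hn2 : 2 * smoothRank + 3 ≤ n := (le_max_right _ _).trans hn
  obtain ⟨hp, hup, hlow⟩ := hcmp n hNn
  refine ⟨hN.trans hNn, hp, fun P hP => ?_⟩
  have hPp := hP.1
  obtain ⟨hW1, hW2, hW3⟩ := hW n
  have hA0 : 0 < A := by linarith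
  have hB0 : 0 < B := by linarith
  have hAA : A ≤ A ^ 2 := by nlinarith
  have hn2' : 2 ≤ n := by omega
  have hC1 : 1 ≤ 16 * A ^ 2 * B := by nlinarith
  have hC0 : 0 ≤ 16 * A ^ 2 * B := by linarith
  have hC3 : 3 * A * B ≤ 16 * A ^ 2 * B := by nlinarith
  have hC8 : 8 * A * B ≤ 16 * A ^ 2 * B := by nlinarith
  refine ⟨?_, ?_, ?_⟩
  · intro i j hij
    refine (hW1 i j hij).trans ?_
    have : (0 : ℝ) < (j : ℝ) - i := by
      have : ((i : ℕ) : ℝ) < (j : ℕ) := by exact_mod_cast hij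
      linarith
    apply div_le_div_of_nonneg_right _ this.le
    nlinarith
  · intro i j hij2
    have h1 := hP.sub_le_measureReal_crossing hp hB hlow hW1 hn2 hij2
    have h2 := div_le_div_of_nonneg_right hC3 (Nat.cast_nonneg (α := ℝ) n)
    linarith
  · intro i j k l hij2 hkl2 hik
    have hij : i < j := by change (i : ℕ) < j; omega
    have hkl : k < l := by change (k : ℕ) < l; omega
    have hmE : MeasurableSet (crossing i j ∩ crossing k l) :=
      (measurableSet_crossing hij.le).inter (measurableSet_crossing hkl.le)
    have hdet := (determinedBy_crossing hij.le).inter (determinedBy_crossing hkl.le)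
    obtain ⟨t1, t2, t3, t4, t5⟩ := pairError_summands_nonneg (n := n) (m := smoothRank)
      (i := i) (k := k) j.2 l.2
    have hwp : 0 ≤ (walkLaw n).real (crossing i j) * (walkLaw n).real (crossing k l) := by
      positivity
    -- it suffices to bound the excess by one of the summands of `pairError`
    have hone : ∀ t : ℝ, P.real (crossing i j ∩ crossing k l)
        ≤ (walkLaw n).real (crossing i j) * (walkLaw n).real (crossing k l)
          + 16 * A ^ 2 * B * t → t ≤ pairError n smoothRank i j k l →
        P.real (crossing i j ∩ crossing k l)
        ≤ (walkLaw n).real (crossing i j) * (walkLaw n).real (crossing k l)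
          + 16 * A ^ 2 * B * pairError n smoothRank i j k l := fun t h1 h2 =>
      h1.trans (add_le_add le_rfl (mul_le_mul_of_nonneg_left h2 hC0))
    have htriv : P.real (crossing i j ∩ crossing k l)
        ≤ (walkLaw n).real (crossing i j) * (walkLaw n).real (crossing k l)
          + 16 * A ^ 2 * B * 1 := by
      have h1 : P.real (crossing i j ∩ crossing k l) ≤ 1 := measureReal_le_one
      linarith
    have hbig : ∀ X Y w : ℝ, 0 ≤ Y → 0 ≤ X → P.real (crossing i j ∩ crossing k l)
        ≤ 8 * B * Y * w → w ≤ A * X → P.real (crossing i j ∩ crossing k l)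
        ≤ (walkLaw n).real (crossing i j) * (walkLaw n).real (crossing k l)
          + 16 * A ^ 2 * B * (Y * X) := by
      intro X Y w hY hX h1 h2
      have h3 : 8 * B * Y * w ≤ 8 * B * Y * (A * X) :=
        mul_le_mul_of_nonneg_left h2 (by positivity)
      have h4 : 8 * A * B * (Y * X) ≤ 16 * A ^ 2 * B * (Y * X) :=
        mul_le_mul_of_nonneg_right hC8 (mul_nonneg hY hX)
      linarith
    have hoff : ∀ x : Fin n, (0 : ℝ) < (i : ℝ) + n - x := by
      intro x
      have h1 : ((x : ℕ) : ℝ) + 1 ≤ n := by exact_mod_cast x.2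
      have h2 : (0 : ℝ) ≤ ((i : ℕ) : ℝ) := Nat.cast_nonneg _
      linarith
    unfold pairError at hone ⊢
    rcases lt_or_ge (l : ℕ) (j + 1) with hlj | hjl
    · -- nested pairs
      have hlj' : l ≤ j := by change (l : ℕ) ≤ j; omega
      rcases lt_or_ge ((Finset.Icc i j)ᶜ).card smoothRank with hD | hD
      · refine hone _ htriv ?_
        rw [if_pos (lt_and_le_of_card_compl_Icc_lt hij.le hD)]
        linarith
      · have hsub : Finset.Icc i j ∪ Finset.Icc k l ⊆ Finset.Icc i j :=
          Finset.union_subset subset_rfl (Finset.Icc_subset_Icc hik hlj')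
        have h1 := hP.measureReal_le_of_determinedBy_Icc hp hB hup hn2' hij.le hD
          (hdet.mono hsub) hmE
        have h2 := hW2 i j k l hik hkl hlj'
        have h3 : (i : ℕ) ≤ k ∧ (k : ℕ) < l ∧ (l : ℕ) ≤ j := ⟨hik, hkl, hlj'⟩
        rw [← mul_one_div] at h2
        rw [if_pos h3] at t4
        refine hone _ (hbig _ _ _ (div_nonneg (Nat.cast_nonneg n) (hoff j).le) ?_ h1 h2) ?_
        · have e1 : ((i : ℕ) : ℝ) ≤ (k : ℕ) := by exact_mod_cast h3.1
          have e2 : ((k : ℕ) : ℝ) < (l : ℕ) := by exact_mod_cast h3.2.1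
          have e3 : ((l : ℕ) : ℝ) ≤ (j : ℕ) := by exact_mod_cast h3.2.2
          exact div_nonneg zero_le_one (mul_nonneg (by linarith) (by linarith))
        · rw [if_pos h3]
          linarith
    · have hjl' : j < l := by change (j : ℕ) < l; omega
      have hil : i ≤ l := hij.le.trans hjl'.le
      rcases lt_or_ge ((Finset.Icc i l)ᶜ).card smoothRank with hD | hD
      · refine hone _ htriv ?_
        rw [if_pos (lt_and_le_of_card_compl_Icc_lt hil hD)]
        linarith
      rcases lt_or_ge j k with hjk | hkj
      · -- disjoint pairs
        have h8 : (i : ℕ) < j ∧ (j : ℕ) < k ∧ (k : ℕ) < l := ⟨hij, hjk, hkl⟩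
        rw [if_pos h8] at t3
        have h1 := hP.measureReal_inter_crossing_le_of_disjoint hp hA0 hB hup hW1 hij2 hjk hkl2 hD
        refine hone _ (h1.trans (add_le_add le_rfl (mul_le_mul_of_nonneg_right ?_ t3))) ?_
        · nlinarith
        · rw [if_pos h8]
          linarith
      · -- interlaced pairs
        have hsub : Finset.Icc i j ∪ Finset.Icc k l ⊆ Finset.Icc i l :=
          Finset.union_subset (Finset.Icc_subset_Icc le_rfl hjl'.le)
            (Finset.Icc_subset_Icc hik le_rfl)
        have h1 := hP.measureReal_le_of_determinedBy_Icc hp hB hup hn2' hil hD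
          (hdet.mono hsub) hmE
        have h2 := hW3 i j k l hik hkj hjl' hij2
        have h3 : (i : ℕ) ≤ k ∧ (k : ℕ) ≤ j ∧ (j : ℕ) < l ∧ (i : ℕ) < j := ⟨hik, hkj, hjl', hij⟩
        rw [← mul_one_div] at h2
        refine hone _ (hbig _ _ _ (div_nonneg (Nat.cast_nonneg n) (hoff l).le) ?_ h1 h2) ?_
        · have e1 : ((i : ℕ) : ℝ) < (j : ℕ) := by exact_mod_cast h3.2.2.2
          have e2 : ((j : ℕ) : ℝ) < (l : ℕ) := by exact_mod_cast h3.2.2.1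
          exact div_nonneg zero_le_one (mul_nonneg (by linarith) (by linarith))
        · rw [if_pos h3]
          linarith

/-! ### Summation over pairs of crossings -/

/-- Reciprocals of distinct integers between `1` and `n` add up to at most `1 + log n`. -/
lemma sum_ite_one_div_le (p : Fin n → Prop) [DecidablePred p] (f : Fin n → ℕ) (g : Fin n → ℝ)
    (hg : ∀ x, p x → g x = f x) (hf : ∀ x, p x → 1 ≤ f x ∧ f x ≤ n)
    (hinj : ∀ x y, p x → p y → f x = f y → x = y) :
    ∑ x, (if p x then 1 / g x else 0) ≤ 1 + Real.log n := by
  have hH : ∑ k ∈ Finset.Icc 1 n, 1 / (k : ℝ) ≤ 1 + Real.log n := by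
    refine le_trans (le_of_eq ?_) (harmonic_le_one_add_log n)
    rw [harmonic_eq_sum_Icc]
    push_cast
    simp [one_div]
  refine le_trans ?_ hH
  rw [← Finset.sum_filter]
  calc ∑ x ∈ Finset.univ.filter p, 1 / g x
      = ∑ x ∈ Finset.univ.filter p, 1 / (f x : ℝ) :=
        Finset.sum_congr rfl fun x hx => by rw [hg x (Finset.mem_filter.1 hx).2]
    _ = ∑ k ∈ (Finset.univ.filter p).image f, 1 / (k : ℝ) := by
        rw [Finset.sum_image]
        intro x hx y hy h
        exact hinj x y (Finset.mem_filter.1 hx).2 (Finset.mem_filter.1 hy).2 h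
    _ ≤ _ := by
        apply Finset.sum_le_sum_of_subset_of_nonneg
        · intro k hk
          obtain ⟨x, hx, rfl⟩ := Finset.mem_image.1 hk
          exact Finset.mem_Icc.2 (hf x (Finset.mem_filter.1 hx).2)
        · intro k _ _
          positivity

lemma sum_one_div_sub_left_le (i : Fin n) :
    ∑ j : Fin n, (if (i : ℕ) < j then 1 / ((j : ℝ) - i) else 0) ≤ 1 + Real.log n :=
  sum_ite_one_div_le (fun j : Fin n => (i : ℕ) < j) (fun j => (j : ℕ) - i) _
    (fun j hj => by rw [Nat.cast_sub hj.le]) (fun j hj => by have := j.2; omega)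
    (fun j j' hj hj' h => by ext; omega)

lemma sum_one_div_sub_right_le (j : Fin n) :
    ∑ i : Fin n, (if (i : ℕ) < j then 1 / ((j : ℝ) - i) else 0) ≤ 1 + Real.log n :=
  sum_ite_one_div_le (fun i : Fin n => (i : ℕ) < j) (fun i => (j : ℕ) - i) _
    (fun i hi => by rw [Nat.cast_sub hi.le]) (fun i hi => by have := j.2; omega)
    (fun i i' hi hi' h => by ext; omega)

lemma sum_ite_between (i j : Fin n) (hij : (i : ℕ) ≤ j) (c : ℝ) :
    ∑ k : Fin n, (if (i : ℕ) ≤ k ∧ (k : ℕ) ≤ j then c else 0) = ((j : ℝ) - i + 1) * c := by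
  rw [← Finset.sum_filter, Finset.sum_const]
  have h1 : (Finset.univ.filter fun k : Fin n => (i : ℕ) ≤ k ∧ (k : ℕ) ≤ j)
      = Finset.Icc i j := by
    ext k
    simp only [Finset.mem_filter, Finset.mem_univ, true_and, Finset.mem_Icc, Fin.le_def]
  have h2 : (((Finset.Icc i j).card : ℕ) : ℝ) + (i : ℕ) = (j : ℕ) + 1 := by
    rw [Fin.card_Icc]
    have : (j : ℕ) + 1 - i + i = j + 1 := by omega
    exact_mod_cast this
  rw [h1, nsmul_eq_mul]
  congr 1
  linarith

/-- The number `i + n - e` of steps outside of the range `i ≤ k < e` has a reciprocal which is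
summable with total of order `n` only: for each value `o` there are at most `o` choices of `(i, e)`. -/
lemma sum_one_div_outside_le :
    ∑ i : Fin n, ∑ e : Fin n, 1 / ((i : ℝ) + n - e) ≤ 2 * n := by
  have hcount : ∀ i : Fin n,
      ∑ t : Fin n, (if (t : ℕ) ≤ i then 1 / ((i : ℝ) + 1) else 0) ≤ 1 := by
    intro i
    rw [← Finset.sum_filter, Finset.sum_const]
    have h1 : (Finset.univ.filter fun t : Fin n => (t : ℕ) ≤ i) = Finset.Iic i := by
      ext t
      simp only [Finset.mem_filter, Finset.mem_univ, true_and, Finset.mem_Iic, Fin.le_def]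
    rw [h1, nsmul_eq_mul, Fin.card_Iic]
    push_cast
    rw [mul_one_div, div_self]
    positivity
  calc ∑ i : Fin n, ∑ e : Fin n, 1 / ((i : ℝ) + n - e)
      = ∑ i : Fin n, ∑ t : Fin n, 1 / ((i : ℝ) + t + 1) := by
        refine Finset.sum_congr rfl fun i _ => ?_
        rw [← Equiv.sum_comp Fin.revPerm]
        refine Finset.sum_congr rfl fun t _ => ?_
        have h : (((Fin.revPerm t : Fin n) : ℕ) : ℝ) + (t + 1) = n := by
          have : ((Fin.revPerm t : Fin n) : ℕ) + (t + 1) = n := by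
            rw [Fin.revPerm_apply, Fin.val_rev]
            have := t.2
            omega
          exact_mod_cast this
        congr 1
        linarith
    _ ≤ ∑ i : Fin n, ∑ t : Fin n, ((if (t : ℕ) ≤ i then 1 / ((i : ℝ) + 1) else 0)
          + (if (i : ℕ) ≤ t then 1 / ((t : ℝ) + 1) else 0)) := by
        refine Finset.sum_le_sum fun i _ => Finset.sum_le_sum fun t _ => ?_
        have hi : (0 : ℝ) ≤ ((i : ℕ) : ℝ) := Nat.cast_nonneg _
        have ht : (0 : ℝ) ≤ ((t : ℕ) : ℝ) := Nat.cast_nonneg _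
        have e1 : 1 / (((i : ℕ) : ℝ) + (t : ℕ) + 1) ≤ 1 / (((i : ℕ) : ℝ) + 1) :=
          one_div_le_one_div_of_le (by positivity) (by linarith)
        have e2 : 1 / (((i : ℕ) : ℝ) + (t : ℕ) + 1) ≤ 1 / (((t : ℕ) : ℝ) + 1) :=
          one_div_le_one_div_of_le (by positivity) (by linarith)
        have p1 : 0 ≤ 1 / (((i : ℕ) : ℝ) + 1) := by positivity
        have p2 : 0 ≤ 1 / (((t : ℕ) : ℝ) + 1) := by positivity
        rcases le_total (t : ℕ) i with h | h
        · rw [if_pos h]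
          split_ifs <;> linarith
        · rw [if_pos h]
          split_ifs <;> linarith
    _ = ∑ i : Fin n, ∑ t : Fin n, (if (t : ℕ) ≤ i then 1 / ((i : ℝ) + 1) else 0)
          + ∑ t : Fin n, ∑ i : Fin n, (if (i : ℕ) ≤ t then 1 / ((t : ℝ) + 1) else 0) := by
        simp only [Finset.sum_add_distrib]
        congr 1
        exact Finset.sum_comm
    _ ≤ ∑ _i : Fin n, (1 : ℝ) + ∑ _i : Fin n, (1 : ℝ) :=
        add_le_add (Finset.sum_le_sum fun i _ => hcount i) (Finset.sum_le_sum fun i _ => hcount i)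
    _ = 2 * n := by
        simp; ring

lemma sum_ends_le (m : ℕ) :
    ∑ i : Fin n, ∑ j : Fin n, (if (i : ℕ) < m ∧ n ≤ (j : ℕ) + m then (1 : ℝ) else 0)
      ≤ (m : ℝ) ^ 2 := by
  have h1 : (Finset.univ.filter fun i : Fin n => (i : ℕ) < m).card ≤ m := by
    have := Finset.card_le_card_of_injOn (t := Finset.range m)
      (s := Finset.univ.filter fun i : Fin n => (i : ℕ) < m) (fun i => (i : ℕ))
      (fun i hi => by simpa using hi) (Fin.val_injective.injOn)
    simpa using this
  have h2 : (Finset.univ.filter fun j : Fin n => n ≤ (j : ℕ) + m).card ≤ m := by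
    have := Finset.card_le_card_of_injOn (t := Finset.range m)
      (s := Finset.univ.filter fun j : Fin n => n ≤ (j : ℕ) + m) (fun j => n - 1 - (j : ℕ))
      (fun j hj => by
        have := j.2
        simp only [Finset.coe_filter, Finset.mem_univ, true_and, Set.mem_ofPred_eq,
          Finset.coe_range, Set.mem_Iio] at hj ⊢
        omega)
      (fun j _ j' _ h => by
        have := j.2
        have := j'.2
        ext
        simp only at h
        omega)
    simpa using this
  have h3 : ∀ i j : Fin n, (if (i : ℕ) < m ∧ n ≤ (j : ℕ) + m then (1 : ℝ) else 0)
      = (if (i : ℕ) < m then 1 else 0) * (if n ≤ (j : ℕ) + m then 1 else 0) := by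
    intro i j
    split_ifs <;> simp_all
  simp_rw [h3, ← Finset.mul_sum, ← Finset.sum_mul, Finset.sum_boole]
  rw [sq]
  have h1' : (((Finset.univ.filter fun i : Fin n => (i : ℕ) < m).card : ℕ) : ℝ) ≤ m := by
    exact_mod_cast h1
  have h2' : (((Finset.univ.filter fun j : Fin n => n ≤ (j : ℕ) + m).card : ℕ) : ℝ) ≤ m := by
    exact_mod_cast h2
  exact mul_le_mul h1' h2' (Nat.cast_nonneg _) (Nat.cast_nonneg _)

lemma sum_last_comm (f : Fin n → Fin n → Fin n → ℝ) :
    ∑ j, ∑ k, ∑ l, f j k l = ∑ l, ∑ j, ∑ k, f j k l :=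
  (Finset.sum_congr rfl fun _ _ => Finset.sum_comm).trans Finset.sum_comm

lemma outside_pos (i e : Fin n) : (0 : ℝ) < (i : ℝ) + n - e := by
  have h1 : ((e : ℕ) : ℝ) + 1 ≤ n := by exact_mod_cast e.2
  have h2 : (0 : ℝ) ≤ ((i : ℕ) : ℝ) := Nat.cast_nonneg _
  linarith

lemma sum_disjoint_le :
    ∑ i : Fin n, ∑ j : Fin n, ∑ k : Fin n, ∑ l : Fin n,
      (if (i : ℕ) < j ∧ (j : ℕ) < k ∧ (k : ℕ) < l then
        1 / ((i : ℝ) + n - l) * (1 / ((j : ℝ) - i) + 1 / ((l : ℝ) - k)) else 0)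
      ≤ 4 * n ^ 2 * (1 + Real.log n) := by
  have hH : 0 ≤ 1 + Real.log n := by
    have := Real.log_natCast_nonneg n
    linarith
  have hterm : ∀ i j k l : Fin n, (if (i : ℕ) < j ∧ (j : ℕ) < k ∧ (k : ℕ) < l then
        1 / ((i : ℝ) + n - l) * (1 / ((j : ℝ) - i) + 1 / ((l : ℝ) - k)) else 0)
      ≤ 1 / ((i : ℝ) + n - l) * ((if (i : ℕ) < j then 1 / ((j : ℝ) - i) else 0)
        + (if (k : ℕ) < l then 1 / ((l : ℝ) - k) else 0)) := by
    intro i j k l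
    have ho := outside_pos i l
    have p1 : (0 : ℝ) ≤ if (i : ℕ) < j then 1 / ((j : ℝ) - i) else 0 := by
      split_ifs with h
      · have e1 : ((i : ℕ) : ℝ) < (j : ℕ) := by exact_mod_cast h
        have := sub_pos.2 e1
        positivity
      · rfl
    have p2 : (0 : ℝ) ≤ if (k : ℕ) < l then 1 / ((l : ℝ) - k) else 0 := by
      split_ifs with h
      · have e1 : ((k : ℕ) : ℝ) < (l : ℕ) := by exact_mod_cast h
        have := sub_pos.2 e1
        positivity
      · rfl
    by_cases h : (i : ℕ) < j ∧ (j : ℕ) < k ∧ (k : ℕ) < l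
    · rw [if_pos h, if_pos h.1, if_pos h.2.2]
    · rw [if_neg h]
      positivity
  calc _ ≤ ∑ i : Fin n, ∑ j : Fin n, ∑ k : Fin n, ∑ l : Fin n,
        1 / ((i : ℝ) + n - l) * ((if (i : ℕ) < j then 1 / ((j : ℝ) - i) else 0)
        + (if (k : ℕ) < l then 1 / ((l : ℝ) - k) else 0)) :=
        Finset.sum_le_sum fun i _ => Finset.sum_le_sum fun j _ => Finset.sum_le_sum fun k _ =>
          Finset.sum_le_sum fun l _ => hterm i j k l
    _ = ∑ i : Fin n, ∑ l : Fin n, 1 / ((i : ℝ) + n - l) *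
        (∑ j : Fin n, ∑ k : Fin n, ((if (i : ℕ) < j then 1 / ((j : ℝ) - i) else 0)
        + (if (k : ℕ) < l then 1 / ((l : ℝ) - k) else 0))) := by
        refine Finset.sum_congr rfl fun i _ => ?_
        simp_rw [Finset.mul_sum]
        exact sum_last_comm _
    _ ≤ ∑ i : Fin n, ∑ l : Fin n, 1 / ((i : ℝ) + n - l) * (2 * n * (1 + Real.log n)) := by
        refine Finset.sum_le_sum fun i _ => Finset.sum_le_sum fun l _ => ?_
        refine mul_le_mul_of_nonneg_left ?_ (one_div_pos.2 (outside_pos i l)).le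
        simp_rw [Finset.sum_add_distrib]
        have e1 := sum_one_div_sub_left_le i
        have e2 := sum_one_div_sub_right_le l
        rw [Finset.sum_comm]
        simp only [Finset.sum_const, Finset.card_univ, Fintype.card_fin, nsmul_eq_mul]
        have e3 := mul_le_mul_of_nonneg_left (add_le_add e1 e2) (Nat.cast_nonneg (α := ℝ) n)
        linarith
    _ = (∑ i : Fin n, ∑ l : Fin n, 1 / ((i : ℝ) + n - l)) * (2 * n * (1 + Real.log n)) := by
        simp_rw [Finset.sum_mul]
    _ ≤ 2 * n * (2 * n * (1 + Real.log n)) :=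
        mul_le_mul_of_nonneg_right sum_one_div_outside_le (by positivity)
    _ = _ := by ring

lemma sum_nested_le :
    ∑ i : Fin n, ∑ j : Fin n, ∑ k : Fin n, ∑ l : Fin n,
      (if (i : ℕ) ≤ k ∧ (k : ℕ) < l ∧ (l : ℕ) ≤ j then
        n / ((i : ℝ) + n - j) * (1 / (((l : ℝ) - k) * ((j : ℝ) - i - (l - k) + 1))) else 0)
      ≤ 4 * n ^ 2 * (1 + Real.log n) := by
  have hH : 0 ≤ 1 + Real.log n := by
    have := Real.log_natCast_nonneg n
    linarith
  have hinner : ∀ i j : Fin n, ∑ k : Fin n, ∑ l : Fin n,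
      (if (i : ℕ) ≤ k ∧ (k : ℕ) < l ∧ (l : ℕ) ≤ j then
        n / ((i : ℝ) + n - j) * (1 / (((l : ℝ) - k) * ((j : ℝ) - i - (l - k) + 1))) else 0)
      ≤ 1 / ((i : ℝ) + n - j) * (2 * n * (1 + Real.log n)) := by
    intro i j
    have ho := outside_pos i j
    rcases lt_or_ge (j : ℕ) i with hji | hij
    · have : ∀ k l : Fin n, ¬ ((i : ℕ) ≤ k ∧ (k : ℕ) < l ∧ (l : ℕ) ≤ j) := by
        intro k l h; omega
      simp only [this, if_false, Finset.sum_const_zero]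
      positivity
    have hij' : ((i : ℕ) : ℝ) ≤ (j : ℕ) := by exact_mod_cast hij
    have hL : (0 : ℝ) < (j : ℝ) - i + 1 := by linarith
    -- with `L = j - i` and `β = l - k`, one has
    -- `1 / (β (L - β + 1)) = 1 / (L + 1) * (1 / β + 1 / (L - β + 1))`
    set c := n / ((i : ℝ) + n - j) * (1 / ((j : ℝ) - i + 1)) with hc
    have hc0 : 0 ≤ c := by positivity
    have hk : ∀ k : Fin n, ∑ l : Fin n, (if (i : ℕ) ≤ k ∧ (k : ℕ) < l ∧ (l : ℕ) ≤ j then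
        n / ((i : ℝ) + n - j) * (1 / (((l : ℝ) - k) * ((j : ℝ) - i - (l - k) + 1))) else 0)
        ≤ if (i : ℕ) ≤ k ∧ (k : ℕ) ≤ j then c * (2 * (1 + Real.log n)) else 0 := by
      intro k
      split_ifs with hikj
      · have e1 : ∑ l : Fin n, (if (i : ℕ) ≤ k ∧ (k : ℕ) < l ∧ (l : ℕ) ≤ j then
            1 / ((l : ℝ) - k) else 0) ≤ 1 + Real.log n :=
          sum_ite_one_div_le (fun l : Fin n => (i : ℕ) ≤ k ∧ (k : ℕ) < l ∧ (l : ℕ) ≤ j)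
            (fun l => (l : ℕ) - k) _ (fun l hl => by rw [Nat.cast_sub hl.2.1.le])
            (fun l hl => by have := l.2; omega) (fun l l' hl hl' h => by ext; omega)
        have e2 : ∑ l : Fin n, (if (i : ℕ) ≤ k ∧ (k : ℕ) < l ∧ (l : ℕ) ≤ j then
            1 / ((j : ℝ) - i - (l - k) + 1) else 0) ≤ 1 + Real.log n :=
          sum_ite_one_div_le (fun l : Fin n => (i : ℕ) ≤ k ∧ (k : ℕ) < l ∧ (l : ℕ) ≤ j)
            (fun l => (j : ℕ) + k + 1 - i - l) _
            (fun l hl => by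
              rw [Nat.sub_sub, Nat.cast_sub (by omega)]
              push_cast
              ring)
            (fun l hl => by have := j.2; omega) (fun l l' hl hl' h => by ext; omega)
        have e3 : ∀ l : Fin n, (if (i : ℕ) ≤ k ∧ (k : ℕ) < l ∧ (l : ℕ) ≤ j then
            n / ((i : ℝ) + n - j) * (1 / (((l : ℝ) - k) * ((j : ℝ) - i - (l - k) + 1))) else 0)
            = c * ((if (i : ℕ) ≤ k ∧ (k : ℕ) < l ∧ (l : ℕ) ≤ j then 1 / ((l : ℝ) - k) else 0)
              + (if (i : ℕ) ≤ k ∧ (k : ℕ) < l ∧ (l : ℕ) ≤ j then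
                1 / ((j : ℝ) - i - (l - k) + 1) else 0)) := by
          intro l
          split_ifs with h
          · have a1 : ((i : ℕ) : ℝ) ≤ (k : ℕ) := by exact_mod_cast h.1
            have a2 : ((k : ℕ) : ℝ) < (l : ℕ) := by exact_mod_cast h.2.1
            have a3 : ((l : ℕ) : ℝ) ≤ (j : ℕ) := by exact_mod_cast h.2.2
            have b1 : (l : ℝ) - k ≠ 0 := by linarith
            have b2 : (j : ℝ) - i - (l - k) + 1 ≠ 0 := by linarith
            rw [hc]
            field_simp
            ring
          · simp
        simp_rw [e3, ← Finset.mul_sum, Finset.sum_add_distrib]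
        refine mul_le_mul_of_nonneg_left ?_ hc0
        linarith
      · refine (Finset.sum_eq_zero fun l _ => if_neg ?_).le
        omega
    refine (Finset.sum_le_sum fun k _ => hk k).trans ?_
    rw [sum_ite_between i j hij, hc]
    apply le_of_eq
    field_simp
  calc _ ≤ ∑ i : Fin n, ∑ j : Fin n, 1 / ((i : ℝ) + n - j) * (2 * n * (1 + Real.log n)) :=
        Finset.sum_le_sum fun i _ => Finset.sum_le_sum fun j _ => hinner i j
    _ = (∑ i : Fin n, ∑ l : Fin n, 1 / ((i : ℝ) + n - l)) * (2 * n * (1 + Real.log n)) := by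
        simp_rw [Finset.sum_mul]
    _ ≤ 2 * n * (2 * n * (1 + Real.log n)) :=
        mul_le_mul_of_nonneg_right sum_one_div_outside_le (by positivity)
    _ = _ := by ring

lemma sum_interlaced_le :
    ∑ i : Fin n, ∑ j : Fin n, ∑ k : Fin n, ∑ l : Fin n,
      (if (i : ℕ) ≤ k ∧ (k : ℕ) ≤ j ∧ (j : ℕ) < l ∧ (i : ℕ) < j then
        n / ((i : ℝ) + n - l) * (1 / (((j : ℝ) - i) * ((l : ℝ) - j))) else 0)
      ≤ 4 * n ^ 2 * (1 + Real.log n) := by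
  have hH : 0 ≤ 1 + Real.log n := by
    have := Real.log_natCast_nonneg n
    linarith
  have hk : ∀ i j l : Fin n, ∑ k : Fin n,
      (if (i : ℕ) ≤ k ∧ (k : ℕ) ≤ j ∧ (j : ℕ) < l ∧ (i : ℕ) < j then
        n / ((i : ℝ) + n - l) * (1 / (((j : ℝ) - i) * ((l : ℝ) - j))) else 0)
      ≤ 1 / ((i : ℝ) + n - l) * (2 * n) * (if (j : ℕ) < l then 1 / ((l : ℝ) - j) else 0) := by
    intro i j l
    have ho := outside_pos i l
    by_cases h : (j : ℕ) < l ∧ (i : ℕ) < j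
    · have a1 : ((j : ℕ) : ℝ) < (l : ℕ) := by exact_mod_cast h.1
      have a2 : ((i : ℕ) : ℝ) + 1 ≤ (j : ℕ) := by exact_mod_cast h.2
      have b1 : (0 : ℝ) < (l : ℝ) - j := by linarith
      have b2 : (1 : ℝ) ≤ (j : ℝ) - i := by linarith
      have b3 : (0 : ℝ) < (j : ℝ) - i := by linarith
      simp only [h, and_true, if_true]
      rw [sum_ite_between i j h.2.le]
      calc ((j : ℝ) - i + 1) * (n / ((i : ℝ) + n - l) * (1 / (((j : ℝ) - i) * ((l : ℝ) - j))))
          ≤ (2 * ((j : ℝ) - i)) *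
            (n / ((i : ℝ) + n - l) * (1 / (((j : ℝ) - i) * ((l : ℝ) - j)))) := by
            refine mul_le_mul_of_nonneg_right (by linarith) (by positivity)
        _ = _ := by field_simp
    · have : ∀ k : Fin n, ¬ ((i : ℕ) ≤ k ∧ (k : ℕ) ≤ j ∧ (j : ℕ) < l ∧ (i : ℕ) < j) :=
        fun k hk => h hk.2.2
      simp only [this, if_false, Finset.sum_const_zero]
      split_ifs with h'
      · have a1 : ((j : ℕ) : ℝ) < (l : ℕ) := by exact_mod_cast h'
        have := sub_pos.2 a1
        positivity
      · simp
  calc _ = ∑ i : Fin n, ∑ l : Fin n, ∑ j : Fin n, ∑ k : Fin n,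
      (if (i : ℕ) ≤ k ∧ (k : ℕ) ≤ j ∧ (j : ℕ) < l ∧ (i : ℕ) < j then
        n / ((i : ℝ) + n - l) * (1 / (((j : ℝ) - i) * ((l : ℝ) - j))) else 0) := by
        refine Finset.sum_congr rfl fun i _ => ?_
        exact sum_last_comm _
    _ ≤ ∑ i : Fin n, ∑ l : Fin n, ∑ j : Fin n,
        1 / ((i : ℝ) + n - l) * (2 * n) * (if (j : ℕ) < l then 1 / ((l : ℝ) - j) else 0) :=
        Finset.sum_le_sum fun i _ => Finset.sum_le_sum fun l _ => Finset.sum_le_sum fun j _ =>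
          hk i j l
    _ ≤ ∑ i : Fin n, ∑ l : Fin n, 1 / ((i : ℝ) + n - l) * (2 * n * (1 + Real.log n)) := by
        refine Finset.sum_le_sum fun i _ => Finset.sum_le_sum fun l _ => ?_
        have ho := outside_pos i l
        have hc : 0 ≤ 1 / ((i : ℝ) + n - l) * (2 * n) := by positivity
        rw [← Finset.mul_sum]
        exact (mul_le_mul_of_nonneg_left (sum_one_div_sub_right_le l) hc).trans_eq (by ring)
    _ = (∑ i : Fin n, ∑ l : Fin n, 1 / ((i : ℝ) + n - l)) * (2 * n * (1 + Real.log n)) := by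
        simp_rw [Finset.sum_mul]
    _ ≤ 2 * n * (2 * n * (1 + Real.log n)) :=
        mul_le_mul_of_nonneg_right sum_one_div_outside_le (by positivity)
    _ = _ := by ring

lemma sum_pairError_le (n m : ℕ) :
    ∑ i : Fin n, ∑ j : Fin n, ∑ k : Fin n, ∑ l : Fin n, pairError n m i j k l
      ≤ (2 * m ^ 2 + 12) * (n ^ 2 * (1 + Real.log n)) := by
  have hH : 1 ≤ 1 + Real.log n := by
    have := Real.log_natCast_nonneg n
    linarith
  have e1 : ∑ i : Fin n, ∑ j : Fin n, ∑ _k : Fin n, ∑ _l : Fin n,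
      (if (i : ℕ) < m ∧ n ≤ (j : ℕ) + m then (1 : ℝ) else 0) ≤ n ^ 2 * m ^ 2 := by
    simp only [Finset.sum_const, Finset.card_univ, Fintype.card_fin, nsmul_eq_mul,
      ← Finset.mul_sum]
    rw [← mul_assoc, ← sq]
    exact mul_le_mul_of_nonneg_left (sum_ends_le m) (by positivity)
  have e2 : ∑ i : Fin n, ∑ _j : Fin n, ∑ _k : Fin n, ∑ l : Fin n,
      (if (i : ℕ) < m ∧ n ≤ (l : ℕ) + m then (1 : ℝ) else 0) ≤ n ^ 2 * m ^ 2 := by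
    simp only [Finset.sum_const, Finset.card_univ, Fintype.card_fin, nsmul_eq_mul,
      ← Finset.mul_sum]
    rw [← mul_assoc, ← sq]
    exact mul_le_mul_of_nonneg_left (sum_ends_le m) (by positivity)
  have e3 := sum_disjoint_le (n := n)
  have e4 := sum_nested_le (n := n)
  have e5 := sum_interlaced_le (n := n)
  simp only [pairError, Finset.sum_add_distrib]
  have h6 : (n : ℝ) ^ 2 * m ^ 2 ≤ n ^ 2 * m ^ 2 * (1 + Real.log n) :=
    le_mul_of_one_le_right (by positivity) hH
  linarith

/-! ### The variance -/

/-- The pairs of edges, the first one with the smaller index, which are not adjacent along the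
closed polygon. -/
def edgePairs (n : ℕ) : Finset (Fin n × Fin n) :=
  Finset.univ.filter fun p => (p.1 : ℕ) + 2 ≤ p.2 ∧ (p.2 : ℕ) ≠ p.1 + (n - 1)

lemma selfIntersections_eq_sum (s : Fin n → ℂ) :
    (selfIntersections n s : ℝ)
      = ∑ p ∈ edgePairs n, (crossing p.1 p.2).indicator (fun _ => (1 : ℝ)) s := by
  classical
  have h : {p : Fin n × Fin n | (p.1 : ℕ) + 2 ≤ (p.2 : ℕ) ∧ (p.2 : ℕ) ≠ (p.1 : ℕ) + (n - 1) ∧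
      EdgesCross s p.1 p.2} = ((edgePairs n).filter fun p => s ∈ crossing p.1 p.2 :) := by
    ext p
    simp [edgePairs, crossing, and_assoc]
  rw [selfIntersections, h, Set.ncard_coe_finset, Finset.card_filter]
  push_cast
  rfl

lemma variance_sum_indicator {Ω ι : Type*} [MeasurableSpace Ω] (P : Measure Ω)
    [IsProbabilityMeasure P] (t : Finset ι) (E : ι → Set Ω) (hE : ∀ p ∈ t, MeasurableSet (E p)) :
    variance (fun s => ∑ p ∈ t, (E p).indicator (fun _ => (1 : ℝ)) s) P
      = ∑ p ∈ t, ∑ q ∈ t, P.real (E p ∩ E q) - (∑ p ∈ t, P.real (E p)) ^ 2 := by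
  have hint : ∀ A : Set Ω, MeasurableSet A → Integrable (A.indicator fun _ => (1 : ℝ)) P :=
    fun A hA => (integrable_const 1).indicator hA
  have hL : MemLp (fun s => ∑ p ∈ t, (E p).indicator (fun _ => (1 : ℝ)) s) 2 P :=
    memLp_finsetSum _ fun p hp => (memLp_const (1 : ℝ)).indicator (hE p hp)
  have h1 : ∀ A : Set Ω, MeasurableSet A → ∫ s, A.indicator (fun _ => (1 : ℝ)) s ∂P = P.real A := by
    intro A hA
    rw [integral_indicator_const _ hA, smul_eq_mul, mul_one]
  rw [variance_eq_sub hL]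
  congr 1
  · have h2 : ∀ s, ((fun s => ∑ p ∈ t, (E p).indicator (fun _ => (1 : ℝ)) s) ^ 2) s
        = ∑ p ∈ t, ∑ q ∈ t, (E p ∩ E q).indicator (fun _ => (1 : ℝ)) s := by
      intro s
      simp only [Pi.pow_apply, sq, Finset.sum_mul_sum]
      refine Finset.sum_congr rfl fun p _ => Finset.sum_congr rfl fun q _ => ?_
      have := Set.inter_indicator_mul (s := E p) (t := E q) (fun _ => (1 : ℝ))
        (fun _ => (1 : ℝ)) s
      simp only [mul_one] at this
      exact this.symm
    simp_rw [h2]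
    rw [integral_finsetSum _ fun p hp => integrable_finsetSum _ fun q hq =>
      hint _ ((hE p hp).inter (hE q hq))]
    refine Finset.sum_congr rfl fun p hp => ?_
    rw [integral_finsetSum _ fun q hq => hint _ ((hE p hp).inter (hE q hq))]
    exact Finset.sum_congr rfl fun q hq => h1 _ ((hE p hp).inter (hE q hq))
  · rw [integral_finsetSum _ fun p hp => hint _ (hE p hp)]
    exact congrArg (· ^ 2) (Finset.sum_congr rfl fun p hp => h1 _ (hE p hp))

lemma pairError_nonneg (m : ℕ) (i j k l : Fin n) : 0 ≤ pairError n m i j k l := by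
  obtain ⟨t1, t2, t3, t4, t5⟩ := pairError_summands_nonneg (n := n) (m := m)
    (i := i) (k := k) j.2 l.2
  unfold pairError
  positivity

/-- With `Q` the expected number of crossings of the walk, the variance is at most the sum of the
excesses of the pair probabilities over the products of the crossing probabilities of the walk,
plus the loss `O(n Q)` in replacing `Q ^ 2` by the square of the mean for the polygon. -/
lemma exists_variance_le :
    ∃ C : ℝ, 0 ≤ C ∧ ∃ N : ℕ, ∀ n : ℕ, N ≤ n → smoothRank ≤ n ∧ 0 < sumDensity n 0 ∧
      ∀ P : Measure (Fin n → ℂ), IsPolygonLaw n P →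
        variance (fun s : Fin n → ℂ => (selfIntersections n s : ℝ)) P
          ≤ C * (n ^ 2 * (1 + Real.log n)) := by
  obtain ⟨C, hC, N, hN⟩ := exists_crossing_bounds
  have hC0 : 0 < C := by linarith
  refine ⟨2 * C * (2 * smoothRank ^ 2 + 12) + 2 * C ^ 2, by positivity, max N 1, fun n hn => ?_⟩
  obtain ⟨h1, h2, h3⟩ := hN n ((le_max_left _ _).trans hn)
  refine ⟨h1, h2, fun P hP => ?_⟩
  have := hP.1
  obtain ⟨hW, hlow, hpair⟩ := h3 P hP
  have hn1 : (1 : ℝ) ≤ n := by exact_mod_cast (le_max_right _ _).trans hn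
  have hlog : 0 ≤ Real.log n := Real.log_natCast_nonneg n
  have hmem : ∀ p ∈ edgePairs n, (p.1 : ℕ) + 2 ≤ p.2 := fun p hp => (Finset.mem_filter.1 hp).2.1
  have hle : ∀ p ∈ edgePairs n, p.1 ≤ p.2 := fun p hp => by
    have := hmem p hp
    change (p.1 : ℕ) ≤ p.2
    omega
  have hmeas : ∀ p ∈ edgePairs n, MeasurableSet (crossing p.1 p.2) := fun p hp =>
    measurableSet_crossing (hle p hp)
  simp_rw [selfIntersections_eq_sum]
  rw [variance_sum_indicator P (edgePairs n) (fun p => crossing p.1 p.2) hmeas]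
  set Q := ∑ p ∈ edgePairs n, (walkLaw n).real (crossing p.1 p.2) with hQ
  set M := ∑ p ∈ edgePairs n, P.real (crossing p.1 p.2) with hM
  have hQ0 : 0 ≤ Q := Finset.sum_nonneg fun _ _ => measureReal_nonneg
  have hM0 : 0 ≤ M := Finset.sum_nonneg fun _ _ => measureReal_nonneg
  have hpos : ∀ i j : Fin n, (0 : ℝ) ≤ if (i : ℕ) < j then 1 / ((j : ℝ) - i) else 0 := by
    intro i j
    split_ifs with h
    · have e1 : ((i : ℕ) : ℝ) < (j : ℕ) := by exact_mod_cast h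
      have := sub_pos.2 e1
      positivity
    · rfl
  have hQle : Q ≤ C * (n * (1 + Real.log n)) := by
    calc Q ≤ ∑ p ∈ edgePairs n, C * (if (p.1 : ℕ) < p.2 then 1 / ((p.2 : ℝ) - p.1) else 0) := by
          refine Finset.sum_le_sum fun p hp => ?_
          have hlt : (p.1 : ℕ) < p.2 := by have := hmem p hp; omega
          rw [if_pos hlt, mul_one_div]
          exact hW _ _ hlt
      _ ≤ ∑ p : Fin n × Fin n, C * (if (p.1 : ℕ) < p.2 then 1 / ((p.2 : ℝ) - p.1) else 0) :=
          Finset.sum_le_sum_of_subset_of_nonneg (Finset.subset_univ _)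
            fun p _ _ => mul_nonneg hC0.le (hpos _ _)
      _ = C * ∑ i : Fin n, ∑ j : Fin n, (if (i : ℕ) < j then 1 / ((j : ℝ) - i) else 0) := by
          rw [← Finset.mul_sum, Fintype.sum_prod_type]
      _ ≤ C * ∑ _i : Fin n, (1 + Real.log n) :=
          mul_le_mul_of_nonneg_left (Finset.sum_le_sum fun i _ => sum_one_div_sub_left_le i) hC0.le
      _ = C * (n * (1 + Real.log n)) := by
          rw [Finset.sum_const, Finset.card_univ, Fintype.card_fin, nsmul_eq_mul]
  have hMQ : Q - C * n ≤ M := by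
    have hcard : ((edgePairs n).card : ℝ) ≤ n * n := by
      have := Finset.card_le_univ (edgePairs n)
      rw [Fintype.card_prod, Fintype.card_fin] at this
      exact_mod_cast this
    have e1 : ∑ p ∈ edgePairs n, ((walkLaw n).real (crossing p.1 p.2) - C / n) ≤ M :=
      Finset.sum_le_sum fun p hp => hlow _ _ (hmem p hp)
    rw [Finset.sum_sub_distrib, Finset.sum_const, nsmul_eq_mul] at e1
    have e2 : ((edgePairs n).card : ℝ) * (C / n) ≤ n * n * (C / n) :=
      mul_le_mul_of_nonneg_right hcard (by positivity)
    have e3 : (n : ℝ) * n * (C / n) = C * n := by field_simp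
    linarith
  have hMsq : Q ^ 2 - 2 * (C * n) * Q ≤ M ^ 2 := by
    have hCn : 0 ≤ C * n := by positivity
    rcases le_total Q (C * n) with h | h
    -- here the left hand side is not positive
    · nlinarith [sq_nonneg M]
    · have := pow_le_pow_left₀ (sub_nonneg.2 h) hMQ 2
      nlinarith [sq_nonneg (C * n)]
  have hsecond : ∑ p ∈ edgePairs n, ∑ q ∈ edgePairs n,
      P.real (crossing p.1 p.2 ∩ crossing q.1 q.2)
      ≤ Q ^ 2 + 2 * C * ((2 * smoothRank ^ 2 + 12) * (n ^ 2 * (1 + Real.log n))) := by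
    have hterm : ∀ p ∈ edgePairs n, ∀ q ∈ edgePairs n,
        P.real (crossing p.1 p.2 ∩ crossing q.1 q.2)
        ≤ (walkLaw n).real (crossing p.1 p.2) * (walkLaw n).real (crossing q.1 q.2)
          + C * (pairError n smoothRank p.1 p.2 q.1 q.2
            + pairError n smoothRank q.1 q.2 p.1 p.2) := by
      intro p hp q hq
      have n1 := mul_nonneg hC0.le (pairError_nonneg smoothRank p.1 p.2 q.1 q.2)
      have n2 := mul_nonneg hC0.le (pairError_nonneg smoothRank q.1 q.2 p.1 p.2)
      rcases le_total p.1 q.1 with h | h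
      · have := hpair _ _ _ _ (hmem p hp) (hmem q hq) h
        linarith
      · have := hpair _ _ _ _ (hmem q hq) (hmem p hp) h
        rw [Set.inter_comm]
        linarith
    have hS : ∑ p ∈ edgePairs n, ∑ q ∈ edgePairs n, pairError n smoothRank p.1 p.2 q.1 q.2
        ≤ (2 * smoothRank ^ 2 + 12) * (n ^ 2 * (1 + Real.log n)) := by
      refine le_trans ?_ (sum_pairError_le n smoothRank)
      calc _ ≤ ∑ p : Fin n × Fin n, ∑ q : Fin n × Fin n,
            pairError n smoothRank p.1 p.2 q.1 q.2 := by
            refine (Finset.sum_le_sum fun p _ => Finset.sum_le_sum_of_subset_of_nonneg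
              (Finset.subset_univ _) fun q _ _ => pairError_nonneg _ _ _ _ _).trans ?_
            exact Finset.sum_le_sum_of_subset_of_nonneg (Finset.subset_univ _) fun p _ _ =>
              Finset.sum_nonneg fun q _ => pairError_nonneg _ _ _ _ _
        _ = _ := by simp_rw [Fintype.sum_prod_type]
    have hS' : ∑ p ∈ edgePairs n, ∑ q ∈ edgePairs n, pairError n smoothRank q.1 q.2 p.1 p.2
        ≤ (2 * smoothRank ^ 2 + 12) * (n ^ 2 * (1 + Real.log n)) := by
      rw [Finset.sum_comm]
      exact hS
    refine (Finset.sum_le_sum fun p hp => Finset.sum_le_sum fun q hq => hterm p hp q hq).trans ?_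
    simp_rw [Finset.sum_add_distrib, ← Finset.mul_sum, Finset.sum_add_distrib, ← Finset.sum_mul]
    have := mul_le_mul_of_nonneg_left (add_le_add hS hS') hC0.le
    rw [← hQ, ← sq]
    linarith
  have hQn : 2 * (C * n) * Q ≤ 2 * (C * n) * (C * (n * (1 + Real.log n))) :=
    mul_le_mul_of_nonneg_left hQle (by positivity)
  linarith

end RandomPolygon

theorem mainTheorem4 :
    ∃ C : ℝ, ∀ᶠ n : ℕ in atTop,
      (∃! P : Measure (Fin n → ℂ), RandomPolygon.IsPolygonLaw n P) ∧
      ∀ P : Measure (Fin n → ℂ), RandomPolygon.IsPolygonLaw n P →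
        ProbabilityTheory.variance
            (fun s : Fin n → ℂ => (RandomPolygon.selfIntersections n s : ℝ)) P
          ≤ C * ((n : ℝ) ^ 2 * Real.log n) := by
  obtain ⟨C, hC, N, hN⟩ := RandomPolygon.exists_variance_le
  refine ⟨2 * C, ?_⟩
  filter_upwards [eventually_ge_atTop (max N 3)] with n hn
  obtain ⟨h1, h2, h3⟩ := hN n ((le_max_left _ _).trans hn)
  obtain ⟨P, hP⟩ := RandomPolygon.exists_isPolygonLaw h1 h2
  refine ⟨⟨P, hP, fun P' hP' => hP'.unique hP⟩, fun P hP => (h3 P hP).trans ?_⟩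
  have hlog : 1 ≤ Real.log n := by
    rw [Real.le_log_iff_exp_le (by exact_mod_cast Nat.lt_of_lt_of_le (by norm_num) hn)]
    have hn3 : (3 : ℝ) ≤ n := by exact_mod_cast (le_max_right N 3).trans hn
    linarith [Real.exp_one_lt_d9]
  have : (n : ℝ) ^ 2 * (1 + Real.log n) ≤ n ^ 2 * (2 * Real.log n) :=
    mul_le_mul_of_nonneg_left (by linarith) (by positivity)
  calc C * ((n : ℝ) ^ 2 * (1 + Real.log n)) ≤ C * (n ^ 2 * (2 * Real.log n)) :=
        mul_le_mul_of_nonneg_left this hC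
    _ = _ := by ring
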